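/- **Setting.** Let $\kappa$ be a field of characteristic $0$, $G$ a finite abelian group, and $\beta:G\times G\to\kappa^\times$ a symmetric bicharacter: $\beta(ab,c)=\beta(a,c)\beta(b,c)$, $\beta(a,bc)=\beta(a,b)\beta(a,c)$, $\beta(a,b)\beta(b,a)=1$. Let $V=\bigoplus_{a\in G}V_a$ be a $G$-graded $\kappa$-vector space with a nondegenerate bilinear form satisfying $\langle V_a,V_b\rangle=0$ for $a\ne b^{-1}$ and $\langle v,w\rangle=-\beta(b,a)\langle w,v\rangle$ for $v\in V_a$, $w\in V_b$. For homogeneous elements write $\beta(v,w)$ for $\beta(\deg v,\deg w)$. Let $r\ge 1$, $s\ge 0$ and $n\in\{2s,2s+1\}$, and let $B=\{t_1,t_1^*,\dots,t_r,t_r^*,u_1,u_1^*,\dots,u_s,u_s^*,(u_{s+1})\}$ be a homogeneous basis of $V$, where $u_{s+1}=u_{s+1}^*$ occurs only if $n=2s+1$, such that $\beta(b,b)=1$ for $b=t_i,t_i^*$ and $\beta(b,b)=-1$ for the other elements, and such that the matrix $F_{b,b'}=\langle b,b'\rangle$ has $F_{t_i,t_i^*}=1$, $F_{t_i^*,t_i}=-1$,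 $F_{u_j,u_j^*}=F_{u_j^*,u_j}=1$ and all other entries $0$. Let $\mathfrak g=\mathfrak{spo}(V,\beta)=\bigoplus_a\mathfrak g_a\subseteq \mathrm{End}(V)$, where $\mathfrak g_a$ consists of the $x$ with $xV_b\subseteq V_{ab}$ and $\langle xu,v\rangle+\beta(b,a)\langle u,xv\rangle=0$ for all $b\in G$, $u\in V_b$, $v\in V$; its bracket is $[x,y]=xy-\beta(b,a)yx$ for $x\in\mathfrak g_a,\ y\in\mathfrak g_b$. It acts on $V^{\otimes k}$ by $x(v_1\otimes\cdots\otimes v_k)=\sum_i\big(\prod_{j<i}\beta(\deg v_j,a)\big)\,v_1\otimes\cdots\otimes xv_i\otimes\cdots\otimes v_k$ for $x\in\mathfrak g_a$ and homogeneous $v_j$. Let $\mathfrak h$ be the space of elements of $\mathfrak g$ that are diagonal in the basis $B$, and let $\omega_1,\dots,\omega_{r+s}\in\mathfrak h^*$ read off the diagonal entries at $t_1,\dots,t_r,u_1,\dots,u_s$. The simple roots are $\omega_i-\omega_{i+1}$ for $1\le i<r+s$, together with $\omega_{r+s}$ if $n$ is odd, $\omega_{r+s-1}+\omega_{r+s}$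 if $n\ge 2$ is even, and $2\omega_r$ if $n=0$. A root is an $\alpha\in\mathfrak h^*\setminus\{0\}$ with $\mathfrak g^\alpha=\{x\in\mathfrak g: [h,x]=\alpha(h)x\ \forall h\in\mathfrak h\}\neq 0$; it is positive if it is a nonnegative integral combination of simple roots, and $\mathfrak g_+=\sum_{\alpha>0}\mathfrak g^\alpha$. A vector $\theta\in V^{\otimes k}$ is a *maximal vector* if $\mathfrak g_+\theta=0$ and there is a $\mu\in\mathfrak h^*$ with $h\theta=\mu(h)\theta$ for all $h\in\mathfrak h$. **Brauer diagram operators.** The symmetric group $S_k$, in which $\psi\gamma$ means first $\psi$ and then $\gamma$, acts on $V^{\otimes k}$ on the right: for $a_1,\dots,a_k\in B$, $$(a_1\otimes\cdots\otimes a_k)\,\sigma=\Big(\prod_{i<j,\ \sigma(i)>\sigma(j)}-\beta(a_j,a_i)\Big)\,a_{\sigma^{-1}(1)}\otimes\cdots\otimes a_{\sigma^{-1}(k)} .$$ For $p<q$ the contraction $c_{p,q}$ (the operator of the Brauer diagram with edges $\{p,q\}$ on the top and on the bottom and all other edges vertical) is $$(a_1\otimes\cdots\otimes a_k)\,c_{p,q}=F_{a_p,a_q}\prod_{p<i<q}\beta(a_i,a_p)\sum_{b,b'\in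 B}F^{-1}_{b,b'}\Big(\prod_{p<i<q}\beta(a_i,b')\Big)\,a_1\otimes\cdots\otimes b\otimes\cdots\otimes b'\otimes\cdots\otimes a_k ,$$ with $b,b'$ in the positions $p,q$ and $F^{-1}$ the inverse matrix of $F$. **The vectors.** Let $k\ge0$. A contraction datum $(\underline p,\underline q)\in\mathfrak p$ is a (possibly empty) set of pairwise disjoint pairs $(p_1,q_1),\dots,(p_j,q_j)$ in $\{1,\dots,k\}$ with $p_i<q_i$, listed so that $p_1<\dots<p_j$; put $c_{\underline p,\underline q}=c_{p_1,q_1}\cdots c_{p_j,q_j}$ (the identity if $j=0$), and let $(\underline p\cup\underline q)^c$ be the set of remaining positions. For $L\subseteq\{1,\dots,k\}$ let $\mathcal{HST}_{r,s}(L)$ be the set of standard tableaux (rows and columns increasing, each element of $L$ used exactly once) whose shape $\lambda\vdash|L|$ satisfies $\lambda_{r+1}\le s$. For such $T$ let $R_T,C_T\le S_k$ be its row and column groups (fixing the positions outside $L$), let $s_T=\sum_{\psi\in R_T,\ \gamma\in C_T}\operatorname{sgn}(\psi)\,\psi\gamma$, let $h(\lambda)$ be the positive integer with $s_T^2=h(\lambda)s_T$,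 and put $y_T=h(\lambda)^{-1}s_T$. For $T\in\mathcal{HST}_{r,s}((\underline p\cup\underline q)^c)$ let $w_{T,\underline p,\underline q}=w_1\otimes\cdots\otimes w_k$, where $w_i=t_1$ if $i\in\underline p$; $w_i=t_1^*$ if $i\in\underline q$; $w_i=t_a$ if $i$ lies in row $a\le r$ of $T$; and $w_i=u_c$ if $i$ lies in column $c$ of $T$ and in a row below the $r$-th. **Theorem 3.11.** Suppose $r+s\ge k$. Then the vectors $$w_{T,\underline p,\underline q}\,c_{\underline p,\underline q}\,y_T,\qquad (\underline p,\underline q)\in\mathfrak p,\quad T\in\mathcal{HST}_{r,s}\big((\underline p\cup\underline q)^c\big),$$ are maximal vectors of $V^{\otimes k}$, and the family of these vectors, indexed by the pairs $((\underline p,\underline q),T)$, is linearly independent. -/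

import Mathlib

open scoped TensorProduct
open Module

noncomputable section

namespace Spo

/-! ### Lie color algebras: bicharacters, gradings, the algebra `spo(V, β)` -/

section ColorAlgebra

variable {κ G V : Type*} [Field κ] [CommGroup G] [Fintype G] [DecidableEq G]
  [AddCommGroup V] [Module κ V]

/-- Symmetric bicharacters `β : G × G → κˣ`. -/
structure IsSymmetricBicharacter (β : G → G → κˣ) : Prop where
  mul_left : ∀ a b c, β (a * b) c = β a c * β b c
  mul_right : ∀ a b c, β a (b * c) = β a b * β a c
  symm : ∀ a b, β a b * β b a = 1

/-- Nondegenerate `β`-skew-symmetric bilinear forms on the graded space `V = ⨁ a, 𝒱 a`. -/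
structure IsColorSkewForm (β : G → G → κˣ) (𝒱 : G → Submodule κ V)
    (form : LinearMap.BilinForm κ V) : Prop where
  nondegenerate : form.Nondegenerate
  orthogonal : ∀ a b, a ≠ b⁻¹ → ∀ v ∈ 𝒱 a, ∀ w ∈ 𝒱 b, form v w = 0
  skew : ∀ a b, ∀ v ∈ 𝒱 a, ∀ w ∈ 𝒱 b, form v w = -(β b a : κ) * form w v

/-- The projection of `V` onto its homogeneous component of degree `a`. -/
def gradeProj (𝒱 : G → Submodule κ V) [DirectSum.Decomposition 𝒱] (a : G) : V →ₗ[κ] V :=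
  (𝒱 a).subtype ∘ₗ DirectSum.component κ G (fun g => 𝒱 g) a ∘ₗ
    (DirectSum.decomposeLinearEquiv 𝒱).toLinearMap

/-- The homogeneous component `gl(V, β)_a`. -/
def glHom (𝒱 : G → Submodule κ V) (a : G) : Submodule κ (End κ V) where
  carrier := {x | ∀ b, ∀ v ∈ 𝒱 b, x v ∈ 𝒱 (a * b)}
  add_mem' hx hy b v hv := (𝒱 (a * b)).add_mem (hx b v hv) (hy b v hv)
  zero_mem' b _ _ := (𝒱 (a * b)).zero_mem
  smul_mem' c _ hx b v hv := (𝒱 (a * b)).smul_mem c (hx b v hv)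

/-- The degree `a` component of an endomorphism of `V`. -/
def homPart (𝒱 : G → Submodule κ V) [DirectSum.Decomposition 𝒱] (a : G) (x : End κ V) :
    End κ V :=
  ∑ b, gradeProj 𝒱 (a * b) ∘ₗ x ∘ₗ gradeProj 𝒱 b

/-- The color bracket on `gl(V, β)`: the bilinear extension of
`[x, y] = x y - β(b, a) y x` for `x` of degree `a` and `y` of degree `b`. -/
def colorBracket (β : G → G → κˣ) (𝒱 : G → Submodule κ V) [DirectSum.Decomposition 𝒱]
    (x y : End κ V) : End κ V :=
  ∑ a, ∑ b, (homPart 𝒱 a x * homPart 𝒱 b y - (β b a : κ) • (homPart 𝒱 b y * homPart 𝒱 a x))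

/-- The homogeneous component `spo(V, β)_a`. -/
def spoHom (β : G → G → κˣ) (𝒱 : G → Submodule κ V) (form : LinearMap.BilinForm κ V) (a : G) :
    Submodule κ (End κ V) where
  carrier := {x | x ∈ glHom 𝒱 a ∧
    ∀ b, ∀ u ∈ 𝒱 b, ∀ v, form (x u) v + (β b a : κ) * form u (x v) = 0}
  add_mem' {x y} hx hy := ⟨(glHom 𝒱 a).add_mem hx.1 hy.1, fun b u hu v => by
    have h₁ := hx.2 b u hu v
    have h₂ := hy.2 b u hu v
    simp only [LinearMap.add_apply, map_add]
    linear_combination h₁ + h₂⟩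
  zero_mem' := ⟨(glHom 𝒱 a).zero_mem, fun b u hu v => by simp⟩
  smul_mem' c x hx := ⟨(glHom 𝒱 a).smul_mem c hx.1, fun b u hu v => by
    have h₁ := hx.2 b u hu v
    simp only [LinearMap.smul_apply, map_smul, smul_eq_mul]
    linear_combination c * h₁⟩

/-- The underlying space of the orthosymplectic Lie color algebra `spo(V, β)`. -/
def spo (β : G → G → κˣ) (𝒱 : G → Submodule κ V) (form : LinearMap.BilinForm κ V) :
    Submodule κ (End κ V) :=
  ⨆ a, spoHom β 𝒱 form a

/-- The operator acting on `𝒱 b` as the scalar `β(b, a)`. -/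
def twist (β : G → G → κˣ) (𝒱 : G → Submodule κ V) [DirectSum.Decomposition 𝒱] (a : G) :
    End κ V :=
  ∑ b, (β b a : κ) • gradeProj 𝒱 b

/-- The action of `x` on `V^{⊗k}`; for `x` of degree `a`,
`x (v₁ ⊗ ⋯ ⊗ v_k) = ∑ i, β(v₁, a) ⋯ β(v_{i-1}, a) v₁ ⊗ ⋯ ⊗ x v_i ⊗ ⋯ ⊗ v_k`. -/
def tensorAct (β : G → G → κˣ) (𝒱 : G → Submodule κ V) [DirectSum.Decomposition 𝒱] (k : ℕ)
    (x : End κ V) : End κ (⨂[κ] _ : Fin k, V) :=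
  ∑ a, ∑ i : Fin k, PiTensorProduct.map fun j =>
    if j < i then twist β 𝒱 a else if j = i then homPart 𝒱 a x else LinearMap.id

end ColorAlgebra

/-! ### The homogeneous basis `t_i, t_i^*, u_j, u_j^*, (u_{s+1})` -/

/-- Labels of the basis `B`; here `n = dim V_{(1)} = 2 s + e` with `e ∈ {0, 1}`, and `mid` is the
label of `u_{s+1}`, present only for `e = 1`. -/
inductive Idx (r s e : ℕ) : Type
  | t (i : Fin r) : Idx r s e
  | tStar (i : Fin r) : Idx r s e
  | u (j : Fin s) : Idx r s e
  | uStar (j : Fin s) : Idx r s e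
  | mid (j : Fin e) : Idx r s e
  deriving DecidableEq, Fintype

/-- The involution `b ↦ b^*`. -/
def Idx.star {r s e : ℕ} : Idx r s e → Idx r s e
  | .t i => .tStar i
  | .tStar i => .t i
  | .u j => .uStar j
  | .uStar j => .u j
  | .mid j => .mid j

/-- `β(b, b)` for a basis element `b`: `1` on `B₀` and `-1` on `B₁`. -/
def Idx.parity (κ : Type*) [Ring κ] {r s e : ℕ} : Idx r s e → κ
  | .t _ | .tStar _ => 1
  | .u _ | .uStar _ | .mid _ => -1

/-- The value `⟨b, b^*⟩` for a basis element `b`. -/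
def Idx.pairing (κ : Type*) [Ring κ] {r s e : ℕ} : Idx r s e → κ
  | .tStar _ => -1
  | .t _ | .u _ | .uStar _ | .mid _ => 1

section Basis

variable {κ G V : Type*} [Field κ] [CommGroup G] [Fintype G] [DecidableEq G]
  [AddCommGroup V] [Module κ V] {r s e : ℕ}

/-- `b` is a homogeneous basis of `V`, with degrees `deg`, consisting of a basis
`t_i, t_i^*` of `V_{(0)}` and a basis `u_j, u_j^*, (u_{s+1})` of `V_{(1)}` in which the form is
the standard one. -/
structure IsSpoBasis (β : G → G → κˣ) (𝒱 : G → Submodule κ V) (form : LinearMap.BilinForm κ V)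
    (b : Basis (Idx r s e) κ V) (deg : Idx r s e → G) : Prop where
  homogeneous : ∀ i, b i ∈ 𝒱 (deg i)
  parity : ∀ i, (β (deg i) (deg i) : κ) = i.parity κ
  form_eq : ∀ i j, form (b i) (b j) = if j = i.star then i.pairing κ else 0

/-- The space `𝔥` of diagonal matrices in `spo(V, β)`. -/
def cartan (β : G → G → κˣ) (𝒱 : G → Submodule κ V) (form : LinearMap.BilinForm κ V)
    (b : Basis (Idx r s e) κ V) : Submodule κ (End κ V) where
  carrier := {x | x ∈ spo β 𝒱 form ∧ ∀ i j, i ≠ j → b.repr (x (b j)) i = 0}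
  add_mem' {x y} hx hy := ⟨(spo β 𝒱 form).add_mem hx.1 hy.1, fun i j hij => by
    simp [hx.2 i j hij, hy.2 i j hij]⟩
  zero_mem' := ⟨(spo β 𝒱 form).zero_mem, fun i j _ => by simp⟩
  smul_mem' c x hx := ⟨(spo β 𝒱 form).smul_mem c hx.1, fun i j hij => by
    simp [hx.2 i j hij]⟩

/-- The functional `ε_v ∈ 𝔥^*` reading off the `v`-th diagonal entry. -/
def eps (β : G → G → κˣ) (𝒱 : G → Submodule κ V) (form : LinearMap.BilinForm κ V)
    (b : Basis (Idx r s e) κ V) (v : Idx r s e) : Dual κ (cartan β 𝒱 form b) where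
  toFun h := b.repr (h.1 (b v)) v
  map_add' h h' := by simp
  map_smul' c h := by simp

/-- The sequence `ε_1, …, ε_r, δ_1, …, δ_s` in `𝔥^*` (indexed from `0`). -/
def chain (β : G → G → κˣ) (𝒱 : G → Submodule κ V) (form : LinearMap.BilinForm κ V)
    (b : Basis (Idx r s e) κ V) (i : ℕ) : Dual κ (cartan β 𝒱 form b) :=
  if h : i < r then eps β 𝒱 form b (.t ⟨i, h⟩)
  else if h : i - r < s then eps β 𝒱 form b (.u ⟨i - r, h⟩)
  else 0

/-- The simple roots `α_1, …, α_{r+s}` (indexed from `0`). With `ω_1, …, ω_{r+s}` standing for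
`ε_1, …, ε_r, δ_1, …, δ_s`, they are `ω_i - ω_{i+1}` for `i < r + s` and, in the last place,
`ω_{r+s}` for `n` odd, `ω_{r+s-1} + ω_{r+s}` for `n ≥ 2` even, and `2 ω_r` for `n = 0`. -/
def simpleRoot (β : G → G → κˣ) (𝒱 : G → Submodule κ V) (form : LinearMap.BilinForm κ V)
    (b : Basis (Idx r s e) κ V) (i : Fin (r + s)) : Dual κ (cartan β 𝒱 form b) :=
  let ω := chain β 𝒱 form b
  if i.val + 1 < r + s then ω i.val - ω (i.val + 1)
  else if e = 1 then ω i.val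
  else if s = 0 then (2 : κ) • ω i.val
  else ω (i.val - 1) + ω i.val

/-- The space `𝔤^α = {x ∈ 𝔤 | [h, x] = α(h) x for all h ∈ 𝔥}`. -/
def rootSpace (β : G → G → κˣ) (𝒱 : G → Submodule κ V) [DirectSum.Decomposition 𝒱]
    (form : LinearMap.BilinForm κ V) (b : Basis (Idx r s e) κ V)
    (α : Dual κ (cartan β 𝒱 form b)) : Set (End κ V) :=
  {x | x ∈ spo β 𝒱 form ∧
    ∀ h : cartan β 𝒱 form b, colorBracket β 𝒱 h.1 x = α h • x}

/-- Positive roots: the nonzero roots that are nonnegative integral combinations of the simple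
roots. -/
def IsPositiveRoot (β : G → G → κˣ) (𝒱 : G → Submodule κ V) [DirectSum.Decomposition 𝒱]
    (form : LinearMap.BilinForm κ V) (b : Basis (Idx r s e) κ V)
    (α : Dual κ (cartan β 𝒱 form b)) : Prop :=
  α ≠ 0 ∧ (∃ x ∈ rootSpace β 𝒱 form b α, x ≠ 0) ∧
    ∃ c : Fin (r + s) → ℕ, α = ∑ i, c i • simpleRoot β 𝒱 form b i

/-- `𝔤₊`, the sum of the root spaces of the positive roots. -/
def posPart (β : G → G → κˣ) (𝒱 : G → Submodule κ V) [DirectSum.Decomposition 𝒱]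
    (form : LinearMap.BilinForm κ V) (b : Basis (Idx r s e) κ V) : Submodule κ (End κ V) :=
  Submodule.span κ {x | ∃ α, IsPositiveRoot β 𝒱 form b α ∧ x ∈ rootSpace β 𝒱 form b α}

/-- `θ ∈ V^{⊗k}` is a maximal vector of weight `μ`. -/
def IsMaximalVector (β : G → G → κˣ) (𝒱 : G → Submodule κ V) [DirectSum.Decomposition 𝒱]
    (form : LinearMap.BilinForm κ V) (b : Basis (Idx r s e) κ V) {k : ℕ}
    (μ : Dual κ (cartan β 𝒱 form b)) (θ : ⨂[κ] _ : Fin k, V) : Prop :=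
  (∀ x ∈ posPart β 𝒱 form b, tensorAct β 𝒱 k x θ = 0) ∧
    ∀ h : cartan β 𝒱 form b, tensorAct β 𝒱 k h.1 θ = μ h • θ

end Basis

/-! ### Brauer diagrams and their action on `V^{⊗k}` -/

/-- A `k`-diagram: a perfect matching of the `2k` vertices, `Sum.inl i` being the `i`-th top
vertex and `Sum.inr i` the `i`-th bottom vertex. -/
structure BrauerDiagram (k : ℕ) where
  partner : Fin k ⊕ Fin k → Fin k ⊕ Fin k
  partner_partner : ∀ v, partner (partner v) = v
  partner_ne : ∀ v, partner v ≠ v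

/-- The diagram of a permutation: the `i`-th top vertex is joined to the `σ i`-th bottom one. -/
def BrauerDiagram.ofPerm {k : ℕ} (σ : Equiv.Perm (Fin k)) : BrauerDiagram k where
  partner := Sum.elim (fun i => .inr (σ i)) (fun i => .inl (σ.symm i))
  partner_partner := by rintro (i | i) <;> simp
  partner_ne := by rintro (i | i) <;> simp

/-- The diagram `c_{p,q}`: a horizontal edge joins the `p`-th and `q`-th vertices on the top, and
also on the bottom; all other edges are vertical. -/
def BrauerDiagram.contraction {k : ℕ} (p q : Fin k) (hpq : p ≠ q) : BrauerDiagram k where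
  partner := Sum.elim
    (fun i => if i = p then .inl q else if i = q then .inl p else .inr i)
    (fun i => if i = p then .inr q else if i = q then .inr p else .inl i)
  partner_partner := by
    rintro (i | i) <;> by_cases h₁ : i = p <;> by_cases h₂ : i = q <;>
      simp_all [Ne.symm hpq]
  partner_ne := by
    rintro (i | i) <;> by_cases h₁ : i = p <;> by_cases h₂ : i = q <;>
      simp_all [Ne.symm hpq]

/-- The place of a vertex in the unfolded diagram, whose vertices from left to right are
`1', 2', …, k', k, …, 2, 1`. -/
def unfoldPos {k : ℕ} : Fin k ⊕ Fin k → ℕ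
  | .inl i => 2 * k - 1 - i
  | .inr i => i

section BrauerAction

variable {κ G V I : Type*} [Field κ] [CommGroup G] [AddCommGroup V] [Module κ V]
  [Fintype I] [DecidableEq I]

/-- The matrix `F_B` of the form in the basis `b`. -/
def formMatrix (form : LinearMap.BilinForm κ V) (b : Basis I κ V) : Matrix I I κ :=
  Matrix.of fun i j => form (b i) (b j)

/-- The weight of the edge joining `v` and `w`, where `v` precedes `w` in the unfolded diagram;
the top vertices are labeled by `x` and the bottom ones by `y`. A horizontal top edge `(x, x')`
with `x` to the left has weight `F_{x,x'}`, a horizontal bottom edge `(y, y')` with `y` to the left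
has weight `F⁻¹_{y,y'}`, and a vertical edge `(x, y)` has weight `δ_{x,y}`. -/
def edgeWeight (form : LinearMap.BilinForm κ V) (b : Basis I κ V) {k : ℕ} (x y : Fin k → I) :
    Fin k ⊕ Fin k → Fin k ⊕ Fin k → κ
  | .inl i, .inl j => formMatrix form b (x j) (x i)
  | .inr i, .inr j => (formMatrix form b)⁻¹ (y i) (y j)
  | .inl i, .inr j => if x i = y j then 1 else 0
  | .inr i, .inl j => if x j = y i then 1 else 0

/-- The degree carried by a vertex of the unfolded diagram: the top vertices are turned into dual
ones by unfolding. -/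
def vertexDeg (deg : I → G) {k : ℕ} (x y : Fin k → I) : Fin k ⊕ Fin k → G
  | .inl i => (deg (x i))⁻¹
  | .inr i => deg (y i)

/-- The weight of the labeled diagram `d`: the product of the weights of its edges and, for every
crossing, of `-β(g, g')`, where `g, g'` are the degrees carried by the third and the fourth (in
the order of the unfolded diagram) of the four end points of the two crossing edges. -/
def diagramWeight (β : G → G → κˣ) (form : LinearMap.BilinForm κ V) (b : Basis I κ V)
    (deg : I → G) {k : ℕ} (d : BrauerDiagram k) (x y : Fin k → I) : κ :=
  (∏ v, if unfoldPos v < unfoldPos (d.partner v)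
    then edgeWeight form b x y v (d.partner v) else 1) *
  ∏ v, ∏ w, if unfoldPos v < unfoldPos w ∧ unfoldPos w < unfoldPos (d.partner v) ∧
      unfoldPos (d.partner v) < unfoldPos (d.partner w)
    then -(β (vertexDeg deg x y (d.partner v)) (vertexDeg deg x y (d.partner w)) : κ) else 1

/-- The operator `Ψ_d` on `V^{⊗k}`, i.e. `w ↦ w d`. -/
def brauerAct (β : G → G → κˣ) (form : LinearMap.BilinForm κ V) (b : Basis I κ V)
    (deg : I → G) {k : ℕ} (d : BrauerDiagram k) : End κ (⨂[κ] _ : Fin k, V) :=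
  (Basis.piTensorProduct fun _ : Fin k => b).constr κ fun x =>
    ∑ y : Fin k → I, diagramWeight β form b deg d x y • ⨂ₜ[κ] i, b (y i)

/-- The right action of `a ∈ κ S_k` on `V^{⊗k}` by graded place permutations. -/
def permAct (β : G → G → κˣ) (form : LinearMap.BilinForm κ V) (b : Basis I κ V)
    (deg : I → G) {k : ℕ} (a : MonoidAlgebra κ (Equiv.Perm (Fin k))) :
    End κ (⨂[κ] _ : Fin k, V) :=
  ∑ σ, a.coeff σ • brauerAct β form b deg (BrauerDiagram.ofPerm σ)

end BrauerAction

/-! ### Contraction data, tableaux, symmetrizers -/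

/-- Contraction data on `{1, …, k}`: a set of `j` pairwise disjoint pairs `(p_i, q_i)` with
`p_i < q_i`, listed so that `p_1 < ⋯ < p_j`. -/
structure ContractionData (k : ℕ) where
  j : ℕ
  p : Fin j → Fin k
  q : Fin j → Fin k
  p_strictMono : StrictMono p
  q_injective : Function.Injective q
  p_ne_q : ∀ a c, p a ≠ q c
  p_lt_q : ∀ a, p a < q a

/-- The complementary positions `(p ∪ q)^c`. -/
def ContractionData.compl {k : ℕ} (c : ContractionData k) : Finset (Fin k) :=
  Finset.univ.filter fun i => ∀ a, c.p a ≠ i ∧ c.q a ≠ i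

/-- The operator `w ↦ w c_{p_1,q_1} ⋯ c_{p_j,q_j}`. -/
def contract {κ G V I : Type*} [Field κ] [CommGroup G] [AddCommGroup V] [Module κ V]
    [Fintype I] [DecidableEq I] (β : G → G → κˣ) (form : LinearMap.BilinForm κ V)
    (b : Basis I κ V) (deg : I → G) {k : ℕ} (c : ContractionData k)
    (w : ⨂[κ] _ : Fin k, V) : ⨂[κ] _ : Fin k, V :=
  (List.finRange c.j).foldl
    (fun v a => brauerAct β form b deg
      (BrauerDiagram.contraction (c.p a) (c.q a) (c.p_lt_q a).ne) v) w

/-- Standard tableaux with set of entries `L`; `box` gives the box (row, column) of each entry,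
rows and columns being numbered from `0`. -/
structure StandardTableau {k : ℕ} (L : Finset (Fin k)) where
  shape : YoungDiagram
  box : {i // i ∈ L} ≃ {c // c ∈ shape.cells}
  row_increasing : ∀ x y, (box x).1.1 = (box y).1.1 → (box x).1.2 < (box y).1.2 → x < y
  col_increasing : ∀ x y, (box x).1.2 = (box y).1.2 → (box x).1.1 < (box y).1.1 → x < y

/-- The set `HST_{r,s}(L)` of standard tableaux with entries in `L` of `(r, s)`-hook shape, i.e.
`λ_{r+1} ≤ s`. -/
def HookTableau (r s : ℕ) {k : ℕ} (L : Finset (Fin k)) : Type :=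
  {T : StandardTableau L // T.shape.rowLen r ≤ s}

namespace StandardTableau

variable {k : ℕ} {L : Finset (Fin k)}

/-- The row containing the position `i`, if `i` is an entry of `T`. -/
def row (T : StandardTableau L) (i : Fin k) : Option ℕ :=
  if h : i ∈ L then some (T.box ⟨i, h⟩).1.1 else none

/-- The column containing the position `i`, if `i` is an entry of `T`. -/
def col (T : StandardTableau L) (i : Fin k) : Option ℕ :=
  if h : i ∈ L then some (T.box ⟨i, h⟩).1.2 else none

/-- The row group `R_T`. -/
def rowGroup (T : StandardTableau L) : Finset (Equiv.Perm (Fin k)) :=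
  Finset.univ.filter fun σ => (∀ i, i ∉ L → σ i = i) ∧ ∀ i, T.row (σ i) = T.row i

/-- The column group `C_T`. -/
def colGroup (T : StandardTableau L) : Finset (Equiv.Perm (Fin k)) :=
  Finset.univ.filter fun σ => (∀ i, i ∉ L → σ i = i) ∧ ∀ i, T.col (σ i) = T.col i

/-- `s_T = ∑ sgn(ψ) ψ γ` over `ψ ∈ R_T`, `γ ∈ C_T`. Permutations multiply as diagrams do, so the
product of `ψ` and `γ` is the permutation `γ ∘ ψ`. -/
def youngElement (κ : Type*) [Field κ] (T : StandardTableau L) :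
    MonoidAlgebra κ (Equiv.Perm (Fin k)) :=
  ∑ ψ ∈ T.rowGroup, ∑ γ ∈ T.colGroup,
    MonoidAlgebra.single (γ * ψ) (((Equiv.Perm.sign ψ : ℤˣ) : ℤ) : κ)

/-- The number `h` with `s_T² = h s_T`; since `s_T` has coefficient `1` at the identity, it is the
coefficient of `s_T²` at the identity. -/
def hookNumber (κ : Type*) [Field κ] (T : StandardTableau L) : κ :=
  (T.youngElement κ * T.youngElement κ).coeff 1

/-- The symmetrizer `y_T = h⁻¹ s_T`. -/
def symmetrizer (κ : Type*) [Field κ] (T : StandardTableau L) :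
    MonoidAlgebra κ (Equiv.Perm (Fin k)) :=
  (T.hookNumber κ)⁻¹ • T.youngElement κ

end StandardTableau

/-- The basis element placed at the position `x` of a hook tableau: `t_a` if `x` is in the `a`-th
of the first `r` rows, i.e. in the `a`-th row of `T^{(1)}`, and otherwise `u_c` if `x` is in
the `c`-th column of `T`, i.e. in the `c`-th row of the transposed tableau `T^{(2)}`. -/
def HookTableau.letter {r s : ℕ} (e : ℕ) {k : ℕ} {L : Finset (Fin k)} (T : HookTableau r s L)
    (x : {i // i ∈ L}) : Idx r s e :=
  if h : (T.1.box x).1.1 < r then .t ⟨(T.1.box x).1.1, h⟩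
  else .u ⟨(T.1.box x).1.2, lt_of_lt_of_le (YoungDiagram.mem_iff_lt_rowLen.1
    (T.1.shape.up_left_mem (not_lt.1 h) le_rfl (T.1.box x).2)) T.2⟩

/-- The factors of `w_{T,p,q}`: `t_1` at the positions in `p`, `t_1^*` at those in `q`, and the
letters of `T` elsewhere. -/
def simpleLabel {r s : ℕ} (e : ℕ) (hr : 1 ≤ r) {k : ℕ} (c : ContractionData k)
    (T : HookTableau r s c.compl) (i : Fin k) : Idx r s e :=
  open Classical in
  if h : i ∈ c.compl then T.letter e ⟨i, h⟩
  else if ∃ a, c.p a = i then .t ⟨0, hr⟩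
  else .tStar ⟨0, hr⟩

/-- The vector `w_{T,p,q} c_{p,q} y_T`. -/
def theta {κ G V : Type*} [Field κ] [CommGroup G] [AddCommGroup V] [Module κ V] {r s e : ℕ}
    (hr : 1 ≤ r) (β : G → G → κˣ) (form : LinearMap.BilinForm κ V)
    (b : Basis (Idx r s e) κ V) (deg : Idx r s e → G) {k : ℕ} (c : ContractionData k)
    (T : HookTableau r s c.compl) : ⨂[κ] _ : Fin k, V :=
  permAct β form b deg (T.1.symmetrizer κ)
    (contract β form b deg c (⨂ₜ[κ] i, b (simpleLabel e hr c T i)))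

end Spo

end

/-! Maximality. Contractions and graded place permutations commute with the homogeneous elements of
`spo` (`homAct_comm_contraction`, `homAct_comm_permRep`). So `x θ` can be computed by letting `x`
act on the simple tensor `w` and contracting and symmetrizing afterwards; in particular `θ` has the
weight of `w`. A diagonal operator in the Cartan space takes positive integer values on the simple
roots (`simpleRoot_heightOp`), hence an element of `𝔤₊` replaces one factor of `w` by basis elements
of greater height. At a position in `p` the factor `t_1` cannot be raised; at a position in `q`, a
raised `t_1^*` is no longer dual to `t_1` and the contraction gives zero. A raised letter of `T`
either repeats some `u_j` in a row, and the signed row sum kills it, or produces more letters `t_1,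
…, t_n` than there are boxes in the first `n` rows. In the latter case every row rearrangement
repeats some `t_i` in a column and the column sum kills it
(`permAct_symmetrizer_eq_zero_of_raised`).

Independence. Fix an index `(c₀, T₀)`. Since `k ≤ r + s`, there is a labeling `z` with the letters
of `T₀` off the pairs of `c₀` and, on the pairs, distinct labels not used by `T₀` together with
their duals. Project onto the tensors obtained from `z` by rearranging positions off the pairs. A
vector `θ` of index `(c, T)` survives only if `c = c₀` and `T` has the shape of `T₀`: the labels of
negative height reveal the pairs, and the letters reveal the shape. If `σ` carries `T₀` to such a
`T`, the projection is a nonzero multiple of `σ C R` applied to the tensor of `z`, where `C` and `R`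
are the column and row sums of `T₀` (`IsSeparating.labelProj_theta`).

A linear relation thus becomes `A C R e_z = 0` with `A` a combination of the `σ`. Averaging over the
stabilizer of `z`, whose elements factor into column and row permutations of `T₀`, yields `A C R C =
0` (`mul_young_eq_zero_of_lift_eq_zero`). Positivity of the standard inner product on the rational
group algebra removes the last `C`, and triangularity of standard polytabloids in a lexicographic
order forces `A = 0` (`StandardTableau.coeff_eq_zero_of_sum_mul_young_mul`). -/

noncomputable section

namespace Spo

set_option linter.unusedSectionVars false

/-! ### Symmetric bicharacters -/

section Bicharacter

variable {κ G : Type*} [Field κ] [CommGroup G] {β : G → G → κˣ}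

theorem IsSymmetricBicharacter.one_right (hβ : IsSymmetricBicharacter β) (a : G) : β a 1 = 1 := by
  have h := hβ.mul_right a 1 1
  rw [mul_one] at h
  exact left_eq_mul.1 h

theorem IsSymmetricBicharacter.one_left (hβ : IsSymmetricBicharacter β) (a : G) : β 1 a = 1 := by
  have h := hβ.mul_left 1 1 a
  rw [mul_one] at h
  exact left_eq_mul.1 h

theorem IsSymmetricBicharacter.inv_right (hβ : IsSymmetricBicharacter β) (a c : G) :
    β a c⁻¹ = (β a c)⁻¹ := by
  rw [eq_inv_iff_mul_eq_one, ← hβ.mul_right, inv_mul_cancel, hβ.one_right]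

theorem IsSymmetricBicharacter.inv_left (hβ : IsSymmetricBicharacter β) (a c : G) :
    β a⁻¹ c = (β a c)⁻¹ := by
  rw [eq_inv_iff_mul_eq_one, ← hβ.mul_left, inv_mul_cancel, hβ.one_left]

theorem IsSymmetricBicharacter.swap (hβ : IsSymmetricBicharacter β) (a c : G) :
    β c a = (β a c)⁻¹ := by
  rw [eq_inv_iff_mul_eq_one, hβ.symm]

end Bicharacter

/-! ### Products over ordered pairs of positions -/

section PairProduct

variable {M : Type*} [CommMonoid M] {ι : Type*} [Fintype ι] [LinearOrder ι]

theorem prod_prod_eq_lt_mul_diag (h : ι → ι → M) :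
    ∏ i, ∏ j, h i j = (∏ i, ∏ j, if i < j then h i j * h j i else 1) * ∏ i, h i i := by
  have h₁ : ∀ i j, h i j = ((if i < j then h i j else 1) * (if j < i then h i j else 1)) *
      (if i = j then h i j else 1) := by
    intro i j
    rcases lt_trichotomy i j with hij | hij | hij
    · simp [hij, hij.ne, hij.not_gt]
    · simp [hij]
    · simp [hij, hij.ne', hij.not_gt]
  calc ∏ i, ∏ j, h i j
      = ((∏ i, ∏ j, if i < j then h i j else 1) * (∏ i, ∏ j, if j < i then h i j else 1)) *
        ∏ i, ∏ j, (if i = j then h i j else 1) := by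
        simp only [← Finset.prod_mul_distrib]
        exact Finset.prod_congr rfl fun i _ => Finset.prod_congr rfl fun j _ => h₁ i j
    _ = _ := by
        have h₂ : (∏ i, ∏ j, if j < i then h i j else 1) = ∏ i, ∏ j, if i < j then h j i else 1 :=
          Finset.prod_comm
        rw [h₂]
        simp only [← Finset.prod_mul_distrib]
        simp only [ite_mul_ite, mul_one, Finset.prod_mul_distrib, Finset.prod_ite_eq,
          Finset.mem_univ, if_true]

/-- Composition with a permutation may reverse a pair, so inversion products can only be compared
after collecting both orders of each pair. -/
theorem prod_prod_congr_symm {h h' : ι → ι → M} (hd : ∀ i, h i i = h' i i)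
    (hs : ∀ i j, i < j → h i j * h j i = h' i j * h' j i) :
    ∏ i, ∏ j, h i j = ∏ i, ∏ j, h' i j := by
  rw [prod_prod_eq_lt_mul_diag h, prod_prod_eq_lt_mul_diag h']
  congr 1
  · refine Finset.prod_congr rfl fun i _ => Finset.prod_congr rfl fun j _ => ?_
    split_ifs with hij
    · exact hs i j hij
    · rfl
  · exact Finset.prod_congr rfl fun i _ => hd i

end PairProduct

/-! ### Signs of graded place permutations -/

section BraidSign

variable {κ G : Type*} [Field κ] {k : ℕ}

/-- The scalar by which a permutation acts on a tensor whose factors have the degrees `g`. -/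
def braidSign (β : G → G → κˣ) (g : Fin k → G) (σ : Equiv.Perm (Fin k)) : κˣ :=
  ∏ i, ∏ j, if i < j ∧ σ j < σ i then -β (g j) (g i) else 1

theorem braidSign_one (β : G → G → κˣ) (g : Fin k → G) : braidSign β g 1 = 1 :=
  Finset.prod_eq_one fun _ _ => Finset.prod_eq_one fun _ _ =>
    if_neg fun h => h.1.not_gt h.2

variable [CommGroup G] {β : G → G → κˣ}

/-- A pair reversed by `σ` and reversed back by `τ` contributes `β(g_j, g_i) β(g_i, g_j) = 1`; any
other pair is reversed at most once and contributes the same factor to both sides. -/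
theorem braidSign_mul (hβ : IsSymmetricBicharacter β) (g : Fin k → G)
    (τ σ : Equiv.Perm (Fin k)) :
    braidSign β g (τ * σ) = braidSign β (g ∘ σ.symm) τ * braidSign β g σ := by
  have h₁ : braidSign β (g ∘ σ.symm) τ =
      ∏ i, ∏ j, if σ i < σ j ∧ τ (σ j) < τ (σ i) then -β (g j) (g i) else 1 := by
    unfold braidSign
    rw [← Equiv.prod_comp σ]
    refine Finset.prod_congr rfl fun i _ => ?_
    rw [← Equiv.prod_comp σ]
    simp
  rw [h₁]
  unfold braidSign
  simp only [← Finset.prod_mul_distrib]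
  refine prod_prod_congr_symm (fun i => by simp) fun i j hij => ?_
  have hs : β (g i) (g j) = (β (g j) (g i))⁻¹ := hβ.swap _ _
  have hσ : σ i ≠ σ j := fun h => hij.ne (σ.injective h)
  have hτ : τ (σ i) ≠ τ (σ j) := fun h => hσ (τ.injective h)
  rcases lt_or_gt_of_ne hσ with h | h <;> rcases lt_or_gt_of_ne hτ with h' | h' <;>
    simp [hij, h, h', hij.not_gt, h.not_gt, h'.not_gt, hs]

theorem braidSign_swap (hβ : IsSymmetricBicharacter β) (g : Fin k → G) {x y : Fin k}
    (hxy : x ≠ y) (hg : g x = g y) : braidSign β g (Equiv.swap x y) = -β (g x) (g x) := by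
  wlog hlt : x < y generalizing x y with H
  · rw [Equiv.swap_comm, H hxy.symm hg.symm (lt_of_le_of_ne (not_lt.1 hlt) hxy.symm), hg]
  -- The inversions of the transposition are `(x, y)` and, for each `j` strictly between, `(x, j)`
  -- and `(j, y)`. As `x` and `y` have equal degrees, the last two contribute mutually inverse
  -- factors.
  have key : ∀ i j, (if i < j ∧ Equiv.swap x y j < Equiv.swap x y i then -β (g j) (g i) else 1) =
      (if i = x then if j = y then -β (g x) (g x) else 1 else 1) *
      ((if i = x then if x < j ∧ j < y then -β (g j) (g x) else 1 else 1) *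
      (if j = y then if x < i ∧ i < y then -β (g x) (g i) else 1 else 1)) := by
    intro i j
    by_cases hix : i = x
    · subst hix
      by_cases hjy : j = y
      · subst hjy
        simp [hlt, hg]
      · by_cases hji : j = i
        · subst hji; simp [hjy]
        · rw [Equiv.swap_apply_of_ne_of_ne hji hjy, Equiv.swap_apply_left]
          simp [hjy]
    · by_cases hiy : i = y
      · subst hiy
        by_cases hjx : j = x
        · subst hjx
          simp [hix, hlt.not_gt, hlt.ne]
        · by_cases hji : j = i
          · subst hji; simp [hix]
          · rw [Equiv.swap_apply_of_ne_of_ne hjx hji, Equiv.swap_apply_right]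
            have : ¬(i < j ∧ j < x) := fun h => (h.1.trans h.2).not_gt hlt
            simp [hix, hji, this]
      · rw [Equiv.swap_apply_of_ne_of_ne hix hiy]
        by_cases hjx : j = x
        · subst hjx
          have : ¬(i < j ∧ y < i) := fun h => (h.2.trans h.1).not_gt hlt
          simp [hix, hlt.ne, this]
        · by_cases hjy : j = y
          · subst hjy
            simp [hix, and_comm, hg]
          · rw [Equiv.swap_apply_of_ne_of_ne hjx hjy]
            have : ¬(i < j ∧ j < i) := fun h => h.1.not_gt h.2
            simp [hix, hjy, this]
  unfold braidSign
  simp only [key, Finset.prod_mul_distrib]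
  have e₁ : (∏ i, ∏ j, if i = x then if j = y then -β (g x) (g x) else 1 else 1) =
      -β (g x) (g x) := by
    rw [Finset.prod_comm]; simp
  have e₂ : (∏ i, ∏ j, if i = x then if x < j ∧ j < y then -β (g j) (g x) else 1 else 1) =
      ∏ j, if x < j ∧ j < y then -β (g j) (g x) else 1 := by
    rw [Finset.prod_comm]; simp
  rw [e₁, e₂]
  simp only [Finset.prod_ite_eq', Finset.mem_univ, if_true]
  rw [← Finset.prod_mul_distrib, Finset.prod_eq_one, mul_one]
  intro j _
  split_ifs
  · rw [neg_mul_neg, hβ.symm]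
  · rw [mul_one]

end BraidSign

/-! ### The representation of the symmetric group on tensors -/

section PermAction

variable {κ G V I : Type*} [Field κ] [CommGroup G] [AddCommGroup V] [Module κ V]
  [Fintype I] [DecidableEq I] {β : G → G → κˣ} {form : LinearMap.BilinForm κ V}
  {b : Basis I κ V} {deg : I → G} {k : ℕ}

variable (k) in
/-- The basis of `V^{⊗k}` consisting of the tensors of basis elements. -/
abbrev tensorBasis (b : Basis I κ V) : Basis (Fin k → I) κ (⨂[κ] _ : Fin k, V) :=
  Basis.piTensorProduct fun _ : Fin k => b

theorem brauerAct_tensorBasis (d : BrauerDiagram k) (x : Fin k → I) :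
    brauerAct β form b deg d (tensorBasis k b x) =
      ∑ y, diagramWeight β form b deg d x y • tensorBasis k b y := by
  rw [brauerAct, Basis.constr_basis]
  simp

/-- After unfolding, every edge runs from the bottom half to the reversed top half, so crossings are
exactly the inversions of `σ`. Their right ends carry inverse degrees, and inverting both arguments
leaves `β` unchanged. -/
theorem diagramWeight_ofPerm (hβ : IsSymmetricBicharacter β) (σ : Equiv.Perm (Fin k))
    (x y : Fin k → I) :
    diagramWeight β form b deg (BrauerDiagram.ofPerm σ) x y =
      if y = x ∘ σ.symm then (braidSign β (deg ∘ x) σ : κ) else 0 := by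
  have pl : ∀ i : Fin k, unfoldPos (.inl i : Fin k ⊕ Fin k) = 2 * k - 1 - i := fun _ => rfl
  have pr : ∀ i : Fin k, unfoldPos (.inr i : Fin k ⊕ Fin k) = i := fun _ => rfl
  have ql : ∀ i, (BrauerDiagram.ofPerm σ).partner (.inl i) = .inr (σ i) := fun _ => rfl
  have qr : ∀ i, (BrauerDiagram.ofPerm σ).partner (.inr i) = .inl (σ.symm i) := fun _ => rfl
  have lt₁ : ∀ i j : Fin k, (i : ℕ) < 2 * k - 1 - j := fun i j => by omega
  have lt₂ : ∀ i j : Fin k, ¬ 2 * k - 1 - j < (i : ℕ) := fun i j => by omega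
  have lt₃ : ∀ i j : Fin k, 2 * k - 1 - i < 2 * k - 1 - (j : ℕ) ↔ j < i := fun i j => by
    rw [Fin.lt_def]; omega
  unfold diagramWeight
  simp only [Fintype.prod_sum_type, pl, pr, ql, qr, lt₁, lt₂, lt₃, if_false, if_true, and_false,
    false_and, and_true, true_and, Finset.prod_const_one, one_mul, mul_one, edgeWeight, vertexDeg,
    hβ.inv_left, hβ.inv_right, inv_inv, Fin.val_fin_lt]
  by_cases hy : y = x ∘ σ.symm
  · rw [if_pos hy, Finset.prod_eq_one, one_mul]
    · unfold braidSign
      rw [Finset.prod_comm, ← Equiv.prod_comp σ]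
      push_cast
      refine Finset.prod_congr rfl fun i _ => ?_
      rw [← Equiv.prod_comp σ]
      refine Finset.prod_congr rfl fun j _ => ?_
      simp only [Equiv.symm_apply_apply, Function.comp]
      by_cases h : i < j ∧ σ j < σ i
      · rw [if_pos h, if_pos h.symm]; simp
      · rw [if_neg h, if_neg fun h' => h h'.symm]; simp
    · intro i _
      simp [hy]
  · rw [if_neg hy]
    obtain ⟨i, hi⟩ := Function.ne_iff.1 hy
    rw [Finset.prod_eq_zero (Finset.mem_univ i), zero_mul]
    exact if_neg fun h => hi h.symm

theorem brauerAct_ofPerm (hβ : IsSymmetricBicharacter β) (σ : Equiv.Perm (Fin k))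
    (x : Fin k → I) :
    brauerAct β form b deg (BrauerDiagram.ofPerm σ) (tensorBasis k b x) =
      (braidSign β (deg ∘ x) σ : κ) • tensorBasis k b (x ∘ σ.symm) := by
  rw [brauerAct_tensorBasis]
  simp only [diagramWeight_ofPerm hβ, ite_smul, zero_smul, Finset.sum_ite_eq', Finset.mem_univ,
    if_true]

/-- The permutation action as a homomorphism: `permRep (τ * σ)` is `σ` followed by `τ`. -/
def permRep (hβ : IsSymmetricBicharacter β) (form : LinearMap.BilinForm κ V)
    (b : Basis I κ V) (deg : I → G) (k : ℕ) :
    Equiv.Perm (Fin k) →* End κ (⨂[κ] _ : Fin k, V) where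
  toFun σ := brauerAct β form b deg (BrauerDiagram.ofPerm σ)
  map_one' := by
    refine (tensorBasis k b).ext fun x => ?_
    rw [brauerAct_ofPerm hβ, braidSign_one]
    simp [End.one_apply, show (Equiv.symm (1 : Equiv.Perm (Fin k))) = 1 from rfl]
  map_mul' τ σ := by
    refine (tensorBasis k b).ext fun x => ?_
    rw [End.mul_apply, brauerAct_ofPerm hβ, brauerAct_ofPerm hβ, map_smul, brauerAct_ofPerm hβ,
      braidSign_mul hβ, smul_smul, mul_comm]
    rfl

theorem permRep_apply (hβ : IsSymmetricBicharacter β) (σ : Equiv.Perm (Fin k))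
    (x : Fin k → I) :
    permRep hβ form b deg k σ (tensorBasis k b x) =
      (braidSign β (deg ∘ x) σ : κ) • tensorBasis k b (x ∘ σ.symm) :=
  brauerAct_ofPerm hβ σ x

theorem permAct_eq_lift (hβ : IsSymmetricBicharacter β)
    (a : MonoidAlgebra κ (Equiv.Perm (Fin k))) :
    permAct β form b deg a = MonoidAlgebra.lift κ _ _ (permRep hβ form b deg k) a := by
  rw [MonoidAlgebra.lift_apply, Finsupp.sum_fintype _ _ (by simp)]
  rfl

end PermAction

/-! ### Subgroup sums and positivity in the rational group algebra -/

section GroupAlgebra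

variable {Γ : Type*} [Group Γ]

/-- The sum of the elements of `H`, weighted by the character `χ`. -/
def charSum (K : Type*) [Field K] (H : Finset Γ) (χ : Γ →* ℤˣ) : MonoidAlgebra K Γ :=
  ∑ h ∈ H, MonoidAlgebra.single h (((χ h : ℤˣ) : ℤ) : K)

theorem intUnit_sq (K : Type*) [Ring K] (u : ℤˣ) : ((u : ℤ) : K) * ((u : ℤ) : K) = 1 := by
  rw [← Int.cast_mul, ← Units.val_mul, Int.units_mul_self]; simp

variable {K : Type*} [Field K] {H : Finset Γ} {S : Subgroup Γ} (χ : Γ →* ℤˣ)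

theorem single_mul_charSum (hH : ∀ x, x ∈ H ↔ x ∈ S) {g : Γ} (hg : g ∈ H) :
    MonoidAlgebra.single g 1 * charSum K H χ = (((χ g : ℤˣ) : ℤ) : K) • charSum K H χ := by
  unfold charSum
  rw [Finset.mul_sum, Finset.smul_sum]
  refine Finset.sum_equiv (Equiv.mulLeft g) (fun x => ?_) fun x _ => ?_
  · simp [hH, S.mul_mem_cancel_left ((hH g).1 hg)]
  · simp [MonoidAlgebra.single_mul_single, ← mul_assoc, intUnit_sq]

theorem charSum_mul_single (hH : ∀ x, x ∈ H ↔ x ∈ S) {g : Γ} (hg : g ∈ H) :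
    charSum K H χ * MonoidAlgebra.single g 1 = (((χ g : ℤˣ) : ℤ) : K) • charSum K H χ := by
  unfold charSum
  rw [Finset.sum_mul, Finset.smul_sum]
  refine Finset.sum_equiv (Equiv.mulRight g) (fun x => ?_) fun x _ => ?_
  · simp [hH, S.mul_mem_cancel_right ((hH g).1 hg)]
  · simp [MonoidAlgebra.single_mul_single, mul_left_comm _ (((χ x : ℤˣ) : ℤ) : K), intUnit_sq]

theorem charSum_mul_self (hH : ∀ x, x ∈ H ↔ x ∈ S) :
    charSum K H χ * charSum K H χ = (H.card : K) • charSum K H χ := by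
  conv_lhs => enter [1]; unfold charSum
  rw [Finset.sum_mul]
  have : ∀ h ∈ H, MonoidAlgebra.single h (((χ h : ℤˣ) : ℤ) : K) * charSum K H χ =
      charSum K H χ := by
    intro h hh
    rw [show MonoidAlgebra.single h (((χ h : ℤˣ) : ℤ) : K) =
      (((χ h : ℤˣ) : ℤ) : K) • MonoidAlgebra.single h 1 by simp, smul_mul_assoc,
      single_mul_charSum χ hH hh, smul_smul, intUnit_sq, one_smul]
  rw [Finset.sum_congr rfl this, Finset.sum_const, Nat.cast_smul_eq_nsmul]

theorem mapRingHom_charSum {K' : Type*} [Field K'] (f : K →+* K') :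
    MonoidAlgebra.mapRingHom Γ f (charSum K H χ) = charSum K' H χ := by
  simp [charSum, map_sum]

theorem coeff_mul_one_comm (x y : MonoidAlgebra K Γ) :
    (x * y).coeff 1 = (y * x).coeff 1 := by
  induction x using MonoidAlgebra.induction_linear with
  | zero => simp
  | add x x' hx hx' => simp [add_mul, mul_add, hx, hx']
  | single g a => simp [mul_comm]

theorem coeff_charSum_mul_charSum {H' : Finset Γ} {χ' : Γ →* ℤˣ} (u : Γ)
    [DecidableEq Γ] :
    (charSum K H χ * charSum K H' χ').coeff u =
      ∑ x ∈ H, ∑ y ∈ H', if x * y = u then (((χ x : ℤˣ) : ℤ) : K) * ((χ' y : ℤˣ) : ℤ) else 0 := by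
  unfold charSum
  rw [Finset.sum_mul, MonoidAlgebra.coeff_sum, Finsupp.finsetSum_apply]
  refine Finset.sum_congr rfl fun x _ => ?_
  rw [Finset.mul_sum, MonoidAlgebra.coeff_sum, Finsupp.finsetSum_apply]
  refine Finset.sum_congr rfl fun y _ => ?_
  rw [MonoidAlgebra.single_mul_single, MonoidAlgebra.coeff_single, Finsupp.single_apply]

variable [Fintype Γ]

/-- The anti-involution of the group algebra that inverts group elements. -/
def invMap (K : Type*) [Field K] : MonoidAlgebra K Γ →ₗ[K] MonoidAlgebra K Γ where
  toFun x := ∑ g, MonoidAlgebra.single g⁻¹ (x.coeff g)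
  map_add' x y := by simp [MonoidAlgebra.single_add, Finset.sum_add_distrib]
  map_smul' c x := by simp [Finset.smul_sum]

theorem invMap_single (g : Γ) (a : K) :
    invMap K (MonoidAlgebra.single g a) = MonoidAlgebra.single g⁻¹ a := by
  classical
  change ∑ h, MonoidAlgebra.single h⁻¹ ((MonoidAlgebra.single g a).coeff h) = _
  rw [Finset.sum_eq_single g]
  · simp
  · intro h _ hh
    simp [Finsupp.single_eq_of_ne hh]
  · simp

theorem invMap_mul (x y : MonoidAlgebra K Γ) : invMap K (x * y) = invMap K y * invMap K x := by
  induction x using MonoidAlgebra.induction_linear with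
  | zero => simp
  | add x x' hx hx' => rw [add_mul, map_add, hx, hx', map_add, mul_add]
  | single g a =>
    induction y using MonoidAlgebra.induction_linear with
    | zero => simp
    | add y y' hy hy' => rw [mul_add, map_add, hy, hy', map_add, add_mul]
    | single h c => simp [MonoidAlgebra.single_mul_single, invMap_single, mul_comm]

theorem invMap_charSum (hH : ∀ x, x ∈ H ↔ x ∈ S) : invMap K (charSum K H χ) = charSum K H χ := by
  unfold charSum
  rw [map_sum]
  refine Finset.sum_equiv (Equiv.inv Γ) (fun x => ?_) fun x _ => ?_
  · simp [hH]
  · simp [invMap_single]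

theorem coeff_mul_invMap (x : MonoidAlgebra K Γ) :
    (x * invMap K x).coeff 1 = ∑ g, x.coeff g * x.coeff g := by
  change (x * ∑ g, MonoidAlgebra.single g⁻¹ (x.coeff g)).coeff 1 = _
  rw [Finset.mul_sum, MonoidAlgebra.coeff_sum, Finsupp.finsetSum_apply]
  simp

/-- The coefficient in question is the sum of the squares of the coefficients of `x`. Positivity is
why the scalars are rational here. -/
theorem eq_zero_of_mul_invMap_eq_zero {x : MonoidAlgebra ℚ Γ}
    (h : (x * invMap ℚ x).coeff 1 = 0) : x = 0 := by
  rw [coeff_mul_invMap, Finset.sum_eq_zero_iff_of_nonneg fun g _ => mul_self_nonneg _] at h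
  ext g
  simpa using h g (Finset.mem_univ g)

/-- Let `a`, `a'` be the two subgroup sums, which are fixed by the anti-involution `*`. For `x = y a
a'` one has `x x^* = y a a' a' a y^* = |H'| (y a a' a) y^* = 0`, so `x = 0` by positivity. -/
theorem mul_charSum_eq_zero {H' : Finset Γ} {S' : Subgroup Γ} {χ' : Γ →* ℤˣ}
    (hH : ∀ x, x ∈ H ↔ x ∈ S) (hH' : ∀ x, x ∈ H' ↔ x ∈ S') {y : MonoidAlgebra ℚ Γ}
    (h : y * charSum ℚ H χ * charSum ℚ H' χ' * charSum ℚ H χ = 0) :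
    y * charSum ℚ H χ * charSum ℚ H' χ' = 0 := by
  refine eq_zero_of_mul_invMap_eq_zero ?_
  rw [invMap_mul, invMap_mul, invMap_charSum χ hH, invMap_charSum χ' hH']
  have : y * charSum ℚ H χ * charSum ℚ H' χ' *
      (charSum ℚ H' χ' * (charSum ℚ H χ * invMap ℚ y)) =
      (H'.card : ℚ) • (y * charSum ℚ H χ * charSum ℚ H' χ' * charSum ℚ H χ * invMap ℚ y) := by
    rw [mul_assoc (y * charSum ℚ H χ), ← mul_assoc (charSum ℚ H' χ'), charSum_mul_self χ' hH']
    simp only [smul_mul_assoc, mul_smul_comm, mul_assoc]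
  rw [this, h]
  simp

end GroupAlgebra

/-! ### Row and column sums of a tableau; the hook number is nonzero -/

namespace StandardTableau

variable {k : ℕ} {L : Finset (Fin k)} (T : StandardTableau L)

theorem mem_rowGroup {σ : Equiv.Perm (Fin k)} :
    σ ∈ T.rowGroup ↔ (∀ i, i ∉ L → σ i = i) ∧ ∀ i, T.row (σ i) = T.row i := by
  simp [rowGroup]

theorem mem_colGroup {σ : Equiv.Perm (Fin k)} :
    σ ∈ T.colGroup ↔ (∀ i, i ∉ L → σ i = i) ∧ ∀ i, T.col (σ i) = T.col i := by
  simp [colGroup]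

/-- `R_T` as a subgroup. -/
def rowSubgroup : Subgroup (Equiv.Perm (Fin k)) where
  carrier := {σ | σ ∈ T.rowGroup}
  mul_mem' {σ τ} hσ hτ := by
    simp only [Set.mem_ofPred_eq, mem_rowGroup] at *
    exact ⟨fun i hi => by rw [Equiv.Perm.mul_apply, hτ.1 i hi, hσ.1 i hi],
      fun i => by rw [Equiv.Perm.mul_apply, hσ.2, hτ.2]⟩
  one_mem' := by simp [mem_rowGroup]
  inv_mem' {σ} hσ := by
    simp only [Set.mem_ofPred_eq, mem_rowGroup] at *
    exact ⟨fun i hi => by rw [Equiv.Perm.inv_eq_iff_eq, hσ.1 i hi],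
      fun i => by rw [← hσ.2]; simp⟩

/-- `C_T` as a subgroup. -/
def colSubgroup : Subgroup (Equiv.Perm (Fin k)) where
  carrier := {σ | σ ∈ T.colGroup}
  mul_mem' {σ τ} hσ hτ := by
    simp only [Set.mem_ofPred_eq, mem_colGroup] at *
    exact ⟨fun i hi => by rw [Equiv.Perm.mul_apply, hτ.1 i hi, hσ.1 i hi],
      fun i => by rw [Equiv.Perm.mul_apply, hσ.2, hτ.2]⟩
  one_mem' := by simp [mem_colGroup]
  inv_mem' {σ} hσ := by
    simp only [Set.mem_ofPred_eq, mem_colGroup] at *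
    exact ⟨fun i hi => by rw [Equiv.Perm.inv_eq_iff_eq, hσ.1 i hi],
      fun i => by rw [← hσ.2]; simp⟩

theorem mem_rowGroup_iff (x : Equiv.Perm (Fin k)) : x ∈ T.rowGroup ↔ x ∈ T.rowSubgroup := Iff.rfl

theorem mem_colGroup_iff (x : Equiv.Perm (Fin k)) : x ∈ T.colGroup ↔ x ∈ T.colSubgroup := Iff.rfl

/-- The signed sum of the row group. -/
abbrev rowSum (K : Type*) [Field K] : MonoidAlgebra K (Equiv.Perm (Fin k)) :=
  charSum K T.rowGroup Equiv.Perm.sign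

/-- The sum of the column group. -/
abbrev colSum (K : Type*) [Field K] : MonoidAlgebra K (Equiv.Perm (Fin k)) :=
  charSum K T.colGroup 1

theorem youngElement_eq (K : Type*) [Field K] :
    T.youngElement K = T.colSum K * T.rowSum K := by
  unfold youngElement rowSum colSum charSum
  rw [Finset.sum_mul_sum, Finset.sum_comm]
  simp [MonoidAlgebra.single_mul_single]

theorem row_of_mem {i : Fin k} (h : i ∈ L) : T.row i = some (T.box ⟨i, h⟩).1.1 := dif_pos h

theorem col_of_mem {i : Fin k} (h : i ∈ L) : T.col i = some (T.box ⟨i, h⟩).1.2 := dif_pos h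

theorem eq_of_row_eq_of_col_eq {x y : Fin k} (hx : x ∈ L) (hy : y ∈ L)
    (h₁ : T.row x = T.row y) (h₂ : T.col x = T.col y) : x = y := by
  rw [T.row_of_mem hx, T.row_of_mem hy, Option.some_inj] at h₁
  rw [T.col_of_mem hx, T.col_of_mem hy, Option.some_inj] at h₂
  exact congrArg Subtype.val (T.box.injective (Subtype.ext (Prod.ext h₁ h₂)))

theorem eq_one_of_mem {σ : Equiv.Perm (Fin k)} (h₁ : σ ∈ T.rowGroup) (h₂ : σ ∈ T.colGroup) :
    σ = 1 := by
  rw [mem_rowGroup] at h₁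
  rw [mem_colGroup] at h₂
  ext1 i
  by_cases hi : i ∈ L
  · refine T.eq_of_row_eq_of_col_eq ?_ hi (h₁.2 i) (h₂.2 i)
    by_contra h
    rw [σ.injective (h₁.1 _ h)] at h
    exact h hi
  · exact h₁.1 i hi

/-- Row and column group meet trivially, so the identity is a product `γ ψ` in only one way. -/
theorem coeff_colSum_mul_rowSum_one : (T.colSum ℚ * T.rowSum ℚ).coeff 1 = 1 := by
  rw [coeff_charSum_mul_charSum, Finset.sum_eq_single 1, Finset.sum_eq_single 1]
  · simp
  · intro y _ hy
    simp [hy]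
  · intro h
    exact absurd T.rowSubgroup.one_mem h
  · intro x hx hne
    refine Finset.sum_eq_zero fun y hy => if_neg fun hxy => hne ?_
    have : y = x⁻¹ := eq_inv_of_mul_eq_one_right hxy
    subst this
    exact T.eq_one_of_mem (T.rowSubgroup.inv_mem_iff.1 hy) hx
  · intro h
    exact absurd T.colSubgroup.one_mem h

/-- The squared norm of the self-adjoint element `C R C` is `|C_T|²` times the coefficient of `(C
R)²` at the identity. If that were zero, then `C R C = 0`, hence `C R = 0`, although `C R` has
coefficient one at the identity. No proportionality of `s_T²` and `s_T` enters. -/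
theorem hookNumber_rat_ne_zero : T.hookNumber ℚ ≠ 0 := by
  intro h
  rw [hookNumber, youngElement_eq] at h
  set C := T.colSum ℚ
  set R := T.rowSum ℚ
  have hC : C * C = (T.colGroup.card : ℚ) • C := charSum_mul_self _ T.mem_colGroup_iff
  have h₀ : C * R * C = 0 := by
    refine eq_zero_of_mul_invMap_eq_zero ?_
    rw [invMap_mul, invMap_mul, invMap_charSum _ T.mem_colGroup_iff,
      invMap_charSum _ T.mem_rowGroup_iff]
    have : C * R * C * (C * (R * C)) = (T.colGroup.card : ℚ) • (C * R * C * (R * C)) := by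
      rw [mul_assoc (C * R) C, ← mul_assoc C C, hC]
      simp only [smul_mul_assoc, mul_smul_comm, mul_assoc]
    rw [this, MonoidAlgebra.coeff_smul_apply, ← mul_assoc (C * R * C), coeff_mul_one_comm]
    have : C * (C * R * C * R) = (T.colGroup.card : ℚ) • (C * R * (C * R)) := by
      simp only [mul_assoc]
      rw [← mul_assoc C C, hC, smul_mul_assoc]
    rw [this, MonoidAlgebra.coeff_smul_apply, h]
    simp
  have h₁ : C * R = 0 := by
    have := mul_charSum_eq_zero (y := 1) (χ := 1) (χ' := Equiv.Perm.sign) T.mem_colGroup_iff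
      T.mem_rowGroup_iff (by rw [one_mul]; exact h₀)
    rwa [one_mul] at this
  have := T.coeff_colSum_mul_rowSum_one
  rw [h₁] at this
  simp at this

theorem hookNumber_eq_cast (K : Type*) [Field K] [CharZero K] :
    T.hookNumber K = (T.hookNumber ℚ : K) := by
  rw [hookNumber, hookNumber, youngElement_eq, youngElement_eq]
  rw [rowSum, colSum, ← mapRingHom_charSum _ (Rat.castHom K), ← mapRingHom_charSum _ (Rat.castHom K),
    ← map_mul, ← map_mul, MonoidAlgebra.coeff_mapRingHom]
  rfl

theorem hookNumber_ne_zero (K : Type*) [Field K] [CharZero K] : T.hookNumber K ≠ 0 := by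
  rw [hookNumber_eq_cast]
  exact_mod_cast T.hookNumber_rat_ne_zero

end StandardTableau

/-! ### Triangularity and independence of standard polytabloids -/

theorem exists_minimal_moved {k : ℕ} {g : Equiv.Perm (Fin k)} (hg : g ≠ 1) :
    ∃ m, g m ≠ m ∧ m < g m ∧ m < g⁻¹ m ∧ ∀ i < m, g i = i := by
  obtain ⟨m₀, hm₀⟩ : ∃ m, g m ≠ m := by
    by_contra! h
    exact hg (Equiv.ext h)
  obtain ⟨m, hm, hmin⟩ := (Set.toFinite {m | g m ≠ m}).exists_minimal ⟨m₀, hm₀⟩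
  have hfix : ∀ i < m, g i = i := fun i hi => by
    by_contra h
    exact (hmin h hi.le).not_gt hi
  refine ⟨m, hm, ?_, ?_, hfix⟩
  · rcases lt_trichotomy (g m) m with h | h | h
    · exact absurd (g.injective (hfix _ h)) hm
    · exact absurd h hm
    · exact h
  · rcases lt_trichotomy (g⁻¹ m) m with h | h | h
    · have := hfix _ h
      rw [show g (g⁻¹ m) = m by simp] at this
      exact absurd this h.ne'
    · exact absurd (Equiv.Perm.inv_eq_iff_eq.1 h).symm hm
    · exact h

namespace StandardTableau

variable {k : ℕ} {L : Finset (Fin k)}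

theorem ext_box {T T' : StandardTableau L}
    (h : ∀ x, (T.box x).1 = (T'.box x).1) : T = T' := by
  have hs : T.shape = T'.shape := by
    ext c
    constructor
    · intro hc
      have := h (T.box.symm ⟨c, hc⟩)
      rw [Equiv.apply_symm_apply] at this
      change c = _ at this
      rw [this]
      exact (T'.box _).2
    · intro hc
      have := h (T'.box.symm ⟨c, hc⟩)
      rw [Equiv.apply_symm_apply] at this
      change _ = c at this
      rw [← this]
      exact (T.box _).2
  obtain ⟨sh, bx, _, _⟩ := T
  obtain ⟨sh', bx', _, _⟩ := T'
  change sh = sh' at hs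
  subst hs
  have : bx = bx' := Equiv.ext fun x => Subtype.ext (h x)
  subst this
  rfl

theorem ext_row_col {T T' : StandardTableau L} (h₁ : ∀ i, T.row i = T'.row i)
    (h₂ : ∀ i, T.col i = T'.col i) : T = T' := by
  refine ext_box fun x => Prod.ext ?_ ?_
  · simpa only [T.row_of_mem x.2, T'.row_of_mem x.2, Option.some_inj] using h₁ x.1
  · simpa only [T.col_of_mem x.2, T'.col_of_mem x.2, Option.some_inj] using h₂ x.1

variable (T : StandardTableau L)

theorem row_getD_lt {x y : Fin k} (hx : x ∈ L) (hy : y ∈ L) (hxy : x < y)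
    (h : T.col x = T.col y) : (T.row x).getD 0 < (T.row y).getD 0 := by
  have h' := h
  rw [T.col_of_mem hx, T.col_of_mem hy, Option.some_inj] at h'
  rcases lt_trichotomy ((T.row x).getD 0) ((T.row y).getD 0) with h₁ | h₁ | h₁
  · exact h₁
  · rw [T.row_of_mem hx, T.row_of_mem hy, Option.getD_some, Option.getD_some] at h₁
    exact absurd (T.eq_of_row_eq_of_col_eq hx hy
      (by rw [T.row_of_mem hx, T.row_of_mem hy, h₁]) h) hxy.ne
  · rw [T.row_of_mem hx, T.row_of_mem hy, Option.getD_some, Option.getD_some] at h₁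
    exact absurd (T.col_increasing ⟨y, hy⟩ ⟨x, hx⟩ h'.symm h₁) hxy.not_gt

theorem col_getD_lt {x y : Fin k} (hx : x ∈ L) (hy : y ∈ L) (hxy : x < y)
    (h : T.row x = T.row y) : (T.col x).getD 0 < (T.col y).getD 0 := by
  have h' := h
  rw [T.row_of_mem hx, T.row_of_mem hy, Option.some_inj] at h'
  rcases lt_trichotomy ((T.col x).getD 0) ((T.col y).getD 0) with h₁ | h₁ | h₁
  · exact h₁
  · rw [T.col_of_mem hx, T.col_of_mem hy, Option.getD_some, Option.getD_some] at h₁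
    exact absurd (T.eq_of_row_eq_of_col_eq hx hy h
      (by rw [T.col_of_mem hx, T.col_of_mem hy, h₁])) hxy.ne
  · rw [T.col_of_mem hx, T.col_of_mem hy, Option.getD_some, Option.getD_some] at h₁
    exact absurd (T.row_increasing ⟨y, hy⟩ ⟨x, hx⟩ h'.symm h₁) hxy.not_gt

/-- `σ` carries the tableau `T₀` to `T`. -/
structure Carries (T₀ T : StandardTableau L) (σ : Equiv.Perm (Fin k)) : Prop where
  fix : ∀ i, i ∉ L → σ i = i
  row_eq : ∀ i, T.row (σ i) = T₀.row i
  col_eq : ∀ i, T.col (σ i) = T₀.col i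

theorem exists_carries {T₀ T : StandardTableau L} (h : T₀.shape = T.shape) :
    ∃ σ, Carries T₀ T σ := by
  let e : Equiv.Perm {i // i ∈ L} :=
    T₀.box.trans ((Equiv.subtypeEquivRight fun c => by rw [h]).trans T.box.symm)
  have he : ∀ x, (T.box (e x)).1 = (T₀.box x).1 := fun x => by simp [e]
  refine ⟨Equiv.Perm.ofSubtype e, fun i hi => Equiv.Perm.ofSubtype_apply_of_not_mem e hi,
    fun i => ?_, fun i => ?_⟩
  all_goals
    by_cases hi : i ∈ L
    · rw [Equiv.Perm.ofSubtype_apply_of_mem e hi]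
      first
        | rw [T.row_of_mem (e ⟨i, hi⟩).2, T₀.row_of_mem hi, Subtype.coe_eta, he]
        | rw [T.col_of_mem (e ⟨i, hi⟩).2, T₀.col_of_mem hi, Subtype.coe_eta, he]
    · rw [Equiv.Perm.ofSubtype_apply_of_not_mem e hi]
      simp [row, col, hi]

/-- The rows of `T` come from those of `T'` through a column permutation `g` of `T'`. If `g ≠ 1`,
its smallest moved entry `m` satisfies `m < g m` in one column of `T'`, so `m` lies further down in
`T` than in `T'`, while smaller entries keep their rows. Positions outside `L` get the default row 0
in both tableaux and do not affect the comparison. -/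
theorem eq_or_lex_lt {T₀ T T' : StandardTableau L} {σ σ' γ ψ : Equiv.Perm (Fin k)}
    (hσ : Carries T₀ T σ) (hσ' : Carries T₀ T' σ') (hγ : γ ∈ T₀.colGroup)
    (hψ : ψ ∈ T₀.rowGroup) (h : σ = σ' * (γ * ψ)) :
    T = T' ∨ toLex (fun i => (T'.row i).getD 0) < toLex fun i => (T.row i).getD 0 := by
  have fixL : ∀ {g : Equiv.Perm (Fin k)}, (∀ i, i ∉ L → g i = i) → ∀ {m}, g m ≠ m →
      m ∈ L ∧ g m ∈ L := by
    intro g hg m hm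
    refine ⟨by_contra fun h => hm (hg m h), by_contra fun h => hm (g.injective (hg _ h))⟩
  have inv_fix : ∀ {g : Equiv.Perm (Fin k)}, (∀ i, i ∉ L → g i = i) → ∀ i, i ∉ L → g⁻¹ i = i :=
    fun hg i hi => Equiv.Perm.inv_eq_iff_eq.2 (hg i hi).symm
  have hγ' := T₀.mem_colGroup.1 (T₀.colSubgroup.inv_mem hγ)
  have hψ' := T₀.mem_rowGroup.1 hψ
  have back_row : ∀ i, T₀.row (σ'⁻¹ i) = T'.row i := fun i => by
    rw [← hσ'.row_eq]; simp
  have back_col : ∀ i, T₀.col (σ'⁻¹ i) = T'.col i := fun i => by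
    rw [← hσ'.col_eq]; simp
  set g := σ' * γ⁻¹ * σ'⁻¹ with hgdef
  have gfix : ∀ i, i ∉ L → g i = i := fun i hi => by
    simp only [hgdef, Equiv.Perm.mul_apply]
    rw [inv_fix hσ'.fix i hi, hγ'.1 i hi, hσ'.fix i hi]
  have gcol : ∀ i, T'.col (g i) = T'.col i := fun i => by
    simp only [hgdef, Equiv.Perm.mul_apply]
    rw [hσ'.col_eq, hγ'.2, back_col]
  have grow : ∀ i, T.row i = T'.row (g i) := fun i => by
    obtain ⟨j, rfl⟩ := σ.surjective i
    rw [hσ.row_eq, h]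
    have : g ((σ' * (γ * ψ)) j) = σ' (ψ j) := by simp [hgdef]
    rw [this, hσ'.row_eq, hψ'.2]
  by_cases hg : g = 1
  · left
    have hrow : ∀ i, T.row i = T'.row i := fun i => by rw [grow, hg]; rfl
    have hγ1 : γ = 1 := by
      rw [hgdef, mul_inv_eq_one, mul_eq_left, inv_eq_one] at hg
      exact hg
    rw [hγ1, one_mul] at h
    set p := σ' * ψ * σ'⁻¹ with hpdef
    have prow : ∀ i, T'.row (p i) = T'.row i := fun i => by
      simp only [hpdef, Equiv.Perm.mul_apply]
      rw [hσ'.row_eq, hψ'.2, back_row]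
    have pcol : ∀ i, T.col (p i) = T'.col i := fun i => by
      have : p i = σ (σ'⁻¹ i) := by rw [h]; rfl
      rw [this, hσ.col_eq, back_col]
    have pfix : ∀ i, i ∉ L → p i = i := fun i hi => by
      simp only [hpdef, Equiv.Perm.mul_apply]
      rw [inv_fix hσ'.fix i hi, hψ'.1 i hi, hσ'.fix i hi]
    -- Both tableaux now have the same rows. A smallest moved `m` would have its column in `T`
    -- smaller than that of `p m`, which is the column of `m` in `T'`; the entry `p⁻¹ m` gives the
    -- reverse inequality.
    have hp : p = 1 := by
      by_contra hp
      obtain ⟨m, hm, hlt, hlt', -⟩ := exists_minimal_moved hp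
      obtain ⟨hmL, hpmL⟩ := fixL pfix hm
      have hm' : p⁻¹ m ≠ m := hlt'.ne'
      have hpmL' := (fixL (inv_fix pfix) hm').2
      have h₁ := T.col_getD_lt hmL hpmL hlt (by rw [hrow, hrow, prow])
      have hpp : p (p⁻¹ m) = m := by simp
      have h₂ := T'.col_getD_lt hmL hpmL' hlt' (by rw [← prow (p⁻¹ m), hpp])
      rw [pcol] at h₁
      rw [← pcol (p⁻¹ m), hpp] at h₂
      exact h₁.not_gt h₂
    refine ext_row_col hrow fun i => ?_
    rw [← pcol i, hp]
    rfl
  · right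
    obtain ⟨m, hm, hlt, -, hmin⟩ := exists_minimal_moved hg
    obtain ⟨hmL, hgmL⟩ := fixL gfix hm
    refine ⟨m, fun i hi => ?_, ?_⟩
    · simp [grow i, hmin i hi]
    · simpa [grow m] using T'.row_getD_lt hmL hgmL hlt (gcol m).symm

open Classical in
/-- Linear independence of the polytabloids of standard tableaux. -/
theorem coeff_eq_zero_of_sum_mul_young {T₀ : StandardTableau L} {ι : Type*} {s : Finset ι}
    {T : ι → StandardTableau L} (hT : Function.Injective T) {σ : ι → Equiv.Perm (Fin k)}
    (hσ : ∀ i ∈ s, Carries T₀ (T i) (σ i)) {a : ι → ℚ}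
    (h : (∑ i ∈ s, MonoidAlgebra.single (σ i) (a i)) * T₀.colSum ℚ * T₀.rowSum ℚ = 0) :
    ∀ i ∈ s, a i = 0 := by
  by_contra! hne
  obtain ⟨i₁, hi₁, ha₁⟩ := hne
  -- Take the lexicographically least tableau with nonzero coefficient. By triangularity no other
  -- summand reaches the group element `σ i`, and its own summand reaches it with coefficient one.
  obtain ⟨i, hi, hmin⟩ := (s.filter fun i => a i ≠ 0).exists_min_image
    (fun i => toLex fun m => ((T i).row m).getD 0) ⟨i₁, by simp [hi₁, ha₁]⟩
  rw [Finset.mem_filter] at hi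
  have hc := congrArg (fun x => x.coeff (σ i)) h
  simp only [mul_assoc, Finset.sum_mul, MonoidAlgebra.coeff_sum, Finsupp.finsetSum_apply,
    MonoidAlgebra.coeff_single_mul_apply, MonoidAlgebra.coeff_zero, Finsupp.zero_apply] at hc
  rw [Finset.sum_eq_single i] at hc
  · rw [inv_mul_cancel, T₀.coeff_colSum_mul_rowSum_one, mul_one] at hc
    exact hi.2 hc
  · intro i' hi' hne
    by_cases ha : a i' = 0
    · rw [ha, zero_mul]
    rw [coeff_charSum_mul_charSum, Finset.sum_eq_zero, mul_zero]
    intro γ hγ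
    refine Finset.sum_eq_zero fun ψ hψ => if_neg fun hx => ?_
    rcases eq_or_lex_lt (hσ i hi.1) (hσ i' hi') hγ hψ (by rw [hx, mul_inv_cancel_left]) with h₁ | h₁
    · exact hne (hT h₁.symm)
    · exact (hmin i' (by simp [hi', ha])).not_gt h₁
  · intro h'
    exact absurd hi.1 h'

/-- The `ℚ`-linear functionals on `κ` separate points, and they pass through products with the Young
sums because those have rational coefficients. Over `ℚ` positivity strips the final column sum. -/
theorem coeff_eq_zero_of_sum_mul_young_mul {κ : Type*} [Field κ] [CharZero κ]
    {T₀ : StandardTableau L} {ι : Type*} {s : Finset ι}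
    {T : ι → StandardTableau L} (hT : Function.Injective T) {σ : ι → Equiv.Perm (Fin k)}
    (hσ : ∀ i ∈ s, Carries T₀ (T i) (σ i)) {a : ι → κ}
    (h : (∑ i ∈ s, MonoidAlgebra.single (σ i) (a i)) *
      (T₀.colSum κ * T₀.rowSum κ * T₀.colSum κ) = 0) :
    ∀ i ∈ s, a i = 0 := by
  intro i hi
  rw [← Module.forall_dual_apply_eq_zero_iff ℚ]
  intro φ
  refine coeff_eq_zero_of_sum_mul_young (a := fun i => φ (a i)) hT hσ ?_ i hi
  refine mul_charSum_eq_zero _ T₀.mem_colGroup_iff T₀.mem_rowGroup_iff ?_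
  rw [mul_assoc, mul_assoc, ← mul_assoc (charSum ℚ T₀.colGroup 1)]
  rw [rowSum, colSum, ← mapRingHom_charSum _ (Rat.castHom κ),
    ← mapRingHom_charSum _ (Rat.castHom κ), ← map_mul, ← map_mul] at h
  ext g
  have hc := congrArg (fun x => φ (x.coeff g)) h
  simp only [Finset.sum_mul, MonoidAlgebra.coeff_sum, Finsupp.finsetSum_apply,
    MonoidAlgebra.coeff_single_mul_apply, MonoidAlgebra.coeff_zero, Finsupp.zero_apply,
    map_sum, map_zero, MonoidAlgebra.coeff_mapRingHom] at hc ⊢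
  rw [← hc]
  refine Finset.sum_congr rfl fun i' _ => ?_
  rw [eq_ratCast, mul_comm (a i'), ← Rat.smul_def, map_smul, smul_eq_mul, mul_comm]

end StandardTableau

/-! ### Homogeneous components read off in a homogeneous basis -/

section Grading

variable {κ G V : Type*} [Field κ] [DecidableEq G]
  [AddCommGroup V] [Module κ V] {𝒱 : G → Submodule κ V} [DirectSum.Decomposition 𝒱]

theorem gradeProj_of_mem {c : G} {v : V} (hv : v ∈ 𝒱 c) : gradeProj 𝒱 c v = v :=
  DirectSum.decompose_of_mem_same 𝒱 hv

theorem gradeProj_of_mem_ne {c c' : G} {v : V} (hv : v ∈ 𝒱 c) (h : c ≠ c') :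
    gradeProj 𝒱 c' v = 0 :=
  DirectSum.decompose_of_mem_ne 𝒱 hv h

variable {I : Type*} {b : Basis I κ V} {deg : I → G}

theorem repr_gradeProj (hdeg : ∀ i, b i ∈ 𝒱 (deg i)) (c : G) (v : V) (i : I) :
    b.repr (gradeProj 𝒱 c v) i = if deg i = c then b.repr v i else 0 := by
  suffices h : b.coord i ∘ₗ gradeProj 𝒱 c = if deg i = c then b.coord i else 0 by
    have := LinearMap.congr_fun h v
    split_ifs at this ⊢ with hc <;> simpa using this
  refine b.ext fun j => ?_
  by_cases hj : deg j = c
  · rw [LinearMap.comp_apply, gradeProj_of_mem (hj ▸ hdeg j)]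
    by_cases hij : j = i
    · subst hij; simp [hj]
    · split_ifs <;> simp [Finsupp.single_eq_of_ne' hij]
  · rw [LinearMap.comp_apply, gradeProj_of_mem_ne (hdeg j) hj]
    by_cases hij : j = i
    · subst hij; simp [hj]
    · split_ifs <;> simp [Finsupp.single_eq_of_ne' hij]

theorem repr_eq_zero_of_mem (hdeg : ∀ i, b i ∈ 𝒱 (deg i)) {c : G} {v : V} (hv : v ∈ 𝒱 c) {i : I}
    (hi : deg i ≠ c) : b.repr v i = 0 := by
  have h := repr_gradeProj hdeg c v i
  rwa [gradeProj_of_mem hv, if_neg hi] at h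

variable [CommGroup G] [Fintype G]

theorem homPart_basis (hdeg : ∀ i, b i ∈ 𝒱 (deg i)) (a : G) (x : End κ V) (j : I) :
    homPart 𝒱 a x (b j) = gradeProj 𝒱 (a * deg j) (x (b j)) := by
  rw [homPart, LinearMap.sum_apply, Finset.sum_eq_single (deg j)]
  · simp [gradeProj_of_mem (hdeg j)]
  · intro c _ hc
    simp [gradeProj_of_mem_ne (hdeg j) hc.symm]
  · simp

theorem repr_homPart (hdeg : ∀ i, b i ∈ 𝒱 (deg i)) (a : G) (x : End κ V) (i j : I) :
    b.repr (homPart 𝒱 a x (b j)) i = if deg i = a * deg j then b.repr (x (b j)) i else 0 := by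
  rw [homPart_basis hdeg, repr_gradeProj hdeg]

theorem homPart_add (a : G) (x y : End κ V) :
    homPart 𝒱 a (x + y) = homPart 𝒱 a x + homPart 𝒱 a y := by
  simp [homPart, LinearMap.add_comp, LinearMap.comp_add, Finset.sum_add_distrib]

theorem homPart_of_mem (hdeg : ∀ i, b i ∈ 𝒱 (deg i)) {a : G} {x : End κ V}
    (hx : x ∈ glHom 𝒱 a) : homPart 𝒱 a x = x :=
  b.ext fun j => by rw [homPart_basis hdeg, gradeProj_of_mem (hx _ _ (hdeg j))]

theorem homPart_of_mem_ne (hdeg : ∀ i, b i ∈ 𝒱 (deg i)) {a a' : G} {x : End κ V}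
    (hx : x ∈ glHom 𝒱 a) (h : a ≠ a') : homPart 𝒱 a' x = 0 :=
  b.ext fun j => by
    rw [homPart_basis hdeg, gradeProj_of_mem_ne (hx _ _ (hdeg j)) (by simpa using h),
      LinearMap.zero_apply]

theorem sum_homPart (hdeg : ∀ i, b i ∈ 𝒱 (deg i)) (x : End κ V) :
    ∑ a, homPart 𝒱 a x = x := by
  refine b.ext fun j => b.ext_elem fun i => ?_
  rw [LinearMap.sum_apply, map_sum, Finsupp.finsetSum_apply]
  simp only [repr_homPart hdeg]
  rw [Finset.sum_eq_single (deg i * (deg j)⁻¹)]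
  · simp
  · intro a _ ha
    exact if_neg fun h => ha (by rw [h]; simp)
  · simp

theorem homPart_mem_spoHom {β : G → G → κˣ} {form : LinearMap.BilinForm κ V}
    (hdeg : ∀ i, b i ∈ 𝒱 (deg i)) (a : G) {x : End κ V} (hx : x ∈ spo β 𝒱 form) :
    homPart 𝒱 a x ∈ spoHom β 𝒱 form a := by
  unfold spo at hx
  induction hx using Submodule.iSup_induction' with
  | mem a' x hx =>
    by_cases h : a' = a
    · subst h
      rwa [homPart_of_mem hdeg hx.1]
    · rw [homPart_of_mem_ne hdeg hx.1 h]
      exact Submodule.zero_mem _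
  | zero =>
    rw [show homPart 𝒱 a (0 : End κ V) = 0 by simp [homPart]]
    exact Submodule.zero_mem _
  | add x y _ _ hx hy =>
    rw [homPart_add]
    exact Submodule.add_mem _ hx hy

end Grading

/-! ### The action on basis tensors -/

section TensorAction

variable {κ G V : Type*} [Field κ] [CommGroup G] [Fintype G] [DecidableEq G]
  [AddCommGroup V] [Module κ V] {𝒱 : G → Submodule κ V} [DirectSum.Decomposition 𝒱]
  {I : Type*} {b : Basis I κ V} {deg : I → G}

/-- The action on `V^{⊗k}` of an endomorphism of degree `a`. -/
def homAct (β : G → G → κˣ) (𝒱 : G → Submodule κ V) [DirectSum.Decomposition 𝒱] (k : ℕ) (a : G)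
    (y : End κ V) : End κ (⨂[κ] _ : Fin k, V) :=
  ∑ i : Fin k, PiTensorProduct.map fun j =>
    if j < i then twist β 𝒱 a else if j = i then y else LinearMap.id

theorem tensorAct_eq (β : G → G → κˣ) (k : ℕ) (x : End κ V) :
    tensorAct β 𝒱 k x = ∑ a, homAct β 𝒱 k a (homPart 𝒱 a x) := rfl

theorem twist_basis (β : G → G → κˣ) (hdeg : ∀ i, b i ∈ 𝒱 (deg i)) (a : G) (j : I) :
    twist β 𝒱 a (b j) = (β (deg j) a : κ) • b j := by
  rw [twist, LinearMap.sum_apply, Finset.sum_eq_single (deg j)]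
  · simp [gradeProj_of_mem (hdeg j)]
  · intro c _ hc
    simp [gradeProj_of_mem_ne (hdeg j) hc.symm]
  · simp

variable [Fintype I] [DecidableEq I]

/-- The factor `β(g₁, a) ⋯ β(g_{i-1}, a)`. -/
def prefixSign (β : G → G → κˣ) {k : ℕ} (g : Fin k → G) (a : G) (i : Fin k) : κˣ :=
  ∏ j, if j < i then β (g j) a else 1

theorem homAct_tensorBasis (β : G → G → κˣ) (hdeg : ∀ i, b i ∈ 𝒱 (deg i)) {k : ℕ} (a : G)
    (y : End κ V) (x : Fin k → I) :
    homAct β 𝒱 k a y (tensorBasis k b x) =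
      ∑ i, (prefixSign β (deg ∘ x) a i : κ) •
        ∑ m, b.repr (y (b (x i))) m • tensorBasis k b (Function.update x i m) := by
  rw [homAct, LinearMap.sum_apply]
  refine Finset.sum_congr rfl fun i _ => ?_
  rw [Basis.piTensorProduct_apply, PiTensorProduct.map_tprod]
  have h : (fun j => (if j < i then twist β 𝒱 a else if j = i then y else LinearMap.id) (b (x j))) =
      fun j => ((if j < i then β (deg (x j)) a else 1 : κˣ) : κ) •
        Function.update (fun j => b (x j)) i (y (b (x i))) j := by
    funext j
    rcases lt_trichotomy j i with h | h | h
    · simp [h, h.ne, twist_basis β hdeg]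
    · subst h; simp
    · simp [h.not_gt, h.ne']
  rw [h, MultilinearMap.map_smul_univ]
  congr 1
  · simp [prefixSign, Units.coe_prod]
  · conv_lhs => rw [← b.sum_repr (y (b (x i)))]
    rw [MultilinearMap.map_update_sum]
    refine Finset.sum_congr rfl fun m _ => ?_
    rw [MultilinearMap.map_update_smul, Basis.piTensorProduct_apply]
    congr 2
    funext j
    by_cases hj : j = i
    · subst hj; simp
    · simp [hj]

end TensorAction

/-! ### The action commutes with graded place permutations -/

section PermCommute

variable {κ G : Type*} [Field κ] [CommGroup G] {β : G → G → κˣ} {k : ℕ}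

theorem braidSign_update (hβ : IsSymmetricBicharacter β) (g : Fin k → G)
    (σ : Equiv.Perm (Fin k)) (a : G) (i : Fin k) :
    braidSign β (Function.update g i (a * g i)) σ = braidSign β g σ *
      ((∏ j, if j < i ∧ σ i < σ j then β a (g j) else 1) *
        ∏ j, if i < j ∧ σ j < σ i then β (g j) a else 1) := by
  have key : ∀ p q, (if p < q ∧ σ q < σ p then
      -β (Function.update g i (a * g i) q) (Function.update g i (a * g i) p) else 1) =
      (if p < q ∧ σ q < σ p then -β (g q) (g p) else 1) *
      ((if q = i then if p < i ∧ σ i < σ p then β a (g p) else 1 else 1) *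
      (if p = i then if i < q ∧ σ q < σ i then β (g q) a else 1 else 1)) := by
    intro p q
    by_cases hpq : p < q ∧ σ q < σ p
    · by_cases hq : q = i
      · subst hq
        have hp : p ≠ q := hpq.1.ne
        simp [hpq, hp, hβ.mul_left, mul_comm]
      · by_cases hp : p = i
        · subst hp
          simp [hpq, hq, hβ.mul_right, mul_comm]
        · simp [hp, hq]
    · by_cases hq : q = i
      · subst hq
        by_cases hp : p = q
        · subst hp; simp
        · simp [hpq, hp]
      · by_cases hp : p = i
        · subst hp; simp [hpq, hq]
        · simp [hpq, hp, hq]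
  unfold braidSign
  simp only [key, Finset.prod_mul_distrib, Finset.prod_ite_eq', Finset.mem_univ, if_true]
  congr 2
  rw [Finset.prod_comm]
  simp

/-- An operator of degree `a` reaches the `i`-th factor either after the permutation or before it.
Factors staying on one side of that factor agree directly; a factor changing sides is accounted for
by the extra `a` in the braiding, via `β(a, g) β(g, a) = 1`. -/
theorem braidSign_mul_prefixSign (hβ : IsSymmetricBicharacter β) (g : Fin k → G)
    (σ : Equiv.Perm (Fin k)) (a : G) (i : Fin k) :
    braidSign β g σ * prefixSign β (g ∘ σ.symm) a (σ i) =
      prefixSign β g a i * braidSign β (Function.update g i (a * g i)) σ := by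
  have h : prefixSign β (g ∘ σ.symm) a (σ i) = ∏ j, if σ j < σ i then β (g j) a else 1 := by
    unfold prefixSign
    rw [← Equiv.prod_comp σ]
    simp
  rw [braidSign_update hβ, mul_left_comm, h]
  congr 1
  unfold prefixSign
  simp only [← Finset.prod_mul_distrib]
  refine Finset.prod_congr rfl fun j _ => ?_
  have hs : β a (g j) = (β (g j) a)⁻¹ := hβ.swap _ _
  rcases lt_trichotomy j i with hij | hij | hij
  · have hne : σ j ≠ σ i := fun h => hij.ne (σ.injective h)
    rcases lt_or_gt_of_ne hne with h' | h' <;> simp [hij, h', hij.not_gt, h'.not_gt, hs]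
  · subst hij; simp
  · have hne : σ j ≠ σ i := fun h => hij.ne' (σ.injective h)
    rcases lt_or_gt_of_ne hne with h' | h' <;> simp [hij, h', hij.not_gt, h'.not_gt]

variable {V : Type*} [Fintype G] [DecidableEq G]
  [AddCommGroup V] [Module κ V] {𝒱 : G → Submodule κ V} [DirectSum.Decomposition 𝒱]
  {I : Type*} [Fintype I] [DecidableEq I] {b : Basis I κ V} {deg : I → G}
  {form : LinearMap.BilinForm κ V}

theorem homAct_comm_permRep (hβ : IsSymmetricBicharacter β) (hdeg : ∀ i, b i ∈ 𝒱 (deg i)) {a : G}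
    {y : End κ V} (hy : y ∈ glHom 𝒱 a) (σ : Equiv.Perm (Fin k)) :
    Commute (homAct β 𝒱 k a y) (permRep hβ form b deg k σ) := by
  refine (tensorBasis k b).ext fun x => ?_
  rw [End.mul_apply, End.mul_apply, permRep_apply, map_smul, homAct_tensorBasis β hdeg,
    homAct_tensorBasis β hdeg, map_sum, ← Equiv.sum_comp σ, Finset.smul_sum]
  refine Finset.sum_congr rfl fun i _ => ?_
  rw [map_smul, map_sum, smul_smul, Finset.smul_sum, Finset.smul_sum]
  refine Finset.sum_congr rfl fun m _ => ?_
  rw [map_smul, permRep_apply, smul_smul, smul_smul, smul_smul]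
  simp only [Function.comp_apply, Equiv.symm_apply_apply]
  by_cases h : b.repr (y (b (x i))) m = 0
  · simp [h]
  have hm : deg m = a * deg (x i) := by
    by_contra hne
    exact h (repr_eq_zero_of_mem hdeg (hy _ _ (hdeg (x i))) hne)
  have hu : deg ∘ Function.update x i m = Function.update (deg ∘ x) i (a * (deg ∘ x) i) := by
    rw [Function.comp_update, hm]; rfl
  have hv : Function.update (x ∘ σ.symm) (σ i) m = Function.update x i m ∘ σ.symm := by
    rw [Function.update_comp_equiv]; simp
  rw [hu, hv]
  congr 1
  have := congrArg (Units.val) (braidSign_mul_prefixSign hβ (deg ∘ x) σ a i)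
  simp only [Units.val_mul] at this
  rw [← Function.comp_assoc, this]
  ring

end PermCommute

/-! ### The involution on labels and the form in the standard basis -/

namespace Idx

variable {r s e : ℕ}

@[simp] theorem star_star (i : Idx r s e) : i.star.star = i := by cases i <;> rfl

/-- `star` as an equivalence. -/
def starEquiv : Idx r s e ≃ Idx r s e where
  toFun := star
  invFun := star
  left_inv := star_star
  right_inv := star_star

theorem pairing_mul_self (κ : Type*) [Ring κ] (i : Idx r s e) :
    i.pairing κ * i.pairing κ = 1 := by cases i <;> simp [pairing]

theorem eq_star_comm {i j : Idx r s e} : i = j.star ↔ j = i.star :=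
  ⟨fun h => by rw [h, star_star], fun h => by rw [h, star_star]⟩

end Idx

section Form

variable {κ G V : Type*} [Field κ] [CommGroup G] [Fintype G] [DecidableEq G]
  [AddCommGroup V] [Module κ V] {𝒱 : G → Submodule κ V}
  {form : LinearMap.BilinForm κ V} {β : G → G → κˣ} {r s e : ℕ}
  {b : Basis (Idx r s e) κ V} {deg : Idx r s e → G}

/-- Otherwise orthogonality of the homogeneous components would make the pairing of a basis element
with its dual vanish. -/
theorem IsSpoBasis.deg_star (hform : IsColorSkewForm β 𝒱 form)
    (hb : IsSpoBasis β 𝒱 form b deg) (i : Idx r s e) : deg i.star = (deg i)⁻¹ := by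
  by_contra h
  have h₁ := hform.orthogonal (deg i) (deg i.star)
    (fun h' => h (by rw [h', inv_inv])) _ (hb.homogeneous i) _ (hb.homogeneous i.star)
  rw [hb.form_eq, if_pos rfl] at h₁
  have h₂ := i.pairing_mul_self κ
  rw [h₁] at h₂
  simp at h₂

theorem IsSpoBasis.formMatrix_inv (hb : IsSpoBasis β 𝒱 form b deg) (i j : Idx r s e) :
    (formMatrix form b)⁻¹ i j = if j = i.star then i.star.pairing κ else 0 := by
  have h : (formMatrix form b)⁻¹ =
      Matrix.of fun i j : Idx r s e => if j = i.star then i.star.pairing κ else 0 := by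
    refine Matrix.inv_eq_right_inv ?_
    ext i j
    rw [Matrix.mul_apply, Finset.sum_eq_single i.star]
    · simp only [formMatrix, Matrix.of_apply, hb.form_eq, if_true, Idx.star_star]
      by_cases hij : j = i
      · rw [if_pos hij, hij, Idx.pairing_mul_self, Matrix.one_apply_eq]
      · rw [if_neg hij, mul_zero, Matrix.one_apply_ne (Ne.symm hij)]
    · intro m _ hm
      simp [formMatrix, hb.form_eq, hm]
    · simp
  rw [h]
  rfl

/-- The defining relation of `spo` as a relation between two matrix entries. It serves both ends of
a contraction: the form on top and the dual tensor at the bottom. -/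
theorem IsSpoBasis.invariance (hb : IsSpoBasis β 𝒱 form b deg) {a : G} {y : End κ V}
    (hy : y ∈ spoHom β 𝒱 form a) (i j : Idx r s e) :
    b.repr (y (b i)) j.star * j.star.pairing κ +
      (β (deg i) a : κ) * (b.repr (y (b j)) i.star * i.pairing κ) = 0 := by
  have h := hy.2 (deg i) (b i) (hb.homogeneous i) (b j)
  have h₁ : form (y (b i)) (b j) = b.repr (y (b i)) j.star * j.star.pairing κ := by
    conv_lhs => rw [← b.sum_repr (y (b i))]
    rw [map_sum, LinearMap.sum_apply, Finset.sum_eq_single j.star]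
    · simp [hb.form_eq]
    · intro m _ hm
      have : ¬ j = m.star := fun h => hm (Idx.eq_star_comm.1 h)
      simp [hb.form_eq, this]
    · simp
  have h₂ : form (b i) (y (b j)) = b.repr (y (b j)) i.star * i.pairing κ := by
    conv_lhs => rw [← b.sum_repr (y (b j))]
    rw [map_sum, Finset.sum_eq_single i.star]
    · simp [hb.form_eq]
    · intro m _ hm
      simp [hb.form_eq, hm]
    · simp
  rwa [h₁, h₂] at h

end Form

/-! ### Contractions on basis tensors -/

section Contraction

variable {κ G V : Type*} [Field κ] [CommGroup G] [Fintype G] [DecidableEq G]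
  [AddCommGroup V] [Module κ V] {𝒱 : G → Submodule κ V}
  {form : LinearMap.BilinForm κ V} {β : G → G → κˣ} {r s e : ℕ}
  {b : Basis (Idx r s e) κ V} {deg : Idx r s e → G} {k : ℕ}

/-- The product of `β(g_i, a)` over the positions `i` strictly between `p` and `q`. -/
def betweenSign (β : G → G → κˣ) (g : Fin k → G) (p q : Fin k) (a : G) : κˣ :=
  ∏ i, if p < i ∧ i < q then β (g i) a else 1

/-- The labeling `x` with the labels `m` and `m^*` put at `p` and `q`. -/
def putPair (x : Fin k → Idx r s e) (p q : Fin k) (m : Idx r s e) : Fin k → Idx r s e :=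
  Function.update (Function.update x p m) q m.star

theorem putPair_left (x : Fin k → Idx r s e) {p q : Fin k} (hpq : p ≠ q) (m : Idx r s e) :
    putPair x p q m p = m := by simp [putPair, hpq]

theorem putPair_right (x : Fin k → Idx r s e) (p q : Fin k) (m : Idx r s e) :
    putPair x p q m q = m.star := by simp [putPair]

theorem putPair_of_ne (x : Fin k → Idx r s e) {p q i : Fin k} (hp : i ≠ p) (hq : i ≠ q)
    (m : Idx r s e) : putPair x p q m i = x i := by simp [putPair, hp, hq]

/-- The scalar depending on the top labels in the formula for `c_{p,q}`. -/
def capWeight (β : G → G → κˣ) (deg : Idx r s e → G) (p q : Fin k) (x : Fin k → Idx r s e) : κ :=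
  if x q = (x p).star then (x p).pairing κ * betweenSign β (deg ∘ x) p q (deg (x p)) else 0

/-- The scalar depending on the bottom label `m` in the formula for `c_{p,q}`. -/
def cupWeight (β : G → G → κˣ) (deg : Idx r s e → G) (p q : Fin k) (x : Fin k → Idx r s e)
    (m : Idx r s e) : κ :=
  m.star.pairing κ * betweenSign β (deg ∘ x) p q (deg m.star)

/-- Each vertical strand between `p` and `q` crosses the top and the bottom horizontal edge once.
The two minus signs cancel, and there remain one `β` factor for the label at `p` on top and one for
the label at `q` at the bottom. -/
theorem diagramWeight_contraction (hβ : IsSymmetricBicharacter β)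
    (hb : IsSpoBasis β 𝒱 form b deg) {p q : Fin k} (hpq : p < q) (x y : Fin k → Idx r s e) :
    diagramWeight β form b deg (BrauerDiagram.contraction p q hpq.ne) x y =
      if y = putPair x p q (y p) then capWeight β deg p q x * cupWeight β deg p q x (y p)
      else 0 := by
  have hqp := hpq.ne'
  have pl : ∀ i : Fin k, unfoldPos (.inl i : Fin k ⊕ Fin k) = 2 * k - 1 - i := fun _ => rfl
  have pr : ∀ i : Fin k, unfoldPos (.inr i : Fin k ⊕ Fin k) = i := fun _ => rfl
  have hedge : (∏ v, if unfoldPos v <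
      unfoldPos ((BrauerDiagram.contraction p q hpq.ne).partner v)
      then edgeWeight form b x y v ((BrauerDiagram.contraction p q hpq.ne).partner v) else 1) =
      (if y = putPair x p q (y p) then
        (if x q = (x p).star then (x p).pairing κ else 0) * (y p).star.pairing κ else 0) := by
    rw [Fintype.prod_sum_type]
    have h₁ : (∏ i : Fin k, if unfoldPos (.inl i : Fin k ⊕ Fin k) <
        unfoldPos ((BrauerDiagram.contraction p q hpq.ne).partner (.inl i))
        then edgeWeight form b x y (.inl i)
          ((BrauerDiagram.contraction p q hpq.ne).partner (.inl i)) else 1) =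
        if x q = (x p).star then (x p).pairing κ else 0 := by
      -- Unfolding reverses the top row, so the top edge begins at `q`.
      rw [Finset.prod_eq_single q]
      · have : (BrauerDiagram.contraction p q hpq.ne).partner (.inl q) = .inl p := by
          simp [BrauerDiagram.contraction, hqp]
        rw [this, pl, pl, if_pos (by rw [Fin.lt_def] at hpq; omega)]
        simp [edgeWeight, formMatrix, hb.form_eq]
      · intro i _ hi
        by_cases hip : i = p
        · subst hip
          have : (BrauerDiagram.contraction i q hpq.ne).partner (.inl i) = .inl q := by
            simp [BrauerDiagram.contraction]
          rw [this, pl, pl, if_neg (by rw [Fin.lt_def] at hpq; omega)]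
        · have : (BrauerDiagram.contraction p q hpq.ne).partner (.inl i) = .inr i := by
            simp [BrauerDiagram.contraction, hi, hip]
          rw [this, pl, pr, if_neg (by omega)]
      · simp
    have h₂ : (∏ i : Fin k, if unfoldPos (.inr i : Fin k ⊕ Fin k) <
        unfoldPos ((BrauerDiagram.contraction p q hpq.ne).partner (.inr i))
        then edgeWeight form b x y (.inr i)
          ((BrauerDiagram.contraction p q hpq.ne).partner (.inr i)) else 1) =
        ∏ i, if i = p then (if y q = (y p).star then (y p).star.pairing κ else 0)
          else if i = q then 1 else if x i = y i then 1 else 0 := by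
      refine Finset.prod_congr rfl fun i _ => ?_
      by_cases hip : i = p
      · subst hip
        have : (BrauerDiagram.contraction i q hpq.ne).partner (.inr i) = .inr q := by
          simp [BrauerDiagram.contraction]
        rw [this, pr, pr, if_pos (Fin.lt_def.1 hpq), if_pos rfl]
        simp [edgeWeight, hb.formMatrix_inv]
      · by_cases hiq : i = q
        · subst hiq
          have : (BrauerDiagram.contraction p i hpq.ne).partner (.inr i) = .inr p := by
            simp [BrauerDiagram.contraction, hip]
          rw [this, pr, pr, if_neg (by rw [Fin.lt_def] at hpq; omega), if_neg hip, if_pos rfl]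
        · have : (BrauerDiagram.contraction p q hpq.ne).partner (.inr i) = .inl i := by
            simp [BrauerDiagram.contraction, hiq, hip]
          rw [this, pl, pr, if_pos (by omega), if_neg hip, if_neg hiq]
          rfl
    rw [h₁, h₂]
    by_cases hy : y = putPair x p q (y p)
    · rw [if_pos hy]
      congr 1
      rw [Finset.prod_eq_single p]
      · have : y q = (y p).star := by
          conv_lhs => rw [hy]
          exact putPair_right _ _ _ _
        simp [this]
      · intro i _ hi
        rw [if_neg hi]
        by_cases hiq : i = q
        · rw [if_pos hiq]
        · have : y i = x i := by
            conv_lhs => rw [hy]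
            exact putPair_of_ne _ hi hiq _
          rw [if_neg hiq, if_pos this.symm]
      · simp
    · rw [if_neg hy]
      obtain ⟨i, hi⟩ := Function.ne_iff.1 hy
      by_cases hip : i = p
      · subst hip
        rw [putPair_left _ hpq.ne] at hi
        exact absurd rfl hi
      by_cases hiq : i = q
      · subst hiq
        rw [putPair_right] at hi
        rw [Finset.prod_eq_zero (Finset.mem_univ p), mul_zero]
        rw [if_pos rfl, if_neg hi]
      · rw [putPair_of_ne _ hip hiq] at hi
        rw [Finset.prod_eq_zero (Finset.mem_univ i), mul_zero]
        rw [if_neg hip, if_neg hiq, if_neg (Ne.symm hi)]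
  have hcross : (∏ v, ∏ w, if unfoldPos v < unfoldPos w ∧
      unfoldPos w < unfoldPos ((BrauerDiagram.contraction p q hpq.ne).partner v) ∧
      unfoldPos ((BrauerDiagram.contraction p q hpq.ne).partner v) <
        unfoldPos ((BrauerDiagram.contraction p q hpq.ne).partner w)
      then -(β (vertexDeg deg x y ((BrauerDiagram.contraction p q hpq.ne).partner v))
        (vertexDeg deg x y ((BrauerDiagram.contraction p q hpq.ne).partner w)) : κ) else 1) =
      betweenSign β (deg ∘ x) p q (deg (x p)) * betweenSign β (deg ∘ x) p q (deg (y q)) := by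
    have plp : (BrauerDiagram.contraction p q hpq.ne).partner (.inl p) = .inl q := by
      simp [BrauerDiagram.contraction]
    have plq : (BrauerDiagram.contraction p q hpq.ne).partner (.inl q) = .inl p := by
      simp [BrauerDiagram.contraction, hqp]
    have prp : (BrauerDiagram.contraction p q hpq.ne).partner (.inr p) = .inr q := by
      simp [BrauerDiagram.contraction]
    have prq : (BrauerDiagram.contraction p q hpq.ne).partner (.inr q) = .inr p := by
      simp [BrauerDiagram.contraction, hqp]
    have pln : ∀ i, i ≠ p → i ≠ q →
        (BrauerDiagram.contraction p q hpq.ne).partner (.inl i) = .inr i := fun i h h' => by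
      simp [BrauerDiagram.contraction, h, h']
    have prn : ∀ i, i ≠ p → i ≠ q →
        (BrauerDiagram.contraction p q hpq.ne).partner (.inr i) = .inl i := fun i h h' => by
      simp [BrauerDiagram.contraction, h, h']
    generalize (BrauerDiagram.contraction p q hpq.ne).partner = P at *
    have hlt := Fin.lt_def.1 hpq
    have hll : ∀ i w, ¬ (unfoldPos (.inl i : Fin k ⊕ Fin k) < unfoldPos w ∧
        unfoldPos w < unfoldPos (P (.inl i)) ∧ unfoldPos (P (.inl i)) < unfoldPos (P w)) := by
      intro i w
      rcases w with j | j
      all_goals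
        by_cases hip : i = p
        · subst hip; simp only [plp, pl, pr]; omega
        by_cases hiq : i = q
        · subst hiq
          rw [plq]
          by_cases hjp : j = p
          · subst hjp; simp only [pl, pr]; omega
          by_cases hjq : j = i
          · subst hjq; simp only [pl, pr]; omega
          · simp only [pl, pr, pln j hjp hjq, prn j hjp hjq]; omega
        · simp only [pln i hip hiq, pl, pr]; omega
    -- These are the crossings of a vertical strand with the top edge; `hrr` collects those with the
    -- bottom edge, where the vertical strand comes second.
    have hrl : ∀ i j, (unfoldPos (.inr i : Fin k ⊕ Fin k) < unfoldPos (.inl j : Fin k ⊕ Fin k) ∧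
        unfoldPos (.inl j : Fin k ⊕ Fin k) < unfoldPos (P (.inr i)) ∧
        unfoldPos (P (.inr i)) < unfoldPos (P (.inl j))) ↔ j = q ∧ p < i ∧ i < q := by
      intro i j
      by_cases hip : i = p
      · subst hip; simp only [prp, pl, pr, lt_irrefl, false_and, and_false, iff_false]; omega
      by_cases hiq : i = q
      · subst hiq; simp only [prq, pl, pr, lt_irrefl, and_false, iff_false]; omega
      by_cases hjp : j = p
      · subst hjp
        simp only [prn i hip hiq, plp, pl, pr, hpq.ne, false_and, iff_false]; omega
      by_cases hjq : j = q
      · subst hjq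
        simp only [prn i hip hiq, plq, pl, pr, true_and, Fin.lt_def]; omega
      · simp only [prn i hip hiq, pln j hjp hjq, pl, pr, hjq, false_and, iff_false]; omega
    have hrr : ∀ i j, (unfoldPos (.inr i : Fin k ⊕ Fin k) < unfoldPos (.inr j : Fin k ⊕ Fin k) ∧
        unfoldPos (.inr j : Fin k ⊕ Fin k) < unfoldPos (P (.inr i)) ∧
        unfoldPos (P (.inr i)) < unfoldPos (P (.inr j))) ↔ i = p ∧ p < j ∧ j < q := by
      intro i j
      by_cases hip : i = p
      · subst hip
        by_cases hjp : j = i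
        · subst hjp; simp only [pr, lt_irrefl, false_and, and_false]
        by_cases hjq : j = q
        · subst hjq; simp only [prp, pr, lt_irrefl, false_and, and_false]
        · simp only [prp, prn j hjp hjq, pl, pr, true_and, Fin.lt_def]; omega
      by_cases hiq : i = q
      · subst hiq; simp only [prq, pr, hip, false_and, iff_false]; omega
      by_cases hjp : j = p
      · subst hjp
        simp only [prn i hip hiq, prp, pl, pr, hip, false_and, iff_false]; omega
      by_cases hjq : j = q
      · subst hjq
        simp only [prn i hip hiq, prq, pl, pr, hip, false_and, iff_false]; omega
      · simp only [prn i hip hiq, prn j hjp hjq, pl, pr, hip, false_and, iff_false]; omega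
    rw [Fintype.prod_sum_type, Finset.prod_eq_one, one_mul]
    · have hin : ∀ i, (∏ w, if unfoldPos (.inr i : Fin k ⊕ Fin k) < unfoldPos w ∧
          unfoldPos w < unfoldPos (P (.inr i)) ∧ unfoldPos (P (.inr i)) < unfoldPos (P w)
          then -(β (vertexDeg deg x y (P (.inr i))) (vertexDeg deg x y (P w)) : κ) else 1) =
          (if p < i ∧ i < q then -(β (deg (x i)) (deg (x p)) : κ) else 1) *
          ∏ j, if i = p ∧ p < j ∧ j < q then -(β (deg (x j)) (deg (y q)) : κ) else 1 := by
        intro i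
        rw [Fintype.prod_sum_type]
        simp only [hrl, hrr]
        congr 1
        · rw [Finset.prod_eq_single q]
          · by_cases h : p < i ∧ i < q
            · rw [if_pos ⟨rfl, h⟩, if_pos h, plq, prn i h.1.ne' h.2.ne]
              simp only [vertexDeg, hβ.inv_left, hβ.inv_right, inv_inv]
            · rw [if_neg (fun h' => h h'.2), if_neg h]
          · intro j _ hj
            exact if_neg fun h => hj h.1
          · simp
        · refine Finset.prod_congr rfl fun j _ => ?_
          by_cases h : i = p ∧ p < j ∧ j < q
          · rw [if_pos h, if_pos h, h.1, prp, prn j h.2.1.ne' h.2.2.ne]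
            simp only [vertexDeg, hβ.inv_right]
            rw [← hβ.swap]
          · rw [if_neg h, if_neg h]
      simp only [hin]
      rw [Finset.prod_mul_distrib, Finset.prod_eq_single (a := p)
        (f := fun i => ∏ j, if i = p ∧ p < j ∧ j < q then -(β (deg (x j)) (deg (y q)) : κ) else 1)]
      · unfold betweenSign
        push_cast
        rw [← Finset.prod_mul_distrib, ← Finset.prod_mul_distrib]
        refine Finset.prod_congr rfl fun i _ => ?_
        by_cases h : p < i ∧ i < q <;> simp [h]
      · intro i _ hi
        exact Finset.prod_eq_one fun j _ => if_neg fun h => hi h.1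
      · simp
    · intro i _
      exact Finset.prod_eq_one fun w _ => if_neg (hll i w)
  unfold diagramWeight
  rw [hedge, hcross]
  by_cases hy : y = putPair x p q (y p)
  · have hyq : y q = (y p).star := by
      conv_lhs => rw [hy]
      exact putPair_right _ _ _ _
    rw [if_pos hy, if_pos hy, hyq]
    unfold capWeight cupWeight
    split_ifs <;> ring
  · rw [if_neg hy, if_neg hy, zero_mul]

theorem putPair_injective (x : Fin k → Idx r s e) {p q : Fin k} (hpq : p ≠ q) :
    Function.Injective (putPair x p q) := fun m m' h => by
  simpa [putPair_left _ hpq] using congrFun h p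

theorem brauerAct_contraction (hβ : IsSymmetricBicharacter β)
    (hb : IsSpoBasis β 𝒱 form b deg) {p q : Fin k} (hpq : p < q) (x : Fin k → Idx r s e) :
    brauerAct β form b deg (BrauerDiagram.contraction p q hpq.ne) (tensorBasis k b x) =
      ∑ m, (capWeight β deg p q x * cupWeight β deg p q x m) •
        tensorBasis k b (putPair x p q m) := by
  rw [brauerAct_tensorBasis]
  symm
  refine Fintype.sum_of_injective _ (putPair_injective x hpq.ne) _ _ (fun y hy => ?_) fun m => ?_
  · rw [diagramWeight_contraction hβ hb hpq, if_neg fun h => hy ⟨y p, h.symm⟩, zero_smul]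
  · rw [diagramWeight_contraction hβ hb hpq, putPair_left _ hpq.ne, if_pos]
    simp [putPair]

end Contraction

/-! ### The action commutes with contractions -/

section Commute

variable {κ G V : Type*} [Field κ] [CommGroup G] [Fintype G] [DecidableEq G]
  [AddCommGroup V] [Module κ V] {𝒱 : G → Submodule κ V} [DirectSum.Decomposition 𝒱]
  {form : LinearMap.BilinForm κ V} {β : G → G → κˣ} {r s e : ℕ}
  {b : Basis (Idx r s e) κ V} {deg : Idx r s e → G} {k : ℕ}

theorem betweenSign_mul (hβ : IsSymmetricBicharacter β) (g : Fin k → G) (p q : Fin k) (a c : G) :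
    betweenSign β g p q (a * c) = betweenSign β g p q a * betweenSign β g p q c := by
  unfold betweenSign
  rw [← Finset.prod_mul_distrib]
  refine Finset.prod_congr rfl fun i _ => ?_
  split_ifs
  · exact hβ.mul_right _ _ _
  · rw [mul_one]

theorem prod_ite_update {M : Type*} [CommMonoid M] (P : Fin k → Prop) [DecidablePred P]
    (f : G → M) (g : Fin k → G) (i : Fin k) (c : G) (d : M) (h : f c = f (g i) * d) :
    (∏ j, if P j then f (Function.update g i c j) else 1) =
      (∏ j, if P j then f (g j) else 1) * if P i then d else 1 := by
  have h₁ : ∀ j, (if P j then f (Function.update g i c j) else 1) =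
      (if P j then f (g j) else 1) * if j = i then (if P i then d else 1) else 1 := by
    intro j
    by_cases hj : j = i
    · subst hj
      by_cases hP : P j <;> simp [hP, h]
    · simp [hj]
  simp only [h₁, Finset.prod_mul_distrib, Finset.prod_ite_eq', Finset.mem_univ, if_true]

theorem betweenSign_update (hβ : IsSymmetricBicharacter β) (g : Fin k → G) (p q i : Fin k)
    (a c : G) : betweenSign β (Function.update g i (a * g i)) p q c =
      betweenSign β g p q c * if p < i ∧ i < q then β a c else 1 :=
  prod_ite_update (fun j => p < j ∧ j < q) (fun u => β u c) g i (a * g i) (β a c)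
    (by rw [hβ.mul_left, mul_comm])

theorem betweenSign_update_of_not (g : Fin k → G) {p q i : Fin k} (hi : ¬(p < i ∧ i < q))
    (a c : G) : betweenSign β (Function.update g i a) p q c = betweenSign β g p q c := by
  have := prod_ite_update (fun j => p < j ∧ j < q) (fun u => β u c) g i a
    ((β (g i) c)⁻¹ * β a c) (by simp)
  rwa [if_neg hi, mul_one] at this

theorem prefixSign_update (g : Fin k → G) (a c : G) (i j : Fin k) :
    prefixSign β (Function.update g j c) a i =
      prefixSign β g a i * if j < i then (β (g j) a)⁻¹ * β c a else 1 :=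
  prod_ite_update (fun l => l < i) (fun u => β u a) g j c _ (by simp)

theorem prefixSign_eq_mul_betweenSign (g : Fin k → G) (a : G) {p q : Fin k} (hpq : p < q) :
    prefixSign β g a q = prefixSign β g a p * β (g p) a * betweenSign β g p q a := by
  have h : β (g p) a = ∏ j, if j = p then β (g j) a else 1 := by simp
  rw [h]
  unfold prefixSign betweenSign
  rw [← Finset.prod_mul_distrib, ← Finset.prod_mul_distrib]
  refine Finset.prod_congr rfl fun j _ => ?_
  rcases lt_trichotomy j p with hj | hj | hj
  · simp [hj, hj.trans hpq, hj.ne, hj.not_gt]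
  · subst hj; simp [hpq]
  · simp [hj, hj.ne', hj.not_gt]

theorem comp_putPair (x : Fin k → Idx r s e) (p q : Fin k) (m : Idx r s e) :
    deg ∘ putPair x p q m =
      Function.update (Function.update (deg ∘ x) p (deg m)) q (deg m.star) := by
  unfold putPair
  rw [Function.comp_update, Function.comp_update]

/-- Left of `p` nothing changes. Right of `q` the labels at `p` and `q` have inverse degrees before
and after contraction, so their prefix factors cancel. In between, the prefix sees only the change
at `p`, which the added degree `a` in the cap and cup weights compensates. -/
theorem capWeight_update_mul_prefixSign (hβ : IsSymmetricBicharacter β)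
    (hstar : ∀ i : Idx r s e, deg i.star = (deg i)⁻¹) {p q i : Fin k} (hpq : p < q)
    (hp : i ≠ p) (hq : i ≠ q) (x : Fin k → Idx r s e) {a : G} {n : Idx r s e}
    (hn : deg n = a * deg (x i)) (m : Idx r s e) :
    (prefixSign β (deg ∘ x) a i : κ) * (capWeight β deg p q (Function.update x i n) *
        cupWeight β deg p q (Function.update x i n) m) =
      capWeight β deg p q x * cupWeight β deg p q x m *
        prefixSign β (deg ∘ putPair x p q m) a i := by
  have hu : deg ∘ Function.update x i n = Function.update (deg ∘ x) i (a * (deg ∘ x) i) := by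
    rw [Function.comp_update, hn]; rfl
  unfold capWeight cupWeight
  rw [Function.update_of_ne hp.symm, Function.update_of_ne hq.symm]
  by_cases hx : x q = (x p).star
  swap
  · simp [hx]
  rw [if_pos hx, if_pos hx, hu, betweenSign_update hβ, betweenSign_update hβ, comp_putPair,
    prefixSign_update, prefixSign_update, Function.update_of_ne hpq.ne']
  have hdq : (deg ∘ x) q = (deg (x p))⁻¹ := by rw [Function.comp_apply, hx, hstar]
  rw [hdq, hstar m, Function.comp_apply]
  have key : ((if p < i ∧ i < q then β a (deg (x p)) else 1) *
      (if p < i ∧ i < q then β a (deg m)⁻¹ else 1)) =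
      (if p < i then (β (deg (x p)) a)⁻¹ * β (deg m) a else 1) *
      (if q < i then (β (deg (x p))⁻¹ a)⁻¹ * β (deg m)⁻¹ a else 1) := by
    rw [hβ.inv_right, hβ.inv_left, hβ.inv_left, inv_inv, hβ.swap (deg (x p)) a,
      hβ.swap (deg m) a, inv_inv]
    rcases lt_or_gt_of_ne hp with h | h
    · simp [h.not_gt, (h.trans hpq).not_gt]
    · rcases lt_or_gt_of_ne hq with h' | h'
      · simp [h, h', h'.not_gt]
      · simp only [h, h', h'.not_gt, if_true, if_false, and_false]
        rw [mul_one, mul_mul_mul_comm, inv_mul_cancel, one_mul, mul_inv_cancel]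
  have key' := congrArg Units.val key
  simp only [Units.val_mul] at key' ⊢
  linear_combination (prefixSign β (deg ∘ x) a i : κ) * (x p).pairing κ *
    betweenSign β (deg ∘ x) p q (deg (x p)) * m.star.pairing κ *
    betweenSign β (deg ∘ x) p q (deg m)⁻¹ * key'

/-- Terms acting away from `p` and `q` agree one by one. The two terms acting at `p` and `q` cancel
on each side separately: before contracting because the form is invariant, after contracting because
the inserted dual tensor is invariant. -/
theorem homAct_comm_contraction (hβ : IsSymmetricBicharacter β) (hform : IsColorSkewForm β 𝒱 form)
    (hb : IsSpoBasis β 𝒱 form b deg) {a : G} {y : End κ V} (hy : y ∈ spoHom β 𝒱 form a)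
    {p q : Fin k} (hpq : p < q) :
    Commute (homAct β 𝒱 k a y)
      (brauerAct β form b deg (BrauerDiagram.contraction p q hpq.ne)) := by
  have hdeg := hb.homogeneous
  have hstar := hb.deg_star hform
  have hent : ∀ m i, b.repr (y (b i)) m ≠ 0 → deg m = a * deg i := fun m i h => by
    by_contra hne
    exact h (repr_eq_zero_of_mem hdeg (hy.1 _ _ (hdeg i)) hne)
  set E := brauerAct β form b deg (BrauerDiagram.contraction p q hpq.ne) with hE
  refine (tensorBasis k b).ext fun x => ?_
  set term : (Fin k → Idx r s e) → Fin k → ⨂[κ] _ : Fin k, V := fun x i =>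
    (prefixSign β (deg ∘ x) a i : κ) •
      ∑ m, b.repr (y (b (x i))) m • tensorBasis k b (Function.update x i m) with hterm
  have hA : ∀ x, homAct β 𝒱 k a y (tensorBasis k b x) = ∑ i, term x i :=
    homAct_tensorBasis β hdeg a y
  have hEx : ∀ x, E (tensorBasis k b x) = ∑ m, (capWeight β deg p q x * cupWeight β deg p q x m) •
      tensorBasis k b (putPair x p q m) := brauerAct_contraction hβ hb hpq
  set U : Fin k → ⨂[κ] _ : Fin k, V := fun i =>
    ∑ m, (capWeight β deg p q x * cupWeight β deg p q x m) • term (putPair x p q m) i with hU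
  have hother : ∀ i, i ≠ p ∧ i ≠ q → E (term x i) - U i = 0 := by
    rintro i ⟨hp, hq⟩
    rw [sub_eq_zero]
    simp only [hterm, hU, map_smul, map_sum, hEx, Finset.smul_sum, smul_smul,
      putPair_of_ne x hp hq]
    rw [Finset.sum_comm]
    refine Finset.sum_congr rfl fun m _ => Finset.sum_congr rfl fun n _ => ?_
    have hcomm : putPair (Function.update x i n) p q m =
        Function.update (putPair x p q m) i n := by
      unfold putPair
      rw [Function.update_comm hp, Function.update_comm hq]
    rw [hcomm]
    by_cases h : b.repr (y (b (x i))) n = 0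
    · simp [h]
    congr 1
    have := capWeight_update_mul_prefixSign hβ hstar hpq hp hq x (hent _ _ h) m
    linear_combination b.repr (y (b (x i))) n * this
  have hsq := fun i : Idx r s e => i.pairing_mul_self κ
  have hcup : ∀ i ∈ ({p, q} : Finset (Fin k)), ∀ n m,
      cupWeight β deg p q (Function.update x i n) m = cupWeight β deg p q x m := by
    intro i hi n m
    unfold cupWeight
    rw [Function.comp_update, betweenSign_update_of_not]
    rcases Finset.mem_insert.1 hi with rfl | hi
    · simp
    · rw [Finset.mem_singleton.1 hi]; simp
  have hbet : ∀ i ∈ ({p, q} : Finset (Fin k)), ∀ n c,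
      betweenSign β (deg ∘ Function.update x i n) p q c = betweenSign β (deg ∘ x) p q c := by
    intro i hi n m
    rw [Function.comp_update, betweenSign_update_of_not]
    rcases Finset.mem_insert.1 hi with rfl | hi
    · simp
    · rw [Finset.mem_singleton.1 hi]; simp
  have hcap : E (term x p) + E (term x q) = 0 := by
    set W := ∑ m, cupWeight β deg p q x m • tensorBasis k b (putPair x p q m) with hW
    have hp : E (term x p) = ((prefixSign β (deg ∘ x) a p : κ) *
        (b.repr (y (b (x p))) (x q).star * ((x q).star.pairing κ *
          betweenSign β (deg ∘ x) p q (deg (x q).star)))) • W := by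
      simp only [hterm, map_smul, map_sum, hEx]
      rw [mul_smul, Finset.sum_eq_single (x q).star]
      · rw [mul_smul, hW, Finset.smul_sum (s := Finset.univ) (r := (x q).star.pairing κ * _)]
        congr 2
        refine Finset.sum_congr rfl fun m _ => ?_
        rw [hcup p (by simp), smul_smul]
        congr 1
        · unfold capWeight
          rw [hbet p (by simp)]
          simp [Function.update_of_ne hpq.ne']
        · simp [putPair]
      · intro n _ hn
        have : ¬ x q = n.star := fun h => hn (Idx.eq_star_comm.1 h)
        rw [Finset.sum_eq_zero, smul_zero]
        intro m _
        simp [capWeight, Function.update_of_ne hpq.ne', this]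
      · simp
    have hq : E (term x q) = ((prefixSign β (deg ∘ x) a q : κ) *
        (b.repr (y (b (x q))) (x p).star * ((x p).pairing κ *
          betweenSign β (deg ∘ x) p q (deg (x p))))) • W := by
      simp only [hterm, map_smul, map_sum, hEx]
      rw [mul_smul, Finset.sum_eq_single (x p).star]
      · rw [mul_smul, hW, Finset.smul_sum (s := Finset.univ) (r := (x p).pairing κ * _)]
        congr 2
        refine Finset.sum_congr rfl fun m _ => ?_
        rw [hcup q (by simp), smul_smul]
        congr 1
        · unfold capWeight
          rw [hbet q (by simp)]
          simp [Function.update_of_ne hpq.ne]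
        · congr 1
          unfold putPair
          rw [Function.update_comm hpq.ne, Function.update_idem, Function.update_comm hpq.ne']
      · intro n _ hn
        rw [Finset.sum_eq_zero, smul_zero]
        intro m _
        simp [capWeight, Function.update_of_ne hpq.ne, hn]
      · simp
    rw [hp, hq, ← add_smul, prefixSign_eq_mul_betweenSign _ _ hpq]
    have hinv := hb.invariance hy (x p) (x q)
    -- A nonzero entry forces the degree relation that makes the signs match; a zero entry makes its
    -- partner vanish through invariance.
    by_cases h : b.repr (y (b (x p))) (x q).star = 0
    · have h' : b.repr (y (b (x q))) (x p).star = 0 := by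
        rw [h, zero_mul, zero_add] at hinv
        have := (mul_eq_zero.1 hinv).resolve_left (Units.ne_zero _)
        linear_combination (x p).pairing κ * this - b.repr (y (b (x q))) (x p).star * hsq (x p)
      rw [h, h']; simp
    · rw [hent _ _ h, betweenSign_mul hβ]
      rw [← zero_smul κ W]
      congr 1
      simp only [Units.val_mul, Function.comp_apply]
      linear_combination (prefixSign β (deg ∘ x) a p : κ) * betweenSign β (deg ∘ x) p q a *
        betweenSign β (deg ∘ x) p q (deg (x p)) * hinv
  have hcupU : U p + U q = 0 := by
    have hBeta : ∀ m, (prefixSign β (deg ∘ putPair x p q m) a p : κ) =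
        prefixSign β (deg ∘ x) a p := fun m => by
      rw [comp_putPair, prefixSign_update, prefixSign_update]
      simp [hpq.not_gt]
    have hbet' : ∀ m c, betweenSign β (deg ∘ putPair x p q m) p q c =
        betweenSign β (deg ∘ x) p q c := fun m c => by
      rw [comp_putPair, betweenSign_update_of_not _ (by simp),
        betweenSign_update_of_not _ (by simp)]
    -- The cup label is replaced by its dual, so that here and in `hq` the tensor carries `m` at `p`
    -- and `n` at `q`.
    have hp : U p = ∑ n, ∑ m, (capWeight β deg p q x * cupWeight β deg p q x n.star *
        (prefixSign β (deg ∘ x) a p * b.repr (y (b n.star)) m)) •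
        tensorBasis k b (Function.update (Function.update x p m) q n) := by
      simp only [hU, hterm]
      rw [← Equiv.sum_comp Idx.starEquiv]
      refine Finset.sum_congr rfl fun n _ => ?_
      rw [show Idx.starEquiv n = n.star from rfl, Finset.smul_sum, Finset.smul_sum]
      refine Finset.sum_congr rfl fun m _ => ?_
      rw [hBeta, smul_smul, smul_smul, putPair_left _ hpq.ne, putPair, Idx.star_star,
        Function.update_comm hpq.ne', Function.update_idem]
      ring_nf
    have hq : U q = ∑ n, ∑ m, (capWeight β deg p q x * cupWeight β deg p q x m *
        (prefixSign β (deg ∘ x) a p * β (deg m) a * betweenSign β (deg ∘ x) p q a *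
          b.repr (y (b m.star)) n)) •
        tensorBasis k b (Function.update (Function.update x p m) q n) := by
      simp only [hU, hterm]
      rw [Finset.sum_comm]
      refine Finset.sum_congr rfl fun m _ => ?_
      rw [Finset.smul_sum, Finset.smul_sum]
      refine Finset.sum_congr rfl fun n _ => ?_
      rw [prefixSign_eq_mul_betweenSign _ _ hpq, hbet', Units.val_mul, Units.val_mul, hBeta,
        smul_smul, smul_smul, putPair_right, putPair, Function.update_idem]
      simp only [Function.comp_apply, Function.update_of_ne hpq.ne, Function.update_self]
      ring_nf
    rw [hp, hq, ← Finset.sum_add_distrib]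
    refine Finset.sum_eq_zero fun n _ => ?_
    rw [← Finset.sum_add_distrib]
    refine Finset.sum_eq_zero fun m _ => ?_
    rw [← add_smul]
    have hinv := hb.invariance hy m.star n.star
    rw [Idx.star_star, Idx.star_star] at hinv
    have hββ : (β (deg m) a : κ) * β (deg m.star) a = 1 := by
      rw [hstar, hβ.inv_left, ← Units.val_mul, mul_inv_cancel, Units.val_one]
    have : capWeight β deg p q x * cupWeight β deg p q x n.star *
        (prefixSign β (deg ∘ x) a p * b.repr (y (b n.star)) m) +
        capWeight β deg p q x * cupWeight β deg p q x m *
        (prefixSign β (deg ∘ x) a p * β (deg m) a * betweenSign β (deg ∘ x) p q a *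
          b.repr (y (b m.star)) n) = 0 := by
      unfold cupWeight
      rw [Idx.star_star]
      by_cases h : b.repr (y (b m.star)) n = 0
      · have h' : b.repr (y (b n.star)) m = 0 := by
          rw [h, zero_mul, zero_add] at hinv
          have := (mul_eq_zero.1 hinv).resolve_left (Units.ne_zero _)
          linear_combination m.star.pairing κ * this - b.repr (y (b n.star)) m * hsq m.star
        rw [h, h']; simp
      · rw [hent _ _ h, betweenSign_mul hβ]
        simp only [Units.val_mul]
        linear_combination (capWeight β deg p q x * prefixSign β (deg ∘ x) a p *
          betweenSign β (deg ∘ x) p q a * betweenSign β (deg ∘ x) p q (deg m.star)) *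
          (β (deg m) a * m.star.pairing κ * n.pairing κ * hinv -
          β (deg m) a * m.star.pairing κ * b.repr (y (b m.star)) n * hsq n -
          n.pairing κ * b.repr (y (b n.star)) m * hββ * (m.star.pairing κ * m.star.pairing κ) -
          n.pairing κ * b.repr (y (b n.star)) m * hsq m.star)
    rw [this, zero_smul]
  rw [End.mul_apply, End.mul_apply, hA, hEx, map_sum, map_sum, eq_comm, ← sub_eq_zero]
  have hUsum : ∑ m, homAct β 𝒱 k a y ((capWeight β deg p q x * cupWeight β deg p q x m) •
      tensorBasis k b (putPair x p q m)) = ∑ i, U i := by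
    simp only [hU, map_smul, hA, Finset.smul_sum]
    exact Finset.sum_comm
  rw [hUsum, ← Finset.sum_sub_distrib, Fintype.sum_eq_add p q hpq.ne hother]
  calc _ = (E (term x p) + E (term x q)) - (U p + U q) := by abel
    _ = 0 := by rw [hcap, hcupU, sub_zero]

theorem homAct_contract (hβ : IsSymmetricBicharacter β) (hform : IsColorSkewForm β 𝒱 form)
    (hb : IsSpoBasis β 𝒱 form b deg) {a : G} {y : End κ V} (hy : y ∈ spoHom β 𝒱 form a)
    (c : ContractionData k) (w : ⨂[κ] _ : Fin k, V) :
    homAct β 𝒱 k a y (contract β form b deg c w) =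
      contract β form b deg c (homAct β 𝒱 k a y w) := by
  unfold contract
  generalize List.finRange c.j = l
  induction l generalizing w with
  | nil => rfl
  | cons i l ih =>
    rw [List.foldl_cons, List.foldl_cons, ih]
    congr 1
    exact LinearMap.congr_fun (homAct_comm_contraction hβ hform hb hy (c.p_lt_q i)) w

theorem homAct_permAct (hβ : IsSymmetricBicharacter β) (hdeg : ∀ i, b i ∈ 𝒱 (deg i)) {a : G}
    {y : End κ V} (hy : y ∈ glHom 𝒱 a) (x : MonoidAlgebra κ (Equiv.Perm (Fin k)))
    (w : ⨂[κ] _ : Fin k, V) :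
    homAct β 𝒱 k a y (permAct β form b deg x w) =
      permAct β form b deg x (homAct β 𝒱 k a y w) := by
  simp only [permAct, LinearMap.sum_apply, LinearMap.smul_apply, map_sum, map_smul]
  refine Finset.sum_congr rfl fun σ _ => congrArg _ ?_
  exact LinearMap.congr_fun (homAct_comm_permRep hβ hdeg hy σ) w

theorem homAct_theta (hβ : IsSymmetricBicharacter β) (hform : IsColorSkewForm β 𝒱 form)
    (hb : IsSpoBasis β 𝒱 form b deg) (hr : 1 ≤ r) {a : G} {y : End κ V}
    (hy : y ∈ spoHom β 𝒱 form a) (c : ContractionData k) (T : HookTableau r s c.compl) :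
    homAct β 𝒱 k a y (theta hr β form b deg c T) =
      permAct β form b deg (T.1.symmetrizer κ) (contract β form b deg c
        (homAct β 𝒱 k a y (tensorBasis k b (simpleLabel e hr c T)))) := by
  rw [theta, homAct_permAct hβ hb.homogeneous hy.1, homAct_contract hβ hform hb hy,
    Basis.piTensorProduct_apply]

end Commute

/-! ### Which basis tensors occur in a contracted tensor -/

section ContractSupport

variable {κ G V : Type*} [Field κ] [CommGroup G] [Fintype G] [DecidableEq G]
  [AddCommGroup V] [Module κ V] {𝒱 : G → Submodule κ V}
  {form : LinearMap.BilinForm κ V} {β : G → G → κˣ} {r s e : ℕ}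
  {b : Basis (Idx r s e) κ V} {deg : Idx r s e → G} {k : ℕ}

/-- The composite of the contractions with indices in a list. -/
def contractList (β : G → G → κˣ) (form : LinearMap.BilinForm κ V)
    (b : Basis (Idx r s e) κ V) (deg : Idx r s e → G) (c : ContractionData k) :
    List (Fin c.j) → End κ (⨂[κ] _ : Fin k, V)
  | [] => 1
  | a :: l => contractList β form b deg c l *
      brauerAct β form b deg (BrauerDiagram.contraction (c.p a) (c.q a) (c.p_lt_q a).ne)

theorem contract_eq (c : ContractionData k) (w : ⨂[κ] _ : Fin k, V) :
    contract β form b deg c w = contractList β form b deg c (List.finRange c.j) w := by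
  unfold contract
  generalize List.finRange c.j = l
  induction l generalizing w with
  | nil => rfl
  | cons a l ih => rw [List.foldl_cons, ih]; rfl

theorem Idx.pairing_ne_zero (i : Idx r s e) : i.pairing κ ≠ 0 := fun h => by
  simpa [h] using i.pairing_mul_self κ

/-- There is no cancellation: at each contraction a labeling `z` can arise only from the cup label
`m = z (c.p a)`, since the remaining pairs leave that position alone. Only nonvanishing is recorded;
the value is never needed. -/
theorem repr_contractList_ne_zero (hβ : IsSymmetricBicharacter β)
    (hb : IsSpoBasis β 𝒱 form b deg) (c : ContractionData k) {l : List (Fin c.j)} (hl : l.Nodup)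
    (x z : Fin k → Idx r s e) :
    (tensorBasis k b).repr (contractList β form b deg c l (tensorBasis k b x)) z ≠ 0 ↔
      (∀ a ∈ l, x (c.q a) = (x (c.p a)).star) ∧
      (∀ i, (∀ a ∈ l, c.p a ≠ i ∧ c.q a ≠ i) → z i = x i) ∧
      ∀ a ∈ l, z (c.q a) = (z (c.p a)).star := by
  induction l generalizing x with
  | nil =>
    simp only [contractList, End.one_apply, Basis.repr_self, List.not_mem_nil, false_imp_iff,
      implies_true, true_and, and_true, forall_true_left]
    rw [Finsupp.single_apply_ne_zero]
    constructor
    · rintro ⟨rfl, -⟩ i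
      rfl
    · intro h
      exact ⟨funext h, one_ne_zero⟩
  | cons a l ih =>
    have hpq := c.p_lt_q a
    obtain ⟨hal, hl⟩ := List.nodup_cons.1 hl
    have hpp : ∀ a' ∈ l, c.p a' ≠ c.p a := fun a' ha' h =>
      hal (c.p_strictMono.injective h ▸ ha')
    have hqq : ∀ a' ∈ l, c.q a' ≠ c.q a := fun a' ha' h => hal (c.q_injective h ▸ ha')
    have hA : ∀ m, (∀ a' ∈ l, putPair x (c.p a) (c.q a) m (c.q a') =
        (putPair x (c.p a) (c.q a) m (c.p a')).star) ↔
        ∀ a' ∈ l, x (c.q a') = (x (c.p a')).star := fun m => by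
      refine forall_congr' fun a' => forall_congr' fun ha' => ?_
      rw [putPair_of_ne _ (c.p_ne_q a a').symm (hqq a' ha'),
        putPair_of_ne _ (hpp a' ha') (c.p_ne_q a' a)]
    rw [contractList, End.mul_apply, brauerAct_contraction hβ hb hpq, map_sum, map_sum,
      Finsupp.finsetSum_apply, Finset.sum_eq_single (z (c.p a))]
    · rw [map_smul, map_smul, Finsupp.smul_apply, smul_eq_mul, mul_ne_zero_iff, ih hl, hA]
      have hcup : cupWeight β deg (c.p a) (c.q a) x (z (c.p a)) ≠ 0 :=
        mul_ne_zero (Idx.pairing_ne_zero _) (Units.ne_zero _)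
      have hcap : capWeight β deg (c.p a) (c.q a) x ≠ 0 ↔ x (c.q a) = (x (c.p a)).star := by
        unfold capWeight
        split_ifs with h
        · simp [h, Idx.pairing_ne_zero]
        · simp [h]
      rw [mul_ne_zero_iff, hcap, and_iff_left hcup, List.forall_mem_cons, List.forall_mem_cons,
        and_assoc]
      refine and_congr_right fun _ => and_congr_right fun _ => ?_
      constructor
      · rintro ⟨h₁, h₂⟩
        refine ⟨fun i hi => ?_, ?_, h₂⟩
        · rw [h₁ i fun a' ha' => hi a' (List.mem_cons_of_mem _ ha')]
          have := hi a List.mem_cons_self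
          exact putPair_of_ne _ this.1.symm this.2.symm _
        · rw [h₁ (c.q a) fun a' ha' => ⟨c.p_ne_q a' a, hqq a' ha'⟩, putPair_right]
      · rintro ⟨h₁, h₂, h₃⟩
        refine ⟨fun i hi => ?_, h₃⟩
        by_cases hip : i = c.p a
        · rw [hip, putPair_left _ hpq.ne]
        by_cases hiq : i = c.q a
        · rw [hiq, putPair_right, h₂]
        · rw [putPair_of_ne _ hip hiq]
          exact h₁ i (List.forall_mem_cons.2 ⟨⟨Ne.symm hip, Ne.symm hiq⟩, hi⟩)
    · intro m _ hm
      rw [map_smul, map_smul, Finsupp.smul_apply, smul_eq_mul]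
      refine mul_eq_zero_of_right _ ?_
      by_contra h
      have := ((ih hl _).1 h).2.1 (c.p a) fun a' ha' => ⟨hpp a' ha', (c.p_ne_q a a').symm⟩
      rw [putPair_left _ hpq.ne] at this
      exact hm this.symm
    · simp

theorem _root_.Spo.ContractionData.mem_compl {c : ContractionData k} {i : Fin k} :
    i ∈ c.compl ↔ ∀ a, c.p a ≠ i ∧ c.q a ≠ i := by simp [ContractionData.compl]

theorem repr_contract_ne_zero (hβ : IsSymmetricBicharacter β)
    (hb : IsSpoBasis β 𝒱 form b deg) (c : ContractionData k) (x z : Fin k → Idx r s e) :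
    (tensorBasis k b).repr (contract β form b deg c (tensorBasis k b x)) z ≠ 0 ↔
      (∀ a, x (c.q a) = (x (c.p a)).star) ∧ (∀ i ∈ c.compl, z i = x i) ∧
      ∀ a, z (c.q a) = (z (c.p a)).star := by
  rw [contract_eq, repr_contractList_ne_zero hβ hb c (List.nodup_finRange _)]
  simp [ContractionData.mem_compl]

end ContractSupport

/-! ### Labelings killed by the symmetrizer -/

section Killing

variable {κ G V : Type*} [Field κ] [CharZero κ] [CommGroup G] [Fintype G] [DecidableEq G]
  [AddCommGroup V] [Module κ V] {𝒱 : G → Submodule κ V}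
  {form : LinearMap.BilinForm κ V} {β : G → G → κˣ} {r s e : ℕ}
  {b : Basis (Idx r s e) κ V} {deg : Idx r s e → G} {k : ℕ}

/-- Absorbing `g` into the sum multiplies the result by `χ g`, while applying `g` to `v` multiplies
it by `ε`; two different scalars force zero. -/
theorem lift_charSum_eq_zero {Γ M : Type*} [Group Γ] [AddCommGroup M] [Module κ M]
    (ρ : Γ →* End κ M) {H : Finset Γ} {S : Subgroup Γ} (hH : ∀ x, x ∈ H ↔ x ∈ S)
    (χ : Γ →* ℤˣ) {g : Γ} (hg : g ∈ H) {v : M} {ε : κ} (hv : ρ g v = ε • v)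
    (hε : (((χ g : ℤˣ) : ℤ) : κ) ≠ ε) :
    MonoidAlgebra.lift κ _ _ ρ (charSum κ H χ) v = 0 := by
  have h := LinearMap.congr_fun (congrArg (MonoidAlgebra.lift κ _ _ ρ)
    (charSum_mul_single (K := κ) χ hH hg)) v
  rw [map_mul, End.mul_apply, MonoidAlgebra.lift_single, one_smul, hv, map_smul, map_smul,
    LinearMap.smul_apply, ← sub_eq_zero, ← sub_smul] at h
  exact (smul_eq_zero.1 h).resolve_left (sub_ne_zero.2 hε.symm)

/-- Equal factors `t_i` are exchanged with sign `-1` and equal factors `u_j` with sign `+1`. This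
matches the signs of `s_T`: equal `t_i` are tolerated in rows but not in columns, equal `u_j` in
columns but not in rows. -/
theorem permRep_swap (hβ : IsSymmetricBicharacter β) (hb : IsSpoBasis β 𝒱 form b deg)
    {z : Fin k → Idx r s e} {x y : Fin k} (hxy : x ≠ y) (h : z x = z y) :
    permRep hβ form b deg k (Equiv.swap x y) (tensorBasis k b z) =
      (-(z x).parity κ) • tensorBasis k b z := by
  rw [permRep_apply, braidSign_swap hβ _ hxy (by simp [h]), Units.val_neg, Function.comp_apply,
    hb.parity, Equiv.symm_swap]
  congr 2
  funext i
  simp only [Function.comp_apply, Equiv.swap_apply_def]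
  split_ifs with h₁ h₂
  · rw [h₁, h]
  · rw [h₂, h]
  · rfl

variable {L : Finset (Fin k)}

theorem StandardTableau.swap_mem_colGroup (T : StandardTableau L) {x y : Fin k} (hx : x ∈ L)
    (hy : y ∈ L) (h : T.col x = T.col y) : Equiv.swap x y ∈ T.colGroup := by
  rw [T.mem_colGroup]
  refine ⟨fun i hi => Equiv.swap_apply_of_ne_of_ne (fun h => hi (h ▸ hx)) fun h => hi (h ▸ hy),
    fun i => ?_⟩
  rw [Equiv.swap_apply_def]
  split_ifs with h₁ h₂
  · rw [h₁, h]
  · rw [h₂, h]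
  · rfl

theorem StandardTableau.swap_mem_rowGroup (T : StandardTableau L) {x y : Fin k} (hx : x ∈ L)
    (hy : y ∈ L) (h : T.row x = T.row y) : Equiv.swap x y ∈ T.rowGroup := by
  rw [T.mem_rowGroup]
  refine ⟨fun i hi => Equiv.swap_apply_of_ne_of_ne (fun h => hi (h ▸ hx)) fun h => hi (h ▸ hy),
    fun i => ?_⟩
  rw [Equiv.swap_apply_def]
  split_ifs with h₁ h₂
  · rw [h₁, h]
  · rw [h₂, h]
  · rfl

theorem lift_colSum_eq_zero (hβ : IsSymmetricBicharacter β) (hb : IsSpoBasis β 𝒱 form b deg)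
    (T : StandardTableau L) {z : Fin k → Idx r s e} {x y : Fin k} (hx : x ∈ L) (hy : y ∈ L)
    (hxy : x ≠ y) (hcol : T.col x = T.col y) (hz : z x = z y) (hpar : (z x).parity κ = 1) :
    MonoidAlgebra.lift κ _ _ (permRep hβ form b deg k) (T.colSum κ) (tensorBasis k b z) = 0 := by
  refine lift_charSum_eq_zero _ T.mem_colGroup_iff _ (T.swap_mem_colGroup hx hy hcol)
    (permRep_swap hβ hb hxy hz) ?_
  rw [hpar]
  norm_num

theorem lift_rowSum_eq_zero (hβ : IsSymmetricBicharacter β) (hb : IsSpoBasis β 𝒱 form b deg)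
    (T : StandardTableau L) {z : Fin k → Idx r s e} {x y : Fin k} (hx : x ∈ L) (hy : y ∈ L)
    (hxy : x ≠ y) (hrow : T.row x = T.row y) (hz : z x = z y) (hpar : (z x).parity κ = -1) :
    MonoidAlgebra.lift κ _ _ (permRep hβ form b deg k) (T.rowSum κ) (tensorBasis k b z) = 0 := by
  refine lift_charSum_eq_zero _ T.mem_rowGroup_iff _ (T.swap_mem_rowGroup hx hy hrow)
    (permRep_swap hβ hb hxy hz) ?_
  rw [hpar, Equiv.Perm.sign_swap hxy]
  norm_num

theorem permAct_symmetrizer (hβ : IsSymmetricBicharacter β) (T : StandardTableau L)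
    (v : ⨂[κ] _ : Fin k, V) :
    permAct β form b deg (T.symmetrizer κ) v = (T.hookNumber κ)⁻¹ •
      MonoidAlgebra.lift κ _ _ (permRep hβ form b deg k) (T.colSum κ)
        (MonoidAlgebra.lift κ _ _ (permRep hβ form b deg k) (T.rowSum κ) v) := by
  rw [permAct_eq_lift hβ, StandardTableau.symmetrizer, map_smul, T.youngElement_eq, map_mul]
  rfl

theorem lift_charSum_apply {Γ M : Type*} [Group Γ] [AddCommGroup M] [Module κ M]
    (ρ : Γ →* End κ M) (H : Finset Γ) (χ : Γ →* ℤˣ) (v : M) :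
    MonoidAlgebra.lift κ _ _ ρ (charSum κ H χ) v = ∑ h ∈ H, (((χ h : ℤˣ) : ℤ) : κ) • ρ h v := by
  simp [charSum, map_sum, MonoidAlgebra.lift_single]

/-- A labeling with too many letters `t_1, …, t_n` repeats one of them in some column. -/
theorem StandardTableau.exists_repeated_letter (T : StandardTableau L) (z : Fin k → Idx r s e)
    (n : ℕ)
    (h : (L.filter fun x => (T.row x).getD 0 < n).card <
      (L.filter fun x => ∃ i : Fin r, i.1 < n ∧ z x = .t i).card) :
    ∃ x ∈ L, ∃ y ∈ L, x ≠ y ∧ T.col x = T.col y ∧ z x = z y ∧ ∃ i, z x = .t i := by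
  by_contra! hno
  refine h.not_ge ?_
  have hmaps : ∀ P : Fin k → Prop, ∀ [DecidablePred P],
      ∀ x ∈ L.filter P, T.col x ∈ L.image T.col := fun P _ x hx =>
    Finset.mem_image_of_mem _ (Finset.mem_filter.1 hx).1
  rw [Finset.card_eq_sum_card_fiberwise (hmaps _), Finset.card_eq_sum_card_fiberwise (hmaps _)]
  refine Finset.sum_le_sum fun c _ => ?_
  -- Count column by column. A column extending below the first `n` rows has `n` boxes in them and
  -- room for at most `n` distinct letters; any other column lies entirely within the first `n`
  -- rows.
  by_cases hlow : ∃ x₀ ∈ L, T.col x₀ = c ∧ n ≤ (T.row x₀).getD 0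
  · obtain ⟨x₀, hx₀, rfl, hn⟩ := hlow
    rw [T.row_of_mem hx₀, Option.getD_some] at hn
    refine le_trans (b := n) ?_ ?_
    · conv_rhs => rw [← Finset.card_range n]
      -- Only letters `t_i` occur in this set, so the default value 0 is never used.
      refine Finset.card_le_card_of_injOn
        (fun x => match z x with | .t i => i.1 | _ => 0) ?_ ?_
      · intro x hx
        simp only [Finset.coe_filter, Finset.mem_filter, Set.mem_ofPred_eq] at hx
        obtain ⟨⟨-, i, hi, hz⟩, -⟩ := hx
        simpa [hz] using hi
      · intro x hx y hy hxy
        simp only [Finset.coe_filter, Finset.mem_filter, Set.mem_ofPred_eq] at hx hy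
        obtain ⟨⟨hxL, i, hi, hzx⟩, hcx⟩ := hx
        obtain ⟨⟨hyL, j, hj, hzy⟩, hcy⟩ := hy
        simp only [hzx, hzy] at hxy
        by_contra hne
        exact hno x hxL y hyL hne (hcx.trans hcy.symm)
          (by rw [hzx, hzy, Fin.ext hxy]) i hzx
    · conv_lhs => rw [← Finset.card_range n]
      refine le_trans (Finset.card_le_card (t := Finset.image (fun x => (T.row x).getD 0) _) ?_)
        Finset.card_image_le
      intro j hj
      rw [Finset.mem_range] at hj
      have hmem : (j, (T.box ⟨x₀, hx₀⟩).1.2) ∈ T.shape :=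
        T.shape.up_left_mem (hj.le.trans hn) le_rfl (T.box ⟨x₀, hx₀⟩).2
      set x := T.box.symm ⟨_, hmem⟩ with hxdef
      have hx : (T.box x).1 = (j, (T.box ⟨x₀, hx₀⟩).1.2) := by rw [hxdef]; simp
      refine Finset.mem_image.2 ⟨x, ?_, ?_⟩
      · simp only [Finset.mem_filter]
        refine ⟨⟨x.2, ?_⟩, ?_⟩
        · rw [T.row_of_mem x.2, Option.getD_some, Subtype.coe_eta, hx]
          exact hj
        · rw [T.col_of_mem x.2, T.col_of_mem hx₀, Subtype.coe_eta, hx]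
      · rw [T.row_of_mem x.2, Option.getD_some, Subtype.coe_eta, hx]
  · refine Finset.card_le_card fun x hx => ?_
    simp only [Finset.mem_filter] at hx ⊢
    refine ⟨⟨hx.1.1, ?_⟩, hx.2⟩
    by_contra hn
    exact hlow ⟨x, hx.1.1, hx.2, not_lt.1 hn⟩

theorem permAct_symmetrizer_eq_zero_of_repeated_row (hβ : IsSymmetricBicharacter β)
    (hb : IsSpoBasis β 𝒱 form b deg) (T : StandardTableau L) {z : Fin k → Idx r s e} {x y : Fin k}
    (hx : x ∈ L) (hy : y ∈ L) (hxy : x ≠ y) (hrow : T.row x = T.row y) (hz : z x = z y)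
    (hpar : (z x).parity κ = -1) :
    permAct β form b deg (T.symmetrizer κ) (tensorBasis k b z) = 0 := by
  rw [permAct_symmetrizer hβ, lift_rowSum_eq_zero hβ hb T hx hy hxy hrow hz hpar, map_zero,
    smul_zero]

/-- Row permutations move letters only within `L` and keep the count, so the pigeonhole applies to
every term of the row sum and the column sum kills each of them. -/
theorem permAct_symmetrizer_eq_zero_of_card_lt (hβ : IsSymmetricBicharacter β)
    (hb : IsSpoBasis β 𝒱 form b deg) (T : StandardTableau L) {z : Fin k → Idx r s e} {n : ℕ}
    (h : (L.filter fun x => (T.row x).getD 0 < n).card <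
      (L.filter fun x => ∃ i : Fin r, i.1 < n ∧ z x = .t i).card) :
    permAct β form b deg (T.symmetrizer κ) (tensorBasis k b z) = 0 := by
  rw [permAct_symmetrizer hβ, lift_charSum_apply (H := T.rowGroup), map_sum, Finset.sum_eq_zero,
    smul_zero]
  intro ψ hψ
  rw [permRep_apply, map_smul, map_smul]
  have hψ' := (T.mem_rowGroup.1 hψ).1
  have hL : ∀ x, ψ x ∈ L ↔ x ∈ L := by
    intro x
    by_cases hx : x ∈ L
    · refine iff_of_true ?_ hx
      by_contra h'
      rw [ψ.injective (hψ' _ h')] at h'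
      exact h' hx
    · rw [hψ' x hx]
  have hcard : (L.filter fun x => ∃ i : Fin r, i.1 < n ∧ (z ∘ ψ.symm) x = .t i).card =
      (L.filter fun x => ∃ i : Fin r, i.1 < n ∧ z x = .t i).card := by
    symm
    refine Finset.card_nbij' ψ ψ.symm ?_ ?_ (fun x _ => ψ.symm_apply_apply x)
      fun x _ => ψ.apply_symm_apply x
    · intro x hx
      simpa [hL] using hx
    · intro x hx
      simpa [← hL (ψ.symm x)] using hx
  obtain ⟨x, hx, y, hy, hxy, hcol, hz, i, hi⟩ :=
    T.exists_repeated_letter (z ∘ ψ.symm) n (by rw [hcard]; exact h)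
  rw [lift_colSum_eq_zero hβ hb T hx hy hxy hcol hz (by rw [hi]; rfl), smul_zero, smul_zero]

end Killing

/-! ### Positive roots raise heights; the vectors are maximal -/

/-- The heights of the weights of the basis elements. -/
def Idx.height {r s e : ℕ} : Idx r s e → ℤ
  | .t i => r + s - i
  | .tStar i => -(r + s - i)
  | .u j => s - j
  | .uStar j => -(s - j)
  | .mid _ => 0

theorem Idx.height_star {r s e : ℕ} (i : Idx r s e) : i.star.height = -i.height := by
  cases i <;> simp [height, star]

section Roots

variable {κ G V : Type*} [Field κ] [CharZero κ] [CommGroup G] [Fintype G] [DecidableEq G]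
  [AddCommGroup V] [Module κ V] {𝒱 : G → Submodule κ V} [DirectSum.Decomposition 𝒱]
  {form : LinearMap.BilinForm κ V} {β : G → G → κˣ} {r s e : ℕ}
  {b : Basis (Idx r s e) κ V} {deg : Idx r s e → G} {k : ℕ}

/-- The diagonal operator whose eigenvalues are the heights. -/
def heightOp (b : Basis (Idx r s e) κ V) : End κ V :=
  b.constr κ fun i => (i.height : κ) • b i

theorem heightOp_basis (i : Idx r s e) : heightOp b (b i) = (i.height : κ) • b i :=
  b.constr_basis κ _ i

theorem repr_heightOp (v : V) (i : Idx r s e) :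
    b.repr (heightOp b v) i = (i.height : κ) * b.repr v i := by
  have h : b.coord i ∘ₗ heightOp b = (i.height : κ) • b.coord i := by
    refine b.ext fun j => ?_
    rw [LinearMap.comp_apply, heightOp_basis]
    by_cases hij : j = i
    · subst hij; simp
    · simp [Finsupp.single_eq_of_ne' hij]
  simpa using LinearMap.congr_fun h v

theorem heightOp_mem_cartan (hβ : IsSymmetricBicharacter β) (hb : IsSpoBasis β 𝒱 form b deg) :
    heightOp b ∈ cartan β 𝒱 form b := by
  refine ⟨?_, fun i j hij => ?_⟩
  · refine Submodule.mem_iSup_of_mem (1 : G) ⟨fun c v hv => ?_, fun c u hu v => ?_⟩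
    · rw [one_mul, ← b.sum_repr v, map_sum]
      refine Submodule.sum_mem _ fun i _ => ?_
      rw [map_smul, heightOp_basis]
      by_cases hi : deg i = c
      · exact Submodule.smul_mem _ _ (Submodule.smul_mem _ _ (hi ▸ hb.homogeneous i))
      · rw [repr_eq_zero_of_mem hb.homogeneous hv hi, zero_smul]
        exact Submodule.zero_mem _
    · rw [hβ.one_right, Units.val_one, one_mul]
      have h : form ∘ₗ heightOp b + form.compl₂ (heightOp b) = 0 := by
        refine b.ext fun i => b.ext fun j => ?_
        simp only [LinearMap.add_apply, LinearMap.comp_apply, LinearMap.compl₂_apply,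
          heightOp_basis, map_smul, LinearMap.smul_apply, hb.form_eq, LinearMap.zero_apply,
          smul_eq_mul]
        by_cases hj : j = i.star
        · rw [if_pos hj, hj, Idx.height_star]
          push_cast
          ring
        · simp [hj]
      exact LinearMap.congr_fun (LinearMap.congr_fun h u) v
  · rw [heightOp_basis, map_smul, Finsupp.smul_apply, b.repr_self,
      Finsupp.single_eq_of_ne hij, smul_zero]

/-- An endomorphism is raising if its matrix entries only increase heights. -/
def IsRaising (b : Basis (Idx r s e) κ V) (x : End κ V) : Prop :=
  ∀ i j, i.height ≤ j.height → b.repr (x (b j)) i = 0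

theorem homPart_of_diagonal (hb : IsSpoBasis β 𝒱 form b deg)
    {h : End κ V} (hh : h ∈ cartan β 𝒱 form b) (a : G) :
    homPart 𝒱 a h = if a = 1 then h else 0 := by
  refine b.ext fun j => b.ext_elem fun i => ?_
  rw [repr_homPart hb.homogeneous]
  by_cases ha : a = 1
  · rw [if_pos ha, ha, one_mul]
    by_cases hij : i = j
    · rw [hij, if_pos rfl]
    · rw [hh.2 i j hij, ite_self]
  · rw [if_neg ha]
    by_cases hij : i = j
    · rw [hij, if_neg (by simpa using ha)]; simp
    · rw [hh.2 i j hij, ite_self]; simp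

/-- Diagonal operators have degree 1, where the commutation factor is trivial. -/
theorem colorBracket_cartan (hβ : IsSymmetricBicharacter β) (hb : IsSpoBasis β 𝒱 form b deg)
    {h : End κ V} (hh : h ∈ cartan β 𝒱 form b) (x : End κ V) :
    colorBracket β 𝒱 h x = h * x - x * h := by
  unfold colorBracket
  rw [Finset.sum_eq_single 1]
  · simp only [homPart_of_diagonal hb hh, if_true, hβ.one_right, Units.val_one, one_smul]
    rw [Finset.sum_sub_distrib, ← Finset.mul_sum, ← Finset.sum_mul, sum_homPart hb.homogeneous]
  · intro a _ ha
    simp [homPart_of_diagonal hb hh, ha]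
  · simp

theorem chain_heightOp (hβ : IsSymmetricBicharacter β) (hb : IsSpoBasis β 𝒱 form b deg) {i : ℕ}
    (hi : i < r + s) :
    chain β 𝒱 form b i ⟨heightOp b, heightOp_mem_cartan hβ hb⟩ = ((r + s - i : ℤ) : κ) := by
  have heps : ∀ v, eps β 𝒱 form b v ⟨heightOp b, heightOp_mem_cartan hβ hb⟩ = (v.height : κ) := by
    intro v
    change b.repr (heightOp b (b v)) v = _
    rw [repr_heightOp]; simp
  unfold chain
  split_ifs with h₁ h₂
  · rw [heps]; simp [Idx.height]
  · rw [heps]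
    congr 1
    simp only [Idx.height]
    omega
  · omega

/-- Along `ω_1, …, ω_{r+s}` the heights descend by one and end at 1. The differences therefore take
the value 1, and the last simple root takes 1, 2 or 3 in its three forms. -/
theorem simpleRoot_heightOp (hβ : IsSymmetricBicharacter β) (hb : IsSpoBasis β 𝒱 form b deg)
    (hr : 1 ≤ r) (i : Fin (r + s)) :
    ∃ n : ℕ, 0 < n ∧
      simpleRoot β 𝒱 form b i ⟨heightOp b, heightOp_mem_cartan hβ hb⟩ = (n : κ) := by
  have hi := i.2
  unfold simpleRoot
  simp only
  split_ifs with h₁ h₂ h₃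
  · refine ⟨1, one_pos, ?_⟩
    rw [LinearMap.sub_apply, chain_heightOp hβ hb hi, chain_heightOp hβ hb h₁]
    push_cast
    ring
  · refine ⟨r + s - i, by omega, ?_⟩
    rw [chain_heightOp hβ hb hi, Nat.cast_sub hi.le]
    push_cast
    ring
  · refine ⟨2 * (r + s - i), by omega, ?_⟩
    rw [LinearMap.smul_apply, chain_heightOp hβ hb hi, Nat.cast_mul, Nat.cast_sub hi.le]
    push_cast
    ring
  · have h₄ : i.1 - 1 < r + s := by omega
    -- In this case `s ≥ 1`; with `r ≥ 1` the last index is positive, so the truncated `i - 1` is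
    -- its true predecessor.
    have h₅ : 1 ≤ i.1 := by omega
    refine ⟨(r + s - i) + (r + s - (i - 1)), by omega, ?_⟩
    rw [LinearMap.add_apply, chain_heightOp hβ hb hi, chain_heightOp hβ hb h₄,
      Nat.cast_add, Nat.cast_sub hi.le, Nat.cast_sub h₄.le]
    push_cast
    ring

theorem IsPositiveRoot.exists_natCast (hβ : IsSymmetricBicharacter β)
    (hb : IsSpoBasis β 𝒱 form b deg) (hr : 1 ≤ r) {α : Dual κ (cartan β 𝒱 form b)}
    (hα : IsPositiveRoot β 𝒱 form b α) :
    ∃ n : ℕ, 0 < n ∧ α ⟨heightOp b, heightOp_mem_cartan hβ hb⟩ = (n : κ) := by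
  obtain ⟨hne, -, c, rfl⟩ := hα
  choose n hn hroot using simpleRoot_heightOp (e := e) hβ hb hr
  refine ⟨∑ i, c i * n i, ?_, ?_⟩
  · rw [Finset.sum_pos_iff]
    by_contra! h
    refine hne (Finset.sum_eq_zero fun i hi => ?_)
    have : c i = 0 := by
      have := h i hi
      have h' := hn i
      by_contra h''
      exact absurd (Nat.mul_pos (Nat.pos_of_ne_zero h'') h') (by omega)
    rw [this, zero_smul]
  · rw [LinearMap.sum_apply]
    push_cast
    refine Finset.sum_congr rfl fun i _ => ?_
    rw [LinearMap.smul_apply, hroot, nsmul_eq_mul]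

/-- On a positive root space bracketing with the height operator is multiplication by some `n > 0`,
so an entry at `(i, j)` can be nonzero only if the heights differ by exactly `n`; characteristic
zero is used here. -/
theorem isRaising_of_mem_posPart (hβ : IsSymmetricBicharacter β)
    (hb : IsSpoBasis β 𝒱 form b deg) (hr : 1 ≤ r) {x : End κ V} (hx : x ∈ posPart β 𝒱 form b) :
    x ∈ spo β 𝒱 form ∧ IsRaising b x := by
  unfold posPart at hx
  induction hx using Submodule.span_induction with
  | mem x hx =>
    obtain ⟨α, hα, hx⟩ := hx
    refine ⟨hx.1, fun i j hij => ?_⟩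
    obtain ⟨n, hn, hαn⟩ := hα.exists_natCast hβ hb hr
    have h := hx.2 ⟨heightOp b, heightOp_mem_cartan hβ hb⟩
    rw [colorBracket_cartan hβ hb (heightOp_mem_cartan hβ hb), hαn] at h
    have h' := DFunLike.congr_fun (congrArg b.repr (LinearMap.congr_fun h (b j))) i
    simp only [LinearMap.sub_apply, End.mul_apply, heightOp_basis, map_smul, map_sub,
      Finsupp.sub_apply, repr_heightOp, Finsupp.smul_apply, LinearMap.smul_apply,
      smul_eq_mul] at h'
    have h₀ : ((i.height - j.height - n : ℤ) : κ) * b.repr (x (b j)) i = 0 := by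
      push_cast
      linear_combination h'
    exact (mul_eq_zero.1 h₀).resolve_left (Int.cast_ne_zero.2 (by omega))
  | zero => exact ⟨Submodule.zero_mem _, fun i j _ => by simp⟩
  | add x y _ _ hx hy =>
    exact ⟨Submodule.add_mem _ hx.1 hy.1, fun i j hij => by simp [hx.2 i j hij, hy.2 i j hij]⟩
  | smul c x _ hx =>
    exact ⟨Submodule.smul_mem _ c hx.1, fun i j hij => by simp [hx.2 i j hij]⟩

variable {L : Finset (Fin k)}

theorem HookTableau.letter_of_lt (T : HookTableau r s L) {x : {i // i ∈ L}}
    (h : (T.1.box x).1.1 < r) : T.letter e x = .t ⟨(T.1.box x).1.1, h⟩ := dif_pos h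

theorem HookTableau.exists_letter_of_ge (T : HookTableau r s L) {x : {i // i ∈ L}}
    (h : r ≤ (T.1.box x).1.1) : ∃ hs : (T.1.box x).1.2 < s,
      T.letter e x = .u ⟨(T.1.box x).1.2, hs⟩ :=
  ⟨_, dif_neg (not_lt.2 h)⟩

theorem permAct_symmetrizer_eq_zero_of_raised (hβ : IsSymmetricBicharacter β)
    (hb : IsSpoBasis β 𝒱 form b deg) (T : HookTableau r s L) {z : Fin k → Idx r s e}
    (i : {i // i ∈ L}) (hz : ∀ x : {i // i ∈ L}, x ≠ i → z x = T.letter e x)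
    (hi : (T.letter e i).height < (z i).height) :
    permAct β form b deg (T.1.symmetrizer κ) (tensorBasis k b z) = 0 := by
  -- The first `n` rows are already filled with letters among `t_1, …, t_n`; the entry `i` lies
  -- below them and supplies one more.
  have many : ∀ n : ℕ, n ≤ r → n ≤ (T.1.box i).1.1 → (∃ j : Fin r, j.1 < n ∧ z i = .t j) →
      permAct β form b deg (T.1.symmetrizer κ) (tensorBasis k b z) = 0 := by
    intro n hnr hn hzi
    refine permAct_symmetrizer_eq_zero_of_card_lt hβ hb T.1 (n := n)
      (Finset.card_lt_card ⟨?_, ?_⟩)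
    · intro x hx
      rw [Finset.mem_filter] at hx ⊢
      obtain ⟨hxL, hxn⟩ := hx
      rw [T.1.row_of_mem hxL, Option.getD_some] at hxn
      refine ⟨hxL, ⟨_, hxn.trans_le hnr⟩, hxn, ?_⟩
      have hne : (⟨x, hxL⟩ : {i // i ∈ L}) ≠ i := fun h => by
        rw [← h] at hn
        omega
      rw [← T.letter_of_lt]
      exact hz ⟨x, hxL⟩ hne
    · intro hsub
      have := hsub (Finset.mem_filter.2 ⟨i.2, hzi⟩)
      rw [Finset.mem_filter, T.1.row_of_mem i.2, Option.getD_some, Subtype.coe_eta] at this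
      omega
  have hrs : ∀ j : Fin r, (0 : ℤ) < r + s - j := fun j => by omega
  rcases lt_or_ge (T.1.box i).1.1 r with hlt | hge
  · rw [T.letter_of_lt hlt] at hi
    rcases hzi : z i with j | j | j | j | j
    · rw [hzi] at hi
      simp only [Idx.height] at hi
      exact many (j + 1) (by omega) (by omega) ⟨j, by omega, hzi⟩
    all_goals
      rw [hzi] at hi
      simp only [Idx.height] at hi
      omega
  · obtain ⟨hs, hl⟩ := T.exists_letter_of_ge (e := e) hge
    rw [hl] at hi
    rcases hzi : z i with j | j | j | j | j
    · exact many r le_rfl hge ⟨j, j.2, hzi⟩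
    · rw [hzi] at hi
      simp only [Idx.height] at hi
      omega
    · rw [hzi] at hi
      simp only [Idx.height] at hi
      have hj : j.1 < (T.1.box i).1.2 := by omega
      -- The box in column `j` of the row of `i` already holds `u_j`, so the raised letter repeats
      -- it in that row.
      have hmem : ((T.1.box i).1.1, j.1) ∈ T.1.shape :=
        T.1.shape.up_left_mem le_rfl hj.le (T.1.box i).2
      obtain ⟨x, hx⟩ : ∃ x, (T.1.box x).1 = ((T.1.box i).1.1, j.1) :=
        ⟨T.1.box.symm ⟨_, hmem⟩, by simp⟩
      have hne : x ≠ i := fun h => by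
        rw [h] at hx
        exact hj.ne' (congrArg Prod.snd hx)
      have hzx : z x = .u j := by
        have hx' : r ≤ (T.1.box x).1.1 := by rw [hx]; exact hge
        obtain ⟨_, h⟩ := T.exists_letter_of_ge (e := e) hx'
        rw [hz x hne, h]
        congr 1
        exact Fin.ext (congrArg Prod.snd hx)
      refine permAct_symmetrizer_eq_zero_of_repeated_row hβ hb T.1 x.2 i.2
        (fun h => hne (Subtype.ext h)) ?_ (hzx.trans hzi.symm) (by rw [hzx]; rfl)
      rw [T.1.row_of_mem x.2, T.1.row_of_mem i.2, Subtype.coe_eta, Subtype.coe_eta, hx]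
    all_goals
      rw [hzi] at hi
      simp only [Idx.height] at hi
      omega

theorem simpleLabel_of_mem (hr : 1 ≤ r) {c : ContractionData k} (T : HookTableau r s c.compl)
    {i : Fin k} (h : i ∈ c.compl) : simpleLabel e hr c T i = T.letter e ⟨i, h⟩ := dif_pos h

theorem simpleLabel_p (hr : 1 ≤ r) {c : ContractionData k} (T : HookTableau r s c.compl)
    (a : Fin c.j) : simpleLabel e hr c T (c.p a) = .t ⟨0, hr⟩ := by
  have h : c.p a ∉ c.compl := fun h => (ContractionData.mem_compl.1 h a).1 rfl
  simp [simpleLabel, h]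

theorem simpleLabel_q (hr : 1 ≤ r) {c : ContractionData k} (T : HookTableau r s c.compl)
    (a : Fin c.j) : simpleLabel e hr c T (c.q a) = .tStar ⟨0, hr⟩ := by
  have h : c.q a ∉ c.compl := fun h => (ContractionData.mem_compl.1 h a).2 rfl
  simp [simpleLabel, h, c.p_ne_q]

theorem Idx.height_le (hr : 1 ≤ r) (i : Idx r s e) : i.height ≤ (r + s : ℤ) := by
  cases i <;> simp only [height] <;> omega

/-- Nothing is higher than `t_1`, and a label at `q` other than `t_1^*` is annihilated by the
contraction. At an entry of `T`, every labeling in the contracted tensor still shows the raised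
letters of `T`, which the symmetrizer kills. -/
theorem permAct_contract_update_eq_zero (hβ : IsSymmetricBicharacter β)
    (hb : IsSpoBasis β 𝒱 form b deg) (hr : 1 ≤ r) (c : ContractionData k)
    (T : HookTableau r s c.compl) (i : Fin k) (m : Idx r s e)
    (hm : (simpleLabel e hr c T i).height < m.height) :
    permAct β form b deg (T.1.symmetrizer κ) (contract β form b deg c
      (tensorBasis k b (Function.update (simpleLabel e hr c T) i m))) = 0 := by
  rw [← (tensorBasis k b).sum_repr (contract β form b deg c _), map_sum]
  refine Finset.sum_eq_zero fun z _ => ?_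
  rw [map_smul]
  by_cases hz : (tensorBasis k b).repr (contract β form b deg c
      (tensorBasis k b (Function.update (simpleLabel e hr c T) i m))) z = 0
  · rw [hz, zero_smul]
  obtain ⟨h₁, h₂, -⟩ := (repr_contract_ne_zero hβ hb c _ z).1 hz
  by_cases hi : i ∈ c.compl
  · rw [permAct_symmetrizer_eq_zero_of_raised hβ hb T ⟨i, hi⟩ ?_ ?_, smul_zero]
    · intro x hx
      have hx' : x.1 ≠ i := fun h => hx (Subtype.ext h)
      rw [h₂ x x.2, Function.update_of_ne hx', simpleLabel_of_mem hr T x.2]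
    · rw [h₂ i hi, Function.update_self, ← simpleLabel_of_mem hr T hi]
      exact hm
  · exfalso
    simp only [ContractionData.mem_compl, not_forall, not_and_or, not_not] at hi
    obtain ⟨a, rfl | rfl⟩ := hi
    · rw [simpleLabel_p] at hm
      have := m.height_le hr
      have h₀ : (Idx.t ⟨0, hr⟩ : Idx r s e).height = r + s := by simp [Idx.height]
      omega
    · have := h₁ a
      rw [Function.update_self, Function.update_of_ne (c.p_ne_q a a), simpleLabel_p] at this
      rw [simpleLabel_q, this] at hm
      exact lt_irrefl _ hm

theorem homAct_theta_eq_zero (hβ : IsSymmetricBicharacter β) (hform : IsColorSkewForm β 𝒱 form)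
    (hb : IsSpoBasis β 𝒱 form b deg) (hr : 1 ≤ r) {a : G} {y : End κ V}
    (hy : y ∈ spoHom β 𝒱 form a) (hraise : IsRaising b y) (c : ContractionData k)
    (T : HookTableau r s c.compl) : homAct β 𝒱 k a y (theta hr β form b deg c T) = 0 := by
  rw [homAct_theta hβ hform hb hr hy, homAct_tensorBasis β hb.homogeneous, contract_eq]
  simp only [map_sum, map_smul]
  refine Finset.sum_eq_zero fun i _ => ?_
  rw [Finset.sum_eq_zero, smul_zero]
  intro m _
  rcases le_or_gt m.height (simpleLabel e hr c T i).height with h | h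
  · rw [hraise _ _ h, zero_smul]
  · rw [← contract_eq, permAct_contract_update_eq_zero hβ hb hr c T i m h, smul_zero]

theorem tensorAct_theta_of_mem_cartan (hβ : IsSymmetricBicharacter β)
    (hform : IsColorSkewForm β 𝒱 form) (hb : IsSpoBasis β 𝒱 form b deg) (hr : 1 ≤ r)
    (c : ContractionData k) (T : HookTableau r s c.compl) (h : cartan β 𝒱 form b) :
    tensorAct β 𝒱 k h.1 (theta hr β form b deg c T) =
      (∑ i, eps β 𝒱 form b (simpleLabel e hr c T i)) h • theta hr β form b deg c T := by
  have key : ∀ a, homAct β 𝒱 k a (homPart 𝒱 a h.1) (tensorBasis k b (simpleLabel e hr c T)) =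
      if a = 1 then (∑ i, eps β 𝒱 form b (simpleLabel e hr c T i)) h •
        tensorBasis k b (simpleLabel e hr c T) else 0 := by
    intro a
    rw [homAct_tensorBasis β hb.homogeneous, homPart_of_diagonal hb h.2]
    split_ifs with ha
    · rw [ha, LinearMap.sum_apply, Finset.sum_smul]
      refine Finset.sum_congr rfl fun i _ => ?_
      have hp : prefixSign β (deg ∘ simpleLabel e hr c T) 1 i = 1 := by
        simp [prefixSign, hβ.one_right]
      rw [hp, Units.val_one, one_smul, Finset.sum_eq_single (simpleLabel e hr c T i)]
      · rw [Function.update_eq_self]; rfl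
      · intro m _ hm
        rw [h.2.2 _ _ hm, zero_smul]
      · simp
    · simp
  have hsum : ∀ a, homAct β 𝒱 k a (homPart 𝒱 a h.1) (theta hr β form b deg c T) =
      if a = 1 then (∑ i, eps β 𝒱 form b (simpleLabel e hr c T i)) h •
        theta hr β form b deg c T else 0 := by
    intro a
    rw [homAct_theta hβ hform hb hr (homPart_mem_spoHom hb.homogeneous a h.2.1), key]
    split_ifs
    · rw [contract_eq, map_smul, map_smul, ← contract_eq, theta, Basis.piTensorProduct_apply]
    · rw [contract_eq, map_zero, map_zero]
  rw [tensorAct_eq, LinearMap.sum_apply]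
  simp only [hsum, Finset.sum_ite_eq', Finset.mem_univ, if_true]

theorem isMaximalVector_theta (hβ : IsSymmetricBicharacter β) (hform : IsColorSkewForm β 𝒱 form)
    (hb : IsSpoBasis β 𝒱 form b deg) (hr : 1 ≤ r) (c : ContractionData k)
    (T : HookTableau r s c.compl) :
    IsMaximalVector β 𝒱 form b (∑ i, eps β 𝒱 form b (simpleLabel e hr c T i))
      (theta hr β form b deg c T) := by
  refine ⟨fun x hx => ?_, tensorAct_theta_of_mem_cartan hβ hform hb hr c T⟩
  obtain ⟨hxs, hxr⟩ := isRaising_of_mem_posPart hβ hb hr hx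
  rw [tensorAct_eq, LinearMap.sum_apply]
  refine Finset.sum_eq_zero fun a _ => homAct_theta_eq_zero hβ hform hb hr
    (homPart_mem_spoHom hb.homogeneous a hxs) (fun i j hij => ?_) c T
  rw [repr_homPart hb.homogeneous, hxr i j hij, ite_self]

end Roots

/-! ### Signs on the stabilizer of a labeling -/

section Stabilizer

variable {κ G V : Type*} [Field κ] [CharZero κ] [CommGroup G]
  [AddCommGroup V] [Module κ V] {I : Type*} [Fintype I] [DecidableEq I]
  {form : LinearMap.BilinForm κ V} {β : G → G → κˣ}
  {b : Basis I κ V} {deg : I → G} {k : ℕ}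

theorem braidSign_mul_of_comp_eq (hβ : IsSymmetricBicharacter β) {g : Fin k → G}
    {σ τ : Equiv.Perm (Fin k)} (h : ∀ i, g (σ i) = g i) :
    braidSign β g (τ * σ) = braidSign β g τ * braidSign β g σ := by
  rw [braidSign_mul hβ]
  congr 2
  funext i
  rw [Function.comp_apply, ← h, Equiv.apply_symm_apply]

/-- Among permutations preserving the degrees the braid sign is multiplicative, and a transposition
of moved positions has sign `-η`. Splitting off transpositions shrinks the support. -/
theorem braidSign_eq_character (hβ : IsSymmetricBicharacter β) {g : Fin k → G} {η : κ}
    (χ : Equiv.Perm (Fin k) →* ℤˣ)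
    (hχ : ∀ x y, x ≠ y → (((χ (Equiv.swap x y) : ℤˣ) : ℤ) : κ) = -η) (σ : Equiv.Perm (Fin k))
    (hσ : ∀ i, g (σ i) = g i) (hη : ∀ i, σ i ≠ i → (β (g i) (g i) : κ) = η) :
    (braidSign β g σ : κ) = ((χ σ : ℤˣ) : ℤ) := by
  induction hn : σ.support.card using Nat.strong_induction_on generalizing σ with
  | _ n ih =>
    by_cases h1 : σ = 1
    · rw [h1, braidSign_one, map_one]; simp
    obtain ⟨x, hx⟩ : ∃ x, σ x ≠ x := by
      by_contra! h
      exact h1 (Equiv.ext h)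
    set σ' := Equiv.swap x (σ x) * σ with hσ'
    have hgσ' : ∀ i, g (σ' i) = g i := by
      intro i
      rw [hσ', Equiv.Perm.mul_apply, Equiv.swap_apply_def]
      split_ifs with h₂ h₃
      · rw [hσ, ← h₂, hσ]
      · rw [σ.injective h₃]
      · exact hσ i
    have hσσ' : σ = Equiv.swap x (σ x) * σ' := by
      rw [hσ', Equiv.swap_mul_self_mul]
    have hmoved : ∀ i, σ' i ≠ i → σ i ≠ i := by
      intro i hi hfix
      refine hi ?_
      rw [hσ', Equiv.Perm.mul_apply, hfix]
      refine Equiv.swap_apply_of_ne_of_ne (fun h => hx ?_) fun h => hx ?_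
      · rw [← h, hfix]
      · have : i = x := σ.injective (hfix.trans h)
        rw [← this, hfix]
    have key := ih _ (hn ▸ Equiv.Perm.card_support_swap_mul hx) σ' hgσ'
      (fun i hi => hη i (hmoved i hi)) rfl
    conv_lhs => rw [hσσ']
    conv_rhs => rw [hσσ']
    rw [braidSign_mul_of_comp_eq hβ hgσ', braidSign_swap hβ g (Ne.symm hx) (hσ x).symm, map_mul,
      Units.val_mul, key, Units.val_mul, Int.cast_mul, hχ _ _ (Ne.symm hx), Units.val_neg, hη x hx]

/-- If `y` annihilates a basis tensor, then so does every element of the coset sums of `y` over the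
stabilizer of the labeling, weighted by the character of the stabilizer. -/
theorem mul_stabilizer_sum_eq_zero (hβ : IsSymmetricBicharacter β) (z : Fin k → I)
    {y : MonoidAlgebra κ (Equiv.Perm (Fin k))}
    (hy : MonoidAlgebra.lift κ _ _ (permRep hβ form b deg k) y (tensorBasis k b z) = 0) :
    y * ∑ τ ∈ Finset.univ.filter (fun τ : Equiv.Perm (Fin k) => z ∘ τ = z),
      MonoidAlgebra.single τ⁻¹ (braidSign β (deg ∘ z) τ : κ) = 0 := by
  ext σ
  -- The group elements sending the tensor of `z` to a multiple of that of `z ∘ σ⁻¹` form the coset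
  -- of `σ` modulo the stabilizer. Up to the unit `braidSign β (deg ∘ z) σ`, this coefficient is the
  -- required weighted coset sum.
  have h := DFunLike.congr_fun (congrArg (tensorBasis k b).repr hy) (z ∘ σ.symm)
  rw [MonoidAlgebra.lift_apply, Finsupp.sum_fintype _ _ (by simp), LinearMap.sum_apply, map_sum,
    Finsupp.finsetSum_apply, ← Equiv.sum_comp (Equiv.mulLeft σ)] at h
  simp only [Equiv.coe_mulLeft, LinearMap.smul_apply, map_smul, Finsupp.smul_apply,
    permRep_apply, Basis.repr_self, map_zero, Finsupp.zero_apply, smul_eq_mul] at h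
  rw [Finset.mul_sum, MonoidAlgebra.coeff_sum, Finsupp.finsetSum_apply]
  simp only [MonoidAlgebra.coeff_mul_single_apply, inv_inv, MonoidAlgebra.coeff_zero,
    Finsupp.zero_apply]
  rw [Finset.sum_filter]
  refine ((mul_eq_zero (a := (braidSign β (deg ∘ z) σ : κ))).1 ?_).resolve_left (Units.ne_zero _)
  rw [Finset.mul_sum]
  refine Eq.trans (Finset.sum_congr rfl fun τ _ => ?_) h
  by_cases hτ : z ∘ τ = z
  · have hz : z ∘ (σ * τ).symm = z ∘ σ.symm := by
      funext i
      have := congrFun hτ ((σ * τ).symm i)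
      rw [Function.comp_apply] at this
      rw [Function.comp_apply, ← this, Function.comp_apply]
      congr 1
      rw [Equiv.eq_symm_apply]
      exact (σ * τ).apply_symm_apply i
    rw [if_pos hτ, hz, Finsupp.single_eq_same,
      braidSign_mul_of_comp_eq hβ fun i => congrArg deg (congrFun hτ i), Units.val_mul]
    ring
  · have hz : z ∘ σ.symm ≠ z ∘ (σ * τ).symm := by
      intro hz
      refine hτ (funext fun i => ?_)
      have := congrFun hz (σ (τ i))
      rw [Function.comp_apply, Function.comp_apply, Equiv.symm_apply_apply] at this
      rw [Function.comp_apply, this]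
      congr 1
      rw [Equiv.symm_apply_eq]
      rfl
    rw [if_neg hτ, Finsupp.single_eq_of_ne hz]
    simp

end Stabilizer

/-! ### From vanishing on one tensor to vanishing in the group algebra -/

section Decomposition

variable {κ G V : Type*} [Field κ] [CharZero κ] [CommGroup G] [Fintype G] [DecidableEq G]
  [AddCommGroup V] [Module κ V] {𝒱 : G → Submodule κ V}
  {form : LinearMap.BilinForm κ V} {β : G → G → κˣ} {r s e : ℕ}
  {b : Basis (Idx r s e) κ V} {deg : Idx r s e → G} {k : ℕ} {L : Finset (Fin k)}

theorem HookTableau.row_of_letter_eq (T : HookTableau r s L) {x y : {i // i ∈ L}} {i : Fin r}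
    (hx : T.letter e x = .t i) (hxy : T.letter e y = T.letter e x) :
    T.1.row y = T.1.row x := by
  have key : ∀ w, T.letter e w = .t i → (T.1.box w).1.1 = i := by
    intro w hw
    rcases lt_or_ge (T.1.box w).1.1 r with h | h
    · rw [T.letter_of_lt h, Idx.t.injEq] at hw
      exact congrArg Fin.val hw
    · obtain ⟨_, h⟩ := T.exists_letter_of_ge (e := e) h
      rw [h] at hw
      cases hw
  rw [T.1.row_of_mem x.2, T.1.row_of_mem y.2, Subtype.coe_eta, Subtype.coe_eta, key x hx,
    key y (hxy.trans hx)]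

theorem HookTableau.col_of_letter_eq (T : HookTableau r s L) {x y : {i // i ∈ L}} {i : Fin s}
    (hx : T.letter e x = .u i) (hxy : T.letter e y = T.letter e x) :
    T.1.col y = T.1.col x := by
  have key : ∀ w, T.letter e w = .u i → (T.1.box w).1.2 = i := by
    intro w hw
    rcases lt_or_ge (T.1.box w).1.1 r with h | h
    · rw [T.letter_of_lt h] at hw
      cases hw
    · obtain ⟨_, h⟩ := T.exists_letter_of_ge (e := e) h
      rw [h, Idx.u.injEq] at hw
      exact congrArg Fin.val hw
  rw [T.1.col_of_mem x.2, T.1.col_of_mem y.2, Subtype.coe_eta, Subtype.coe_eta, key x hx,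
    key y (hxy.trans hx)]

theorem HookTableau.letter_cases (T : HookTableau r s L) (x : {i // i ∈ L}) :
    (∃ i, T.letter e x = .t i) ∨ ∃ i, T.letter e x = .u i := by
  rcases lt_or_ge (T.1.box x).1.1 r with h | h
  · exact .inl ⟨_, T.letter_of_lt h⟩
  · obtain ⟨_, h⟩ := T.exists_letter_of_ge (e := e) h
    exact .inr ⟨_, h⟩

/-- Let `ψ` be the part of `τ` on the positions labeled `t` and `γ` the part on those labeled `u`.
Equal letters `t_i` share a row and equal `u_j` share a column; `ψ` contributes its sign and `γ`
contributes 1. -/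
theorem exists_col_mul_row (hβ : IsSymmetricBicharacter β) (hb : IsSpoBasis β 𝒱 form b deg)
    (T : HookTableau r s L) {z : Fin k → Idx r s e} (hz : ∀ x : {i // i ∈ L}, z x = T.letter e x)
    {τ : Equiv.Perm (Fin k)} (hτ : ∀ i, z (τ i) = z i) (hfix : ∀ i, i ∉ L → τ i = i) :
    ∃ γ ∈ T.1.colGroup, ∃ ψ ∈ T.1.rowGroup, τ = γ * ψ ∧
      (braidSign β (deg ∘ z) τ : κ) = ((Equiv.Perm.sign ψ : ℤˣ) : ℤ) := by
  classical
  have hL : ∀ x, τ x ∈ L ↔ x ∈ L := by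
    intro x
    by_cases hx : x ∈ L
    · refine iff_of_true ?_ hx
      by_contra h'
      rw [τ.injective (hfix _ h')] at h'
      exact h' hx
    · rw [hfix x hx]
  let P : Fin k → Prop := fun x => x ∈ L ∧ ∃ i, z x = .t i
  have hP : ∀ x, P (τ x) ↔ P x := fun x => by simp only [P, hL, hτ]
  set ψ : Equiv.Perm (Fin k) := Equiv.Perm.ofSubtype (τ.subtypePerm hP) with hψdef
  have hψP : ∀ x, P x → ψ x = τ x := fun x hx => by
    rw [hψdef, Equiv.Perm.ofSubtype_apply_of_mem _ hx]; rfl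
  have hψN : ∀ x, ¬ P x → ψ x = x := fun x hx => Equiv.Perm.ofSubtype_apply_of_not_mem _ hx
  have hzψ : ∀ i, z (ψ i) = z i := fun i => by
    by_cases hi : P i
    · rw [hψP i hi, hτ]
    · rw [hψN i hi]
  set γ : Equiv.Perm (Fin k) := τ * ψ⁻¹ with hγdef
  have hτ' : τ = γ * ψ := by rw [hγdef, inv_mul_cancel_right]
  have hγψ : ∀ i, γ (ψ i) = τ i := fun i => by rw [hτ']; rfl
  have hγN : ∀ x, ¬ P x → γ x = τ x := fun x hx => by
    conv_lhs => rw [← hψN x hx]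
    exact hγψ x
  have hγP : ∀ x, P x → γ x = x := fun x hx => by
    obtain ⟨y, rfl⟩ := τ.surjective x
    have hy := (hP y).1 hx
    conv_lhs => rw [← hψP y hy]
    exact hγψ y
  have hzγ : ∀ i, z (γ i) = z i := fun i => by
    by_cases hi : P i
    · rw [hγP i hi]
    · rw [hγN i hi, hτ]
  refine ⟨γ, ?_, ψ, ?_, hτ', ?_⟩
  · rw [T.1.mem_colGroup]
    have hPL : ∀ i, i ∉ L → ¬ P i := fun i hi h => hi h.1
    refine ⟨fun i hi => by rw [hγN i (hPL i hi), hfix i hi], fun i => ?_⟩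
    by_cases hi : P i
    · rw [hγP i hi]
    · rw [hγN i hi]
      by_cases hiL : i ∈ L
      · have h₁ := hz ⟨i, hiL⟩
        have h₂ := hz ⟨τ i, (hL i).2 hiL⟩
        rcases T.letter_cases (e := e) ⟨i, hiL⟩ with ⟨j, hj⟩ | ⟨j, hj⟩
        · exact absurd ⟨hiL, j, h₁.trans hj⟩ hi
        · exact T.col_of_letter_eq (x := ⟨i, hiL⟩) (y := ⟨τ i, (hL i).2 hiL⟩) hj
            (by rw [← h₁, ← h₂]; exact hτ i)
      · rw [hfix i hiL]
  · rw [T.1.mem_rowGroup]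
    refine ⟨fun i hi => hψN i fun h => hi h.1, fun i => ?_⟩
    by_cases hi : P i
    · obtain ⟨hiL, j, hj⟩ := hi
      rw [hψP i ⟨hiL, j, hj⟩]
      have h₁ := hz ⟨i, hiL⟩
      have h₂ := hz ⟨τ i, (hL i).2 hiL⟩
      exact T.row_of_letter_eq (e := e) (x := ⟨i, hiL⟩) (y := ⟨τ i, (hL i).2 hiL⟩)
        (h₁.symm.trans hj) (by rw [← h₁, ← h₂]; exact hτ i)
    · rw [hψN i hi]
  · rw [hτ', braidSign_mul_of_comp_eq hβ fun i => congrArg deg (hzψ i), Units.val_mul,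
      braidSign_eq_character hβ (η := -1) 1 (by simp) γ (fun i => congrArg deg (hzγ i)),
      braidSign_eq_character hβ (η := 1) Equiv.Perm.sign
        (fun x y hxy => by rw [Equiv.Perm.sign_swap hxy]; simp) ψ (fun i => congrArg deg (hzψ i))]
    · simp
    · intro i hi
      have hPi : P i := by_contra fun h => hi (hψN i h)
      obtain ⟨_, j, hj⟩ := hPi
      rw [Function.comp_apply, hb.parity, hj]; rfl
    · intro i hi
      have hPi : ¬ P i := fun h => hi (hγP i h)
      have hiL : i ∈ L := by
        by_contra h
        exact hi (by rw [hγN i hPi, hfix i h])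
      rcases T.letter_cases (e := e) ⟨i, hiL⟩ with ⟨j, hj⟩ | ⟨j, hj⟩
      · exact absurd ⟨hiL, j, (hz ⟨i, hiL⟩).trans hj⟩ hPi
      · rw [Function.comp_apply, hb.parity, show z i = .u j from (hz ⟨i, hiL⟩).trans hj]; rfl

/-- If the labels outside `L` are distinct from each other and from those in `L`, the Young
element is recovered from its value at the basis tensor. -/
theorem mul_young_eq_zero_of_lift_eq_zero (hβ : IsSymmetricBicharacter β)
    (hb : IsSpoBasis β 𝒱 form b deg) (T : HookTableau r s L) {z : Fin k → Idx r s e}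
    (hz : ∀ x : {i // i ∈ L}, z x = T.letter e x)
    (hinj : ∀ i, i ∉ L → ∀ j, z j = z i → j = i)
    {A : MonoidAlgebra κ (Equiv.Perm (Fin k))}
    (h : MonoidAlgebra.lift κ _ _ (permRep hβ form b deg k) (A * (T.1.colSum κ * T.1.rowSum κ))
      (tensorBasis k b z) = 0) :
    A * (T.1.colSum κ * T.1.rowSum κ * T.1.colSum κ) = 0 := by
  set F := Finset.univ.filter (fun τ : Equiv.Perm (Fin k) => z ∘ τ = z) with hF
  have h₁ := mul_stabilizer_sum_eq_zero hβ z h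
  -- Here `τ⁻¹ = ψ⁻¹ γ⁻¹`: the row sum absorbs `ψ⁻¹` with its sign, which the braid sign cancels,
  -- and the column sum absorbs `γ⁻¹`. All stabilizer terms thus become equal.
  have h₂ : ∀ τ ∈ F, T.1.rowSum κ * MonoidAlgebra.single τ⁻¹ (braidSign β (deg ∘ z) τ : κ) *
      T.1.colSum κ = T.1.rowSum κ * T.1.colSum κ := by
    intro τ hτ
    have hτ' := congrFun (Finset.mem_filter.1 hτ).2
    obtain ⟨γ, hγ, ψ, hψ, hγψ, hsign⟩ := exists_col_mul_row hβ hb T hz hτ'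
      fun i hi => hinj i hi _ (hτ' i)
    have e₁ : MonoidAlgebra.single τ⁻¹ (braidSign β (deg ∘ z) τ : κ) =
        (braidSign β (deg ∘ z) τ : κ) •
          (MonoidAlgebra.single ψ⁻¹ 1 * MonoidAlgebra.single γ⁻¹ 1) := by
      rw [MonoidAlgebra.single_mul_single, ← mul_inv_rev, ← hγψ]
      simp
    rw [e₁, mul_smul_comm, ← mul_assoc,
      charSum_mul_single _ T.1.mem_rowGroup_iff (T.1.rowSubgroup.inv_mem hψ), smul_mul_assoc,
      smul_mul_assoc, smul_mul_assoc, mul_assoc,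
      single_mul_charSum _ T.1.mem_colGroup_iff (T.1.colSubgroup.inv_mem hγ), mul_smul_comm,
      hsign, smul_smul, Equiv.Perm.sign_inv, intUnit_sq]
    simp
  have h₃ := congrArg (· * T.1.colSum κ) h₁
  simp only [zero_mul, mul_assoc] at h₃
  rw [Finset.sum_mul, Finset.mul_sum] at h₃
  rw [Finset.sum_congr rfl fun τ hτ => by rw [← mul_assoc, h₂ τ hτ]] at h₃
  rw [Finset.sum_const, mul_smul_comm, mul_smul_comm, ← Nat.cast_smul_eq_nsmul κ] at h₃
  have hcard : (F.card : κ) ≠ 0 := by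
    rw [Nat.cast_ne_zero]
    exact Finset.card_ne_zero_of_mem (a := 1) (by simp [hF])
  rw [mul_assoc (T.1.colSum κ)]
  exact (smul_eq_zero.1 h₃).resolve_left hcard

end Decomposition

/-! ### The letters determine the hook shape -/

section Shape

variable {r s e k : ℕ} {L : Finset (Fin k)}

theorem HookTableau.letter_eq_t_iff (T : HookTableau r s L) (x : {i // i ∈ L}) (a : Fin r) :
    T.letter e x = .t a ↔ (T.1.box x).1.1 = a := by
  rcases lt_or_ge (T.1.box x).1.1 r with h | h
  · rw [T.letter_of_lt h, Idx.t.injEq, Fin.ext_iff]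
  · obtain ⟨_, hl⟩ := T.exists_letter_of_ge (e := e) h
    rw [hl]
    exact iff_of_false (by simp) (by omega)

theorem HookTableau.letter_eq_u_iff (T : HookTableau r s L) (x : {i // i ∈ L}) (a : Fin s) :
    T.letter e x = .u a ↔ r ≤ (T.1.box x).1.1 ∧ (T.1.box x).1.2 = a := by
  rcases lt_or_ge (T.1.box x).1.1 r with h | h
  · rw [T.letter_of_lt h]
    exact iff_of_false (by simp) (by omega)
  · obtain ⟨_, hl⟩ := T.exists_letter_of_ge (e := e) h
    rw [hl, Idx.u.injEq, Fin.ext_iff, and_iff_right h]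

theorem StandardTableau.card_filter_box (T : StandardTableau L) (P : ℕ × ℕ → Prop)
    [DecidablePred P] :
    (Finset.univ.filter fun x : {i // i ∈ L} => P (T.box x).1).card =
      (T.shape.cells.filter P).card := by
  refine Finset.card_bij (fun x _ => (T.box x).1) ?_ ?_ ?_
  · intro x hx
    exact Finset.mem_filter.2 ⟨(T.box x).2, (Finset.mem_filter.1 hx).2⟩
  · intro x _ y _ hxy
    exact T.box.injective (Subtype.ext hxy)
  · intro c hc
    obtain ⟨hc, hP⟩ := Finset.mem_filter.1 hc
    exact ⟨T.box.symm ⟨c, hc⟩, by simpa using hP, by simp⟩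

theorem HookTableau.card_letter_t (T : HookTableau r s L) (a : Fin r) :
    (Finset.univ.filter fun x : {i // i ∈ L} => T.letter e x = .t a).card =
      T.1.shape.rowLen a := by
  simp only [T.letter_eq_t_iff]
  rw [T.1.card_filter_box fun c => c.1 = a, YoungDiagram.rowLen_eq_card]
  rfl

theorem HookTableau.card_letter_u (T : HookTableau r s L) (a : Fin s) :
    (Finset.univ.filter fun x : {i // i ∈ L} => T.letter e x = .u a).card =
      T.1.shape.colLen a - r := by
  simp only [T.letter_eq_u_iff]
  rw [T.1.card_filter_box fun c => r ≤ c.1 ∧ c.2 = a, ← Nat.card_Ico]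
  refine Finset.card_nbij' Prod.fst (fun i => (i, a.1)) ?_ ?_ ?_ fun i _ => rfl
  · rintro ⟨i, j⟩ h
    simp only [Finset.coe_filter, Set.mem_ofPred_eq, YoungDiagram.mem_cells] at h
    obtain ⟨h₁, h₂, rfl⟩ := h
    simpa [h₂] using YoungDiagram.mem_iff_lt_colLen.1 h₁
  · intro i h
    simp only [Finset.coe_Ico, Set.mem_Ico] at h
    simpa [h.1] using YoungDiagram.mem_iff_lt_colLen.2 h.2
  · rintro ⟨i, j⟩ h
    simp only [Finset.coe_filter, Set.mem_ofPred_eq] at h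
    rw [h.2.2]

/-- The letters of a hook tableau determine its shape. -/
theorem HookTableau.shape_eq_of_letter_eq {T T₀ : HookTableau r s L}
    (g : Equiv.Perm {i // i ∈ L}) (h : ∀ x, T.letter e x = T₀.letter e (g x)) :
    T.1.shape = T₀.1.shape := by
  have hcard : ∀ l : Idx r s e, (Finset.univ.filter fun x => T.letter e x = l).card =
      (Finset.univ.filter fun x => T₀.letter e x = l).card := fun l =>
    Finset.card_equiv g fun x => by simp [h]
  have hrow : ∀ a : Fin r, T.1.shape.rowLen a = T₀.1.shape.rowLen a := fun a => by
    rw [← T.card_letter_t (e := e), ← T₀.card_letter_t (e := e), hcard]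
  have hcol : ∀ a : Fin s, T.1.shape.colLen a - r = T₀.1.shape.colLen a - r := fun a => by
    rw [← T.card_letter_u (e := e), ← T₀.card_letter_u (e := e), hcard]
  have hlt : ∀ (T : HookTableau r s L) {i j}, r ≤ i → (i, j) ∈ T.1.shape → j < s :=
    fun T i j hi hm => lt_of_lt_of_le
      (YoungDiagram.mem_iff_lt_rowLen.1 (T.1.shape.up_left_mem hi le_rfl hm)) T.2
  refine SetLike.ext fun ⟨i, j⟩ => ?_
  rcases lt_or_ge i r with hi | hi
  · rw [YoungDiagram.mem_iff_lt_rowLen, YoungDiagram.mem_iff_lt_rowLen]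
    exact (hrow ⟨i, hi⟩) ▸ Iff.rfl
  · by_cases hj : j < s
    · rw [YoungDiagram.mem_iff_lt_colLen, YoungDiagram.mem_iff_lt_colLen]
      -- Truncation in `colLen - r` loses nothing, since only rows `i ≥ r` are compared here.
      have := hcol ⟨j, hj⟩
      simp only at this
      omega
    · exact iff_of_false (fun hm => hj (hlt T hi hm)) fun hm => hj (hlt T₀ hi hm)

theorem HookTableau.letter_eq_of_box_eq {T T₀ : HookTableau r s L} {x y : {i // i ∈ L}}
    (h : (T.1.box x).1 = (T₀.1.box y).1) : T.letter e x = T₀.letter e y := by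
  rcases lt_or_ge (T₀.1.box y).1.1 r with hr | hr
  · rw [T₀.letter_of_lt hr, T.letter_eq_t_iff, h]
  · obtain ⟨_, hl⟩ := T₀.exists_letter_of_ge (e := e) hr
    rw [hl, T.letter_eq_u_iff, h]
    exact ⟨hr, rfl⟩

theorem HookTableau.letter_height_pos (T : HookTableau r s L) (x : {i // i ∈ L}) :
    0 < (T.letter e x).height := by
  rcases T.letter_cases (e := e) x with ⟨i, h⟩ | ⟨i, h⟩
  · rw [h]; simp only [Idx.height]; omega
  · rw [h]; simp only [Idx.height]; omega

end Shape

/-! ### Fresh labels and recovery of the contraction datum -/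

section Labels

variable {r s e k : ℕ}

namespace ContractionData

variable {c c₀ : ContractionData k}

theorem mem_compl_or (c : ContractionData k) (i : Fin k) :
    i ∈ c.compl ∨ (∃ a, c.p a = i) ∨ ∃ a, c.q a = i := by
  rw [mem_compl]
  by_contra! h
  obtain ⟨⟨a, ha⟩, h₁, h₂⟩ := h
  exact h₂ a (ha (h₁ a))

/-- The pairs are listed by increasing `p`, so the set of pairs determines the lists. -/
theorem ext_pairs (h : ∀ a, ∃ a', c.p a = c₀.p a' ∧ c.q a = c₀.q a')
    (h' : ∀ a', ∃ a, c.p a = c₀.p a' ∧ c.q a = c₀.q a') : c = c₀ := by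
  have hj : c.j = c₀.j := by
    choose f hf using h
    choose f' hf' using h'
    have h₁ : Function.Injective f := fun a a' haa => c.p_strictMono.injective (by
      rw [(hf a).1, (hf a').1, haa])
    have h₂ : Function.Injective f' := fun a a' haa => c₀.p_strictMono.injective (by
      rw [← (hf' a).1, ← (hf' a').1, haa])
    have e₁ := Fintype.card_le_of_injective f h₁
    have e₂ := Fintype.card_le_of_injective f' h₂
    simp only [Fintype.card_fin] at e₁ e₂
    omega
  obtain ⟨j, p, q, hp, hq, hne, hlt⟩ := c
  obtain ⟨j₀, p₀, q₀, hp₀, hq₀, hne₀, hlt₀⟩ := c₀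
  simp only at hj h h'
  subst hj
  have hpp : p = p₀ := by
    rw [← StrictMono.range_inj hp hp₀]
    ext i
    constructor
    · rintro ⟨a, rfl⟩
      obtain ⟨a', ha, -⟩ := h a
      exact ⟨a', ha.symm⟩
    · rintro ⟨a, rfl⟩
      obtain ⟨a', ha, -⟩ := h' a
      exact ⟨a', ha⟩
  subst hpp
  have hqq : q = q₀ := by
    funext a
    obtain ⟨a', ha, ha'⟩ := h a
    rw [hp.injective ha, ← ha', hp.injective ha]
  subst hqq
  rfl

/-- A labeling with distinct fresh labels on the pairs of `c₀` determines `c₀`. -/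
theorem eq_of_label {z : Fin k → Idx r s e} {f : Fin c₀.j → Idx r s e}
    (hf : Function.Injective f) (hpos : ∀ a, 0 < (f a).height) (hp : ∀ a, z (c₀.p a) = f a)
    (hq : ∀ a, z (c₀.q a) = (f a).star) (hL : ∀ x ∈ c₀.compl, 0 < (z x).height)
    (hLf : ∀ x ∈ c₀.compl, ∀ a, z x ≠ f a) (hstar : ∀ a, z (c.q a) = (z (c.p a)).star)
    (hcL : ∀ x ∈ c.compl, 0 < (z x).height) : c = c₀ := by
  have hneg : ∀ a, (z (c₀.q a)).height < 0 := fun a => by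
    rw [hq, Idx.height_star]
    have := hpos a
    omega
  have huniq : ∀ y a, z y = f a → y = c₀.p a := by
    intro y a hy
    rcases c₀.mem_compl_or y with h | ⟨a', rfl⟩ | ⟨a', rfl⟩
    · exact absurd hy (hLf y h a)
    · rw [hp] at hy
      rw [hf hy]
    · have h₁ := hneg a'
      rw [hy] at h₁
      exact absurd h₁ (hpos a).not_gt
  -- The position `c₀.q a₀` has a label of negative height, so it belongs to a pair of `c`. Its
  -- partner there carries `f a₀`, which occurs only at `c₀.p a₀`; the condition `p < q` excludes
  -- the reversed orientation.
  have step : ∀ a₀, ∃ a, c.p a = c₀.p a₀ ∧ c.q a = c₀.q a₀ := by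
    intro a₀
    rcases c.mem_compl_or (c₀.q a₀) with h | ⟨a, ha⟩ | ⟨a, ha⟩
    · exact absurd (hcL _ h) (hneg a₀).not_gt
    · have h₁ := hstar a
      rw [ha, hq, Idx.star_star] at h₁
      have h₂ := huniq _ _ h₁
      have h₃ := c.p_lt_q a
      rw [ha, h₂] at h₃
      exact absurd h₃ (c₀.p_lt_q a₀).not_gt
    · refine ⟨a, huniq _ _ ?_, ha⟩
      have h₁ := hstar a
      rw [ha, hq] at h₁
      rw [← Idx.star_star (z (c.p a)), ← h₁, Idx.star_star]
  have hne : ∀ y, (z y).height < 0 ∨ 0 < (z y).height := by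
    intro y
    rcases c₀.mem_compl_or y with h | ⟨a', rfl⟩ | ⟨a', rfl⟩
    · exact .inr (hL y h)
    · exact .inr (by rw [hp]; exact hpos a')
    · exact .inl (hneg a')
  have hmem : ∀ y, (z y).height < 0 → ∃ a, c₀.q a = y := by
    intro y hy
    rcases c₀.mem_compl_or y with h | ⟨a', rfl⟩ | ⟨a', rfl⟩
    · exact absurd (hL y h) hy.not_gt
    · rw [hp] at hy
      exact absurd (hpos a') hy.not_gt
    · exact ⟨a', rfl⟩
  refine ext_pairs (fun a => ?_) step
  have hh : (z (c.q a)).height = -(z (c.p a)).height := by rw [hstar, Idx.height_star]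
  rcases hne (c.p a) with h | h
  · obtain ⟨a₀, ha₀⟩ := hmem _ h
    obtain ⟨a', -, ha'⟩ := step a₀
    exact absurd (ha'.trans ha₀).symm (c.p_ne_q a a')
  · obtain ⟨a₀, ha₀⟩ := hmem (c.q a) (by omega)
    obtain ⟨a', ha', ha''⟩ := step a₀
    have : a' = a := c.q_injective (ha''.trans ha₀)
    subst this
    exact ⟨a₀, ha', ha''⟩

theorem card_compl_add_le (c : ContractionData k) : c.compl.card + c.j ≤ k := by
  have hdisj : Disjoint c.compl (Finset.univ.image c.p) := by
    rw [Finset.disjoint_left]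
    intro i hi hi'
    obtain ⟨a, -, rfl⟩ := Finset.mem_image.1 hi'
    exact (mem_compl.1 hi a).1 rfl
  have h := Finset.card_le_univ (c.compl ∪ Finset.univ.image c.p)
  rw [Finset.card_union_of_disjoint hdisj,
    Finset.card_image_of_injective _ c.p_strictMono.injective] at h
  simpa using h

end ContractionData

/-- There are at least `r + s` labels of positive height. The tableau uses at most one per entry and
each pair needs one more, at most `k` in all; this is where `k ≤ r + s` enters. -/
theorem exists_fresh_labels (hk : k ≤ r + s) {c : ContractionData k}
    (T : HookTableau r s c.compl) :
    ∃ f : Fin c.j → Idx r s e, Function.Injective f ∧ (∀ a, 0 < (f a).height) ∧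
      ∀ x a, T.letter e x ≠ f a := by
  set U : Finset (Idx r s e) := Finset.univ.filter fun i => 0 < i.height with hU
  set S : Finset (Idx r s e) := Finset.univ.image (T.letter e) with hS
  have hUcard : r + s ≤ U.card := by
    let φ : Fin r ⊕ Fin s → U := Sum.elim
      (fun i => ⟨.t i, Finset.mem_filter.2 ⟨Finset.mem_univ _, by
        simp only [Idx.height]; omega⟩⟩)
      (fun i => ⟨.u i, Finset.mem_filter.2 ⟨Finset.mem_univ _, by
        simp only [Idx.height]; omega⟩⟩)
    have hφ : Function.Injective φ := by
      rintro (i | i) (j | j) h <;> simp_all [φ]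
    simpa using Fintype.card_le_of_injective φ hφ
  have hScard : S.card ≤ c.compl.card :=
    Finset.card_image_le.trans (by simp)
  have h₁ := Finset.le_card_sdiff S U
  have h₂ := c.card_compl_add_le
  obtain ⟨φ⟩ := Function.Embedding.nonempty_of_card_le (α := Fin c.j) (β := {i // i ∈ U \ S})
    (by simp only [Fintype.card_fin, Fintype.card_coe]; omega)
  refine ⟨fun a => (φ a).1, Subtype.val_injective.comp φ.injective, fun a => ?_, fun x a h => ?_⟩
  · exact (Finset.mem_filter.1 (Finset.mem_sdiff.1 (φ a).2).1).2
  · exact (Finset.mem_sdiff.1 (φ a).2).2 (by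
      rw [← show T.letter e x = (φ a).1 from h]
      exact Finset.mem_image_of_mem _ (Finset.mem_univ x))

theorem exists_labeling {c : ContractionData k} (l : {i // i ∈ c.compl} → Idx r s e)
    (f : Fin c.j → Idx r s e) :
    ∃ z : Fin k → Idx r s e, (∀ x, z x.1 = l x) ∧ (∀ a, z (c.p a) = f a) ∧
      ∀ a, z (c.q a) = (f a).star := by
  classical
  rcases isEmpty_or_nonempty (Idx r s e) with hI | ⟨⟨i₀⟩⟩
  · have hk : ∀ x : {i // i ∈ c.compl}, False := fun x => hI.elim (l x)
    have hj : ∀ a : Fin c.j, False := fun a => hI.elim (f a)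
    have hempty : ∀ i : Fin k, False := fun i => by
      rcases c.mem_compl_or i with h | ⟨a, -⟩ | ⟨a, -⟩
      exacts [hk ⟨i, h⟩, hj a, hj a]
    exact ⟨fun i => (hempty i).elim, fun x => (hk x).elim, fun a => (hj a).elim,
      fun a => (hj a).elim⟩
  refine ⟨Function.extend c.p f (Function.extend c.q (fun a => (f a).star)
    fun i => if h : i ∈ c.compl then l ⟨i, h⟩ else i₀), fun x => ?_, fun a => ?_, fun a => ?_⟩
  · have hx := ContractionData.mem_compl.1 x.2
    rw [Function.extend_apply' _ _ _ fun ⟨a, ha⟩ => (hx a).1 ha,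
      Function.extend_apply' _ _ _ fun ⟨a, ha⟩ => (hx a).2 ha, dif_pos x.2]
  · exact c.p_strictMono.injective.extend_apply _ _ _
  · rw [Function.extend_apply' _ _ _ fun ⟨a', ha⟩ => c.p_ne_q a' a ha,
      c.q_injective.extend_apply]

end Labels

/-! ### Projection onto rearrangements of a labeling -/

section Projection

variable {κ G V : Type*} [Field κ] [CharZero κ] [CommGroup G] [Fintype G] [DecidableEq G]
  [AddCommGroup V] [Module κ V] {𝒱 : G → Submodule κ V}
  {form : LinearMap.BilinForm κ V} {β : G → G → κˣ} {r s e : ℕ}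
  {b : Basis (Idx r s e) κ V} {deg : Idx r s e → G} {k : ℕ} {L : Finset (Fin k)}

open Classical in
/-- The projection onto the span of the basis tensors with labelings in `Z`. -/
def labelProj (b : Basis (Idx r s e) κ V) (Z : Set (Fin k → Idx r s e)) :
    End κ (⨂[κ] _ : Fin k, V) :=
  (tensorBasis k b).constr κ fun z => if z ∈ Z then tensorBasis k b z else 0

open Classical in
theorem labelProj_apply (Z : Set (Fin k → Idx r s e)) (z : Fin k → Idx r s e) :
    labelProj b Z (tensorBasis k b z) = if z ∈ Z then tensorBasis k b z else 0 :=
  (tensorBasis k b).constr_basis κ _ z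

/-- The rearrangements of the labels of `z` in the positions `L`. -/
def rearrangements (L : Finset (Fin k)) (z : Fin k → Idx r s e) : Set (Fin k → Idx r s e) :=
  {y | ∃ τ : Equiv.Perm (Fin k), (∀ i, i ∉ L → τ i = i) ∧ y = z ∘ τ}

theorem comp_mem_rearrangements {z y : Fin k → Idx r s e} {σ : Equiv.Perm (Fin k)}
    (hσ : ∀ i, i ∉ L → σ i = i) (hy : y ∈ rearrangements L z) : y ∘ σ ∈ rearrangements L z := by
  obtain ⟨τ, hτ, rfl⟩ := hy
  exact ⟨τ * σ, fun i hi => by rw [Equiv.Perm.mul_apply, hσ i hi, hτ i hi], rfl⟩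

theorem labelProj_permRep (hβ : IsSymmetricBicharacter β) (z : Fin k → Idx r s e)
    {σ : Equiv.Perm (Fin k)} (hσ : ∀ i, i ∉ L → σ i = i) (v : ⨂[κ] _ : Fin k, V) :
    labelProj b (rearrangements L z) (permRep hβ form b deg k σ v) =
      permRep hβ form b deg k σ (labelProj b (rearrangements L z) v) := by
  have hσ' : ∀ i, i ∉ L → σ.symm i = i := fun i hi => by
    rw [Equiv.symm_apply_eq, hσ i hi]
  have h : labelProj b (rearrangements L z) ∘ₗ permRep hβ form b deg k σ =
      permRep hβ form b deg k σ ∘ₗ labelProj b (rearrangements L z) := by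
    refine (tensorBasis k b).ext fun y => ?_
    rw [LinearMap.comp_apply, LinearMap.comp_apply, permRep_apply, map_smul, labelProj_apply,
      labelProj_apply]
    by_cases hy : y ∈ rearrangements L z
    · rw [if_pos hy, if_pos (comp_mem_rearrangements hσ' hy), permRep_apply]
    · have hy' : y ∘ σ.symm ∉ rearrangements L z := fun hy' => hy (by
        have := comp_mem_rearrangements hσ hy'
        rwa [Function.comp_assoc, Equiv.symm_comp_self] at this)
      rw [if_neg hy, if_neg hy', map_zero, smul_zero]
  exact LinearMap.congr_fun h v

theorem labelProj_lift_charSum (hβ : IsSymmetricBicharacter β) (z : Fin k → Idx r s e)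
    {H : Finset (Equiv.Perm (Fin k))} (hH : ∀ σ ∈ H, ∀ i, i ∉ L → σ i = i)
    (χ : Equiv.Perm (Fin k) →* ℤˣ) (v : ⨂[κ] _ : Fin k, V) :
    labelProj b (rearrangements L z)
        (MonoidAlgebra.lift κ _ _ (permRep hβ form b deg k) (charSum κ H χ) v) =
      MonoidAlgebra.lift κ _ _ (permRep hβ form b deg k) (charSum κ H χ)
        (labelProj b (rearrangements L z) v) := by
  rw [lift_charSum_apply, lift_charSum_apply, map_sum]
  exact Finset.sum_congr rfl fun σ hσ => by rw [map_smul, labelProj_permRep hβ z (hH σ hσ)]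

theorem labelProj_permAct_symmetrizer (hβ : IsSymmetricBicharacter β) (z : Fin k → Idx r s e)
    (T : StandardTableau L) (v : ⨂[κ] _ : Fin k, V) :
    labelProj b (rearrangements L z) (permAct β form b deg (T.symmetrizer κ) v) =
      permAct β form b deg (T.symmetrizer κ) (labelProj b (rearrangements L z) v) := by
  rw [permAct_symmetrizer hβ, permAct_symmetrizer hβ, map_smul, StandardTableau.colSum,
    StandardTableau.rowSum,
    labelProj_lift_charSum hβ z (fun σ hσ => (T.mem_colGroup.1 hσ).1),
    labelProj_lift_charSum hβ z (fun σ hσ => (T.mem_rowGroup.1 hσ).1)]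

theorem exists_of_labelProj_permAct_ne_zero (hβ : IsSymmetricBicharacter β)
    (Z : Set (Fin k → Idx r s e)) (T : StandardTableau L) {v : ⨂[κ] _ : Fin k, V}
    (h : labelProj b Z (permAct β form b deg (T.symmetrizer κ) v) ≠ 0) :
    ∃ (z : Fin k → Idx r s e) (σ : Equiv.Perm (Fin k)), (tensorBasis k b).repr v z ≠ 0 ∧
      (∀ i, i ∉ L → σ i = i) ∧ z ∘ σ ∈ Z := by
  by_contra! hno
  refine h ?_
  have key : ∀ γ ∈ T.colGroup, ∀ ψ ∈ T.rowGroup,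
      labelProj b Z (permRep hβ form b deg k γ (permRep hβ form b deg k ψ v)) = 0 := by
    intro γ hγ ψ hψ
    rw [show permRep hβ form b deg k γ (permRep hβ form b deg k ψ v) =
      permRep hβ form b deg k (γ * ψ) v by rw [map_mul]; rfl, ← (tensorBasis k b).sum_repr v,
      map_sum, map_sum]
    refine Finset.sum_eq_zero fun z _ => ?_
    by_cases hz : (tensorBasis k b).repr v z = 0
    · rw [hz, zero_smul, map_zero, map_zero]
    rw [map_smul, permRep_apply, map_smul, map_smul, labelProj_apply, if_neg, smul_zero, smul_zero]
    refine hno z (γ * ψ).symm hz fun i hi => ?_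
    rw [Equiv.symm_apply_eq, Equiv.Perm.mul_apply, (T.mem_rowGroup.1 hψ).1 i hi,
      (T.mem_colGroup.1 hγ).1 i hi]
  rw [permAct_symmetrizer hβ, StandardTableau.colSum, StandardTableau.rowSum, lift_charSum_apply,
    lift_charSum_apply, map_smul, map_sum]
  refine smul_eq_zero_of_right _ (Finset.sum_eq_zero fun γ hγ => ?_)
  rw [map_smul, map_sum, map_sum]
  refine smul_eq_zero_of_right _ (Finset.sum_eq_zero fun ψ hψ => ?_)
  rw [map_smul, map_smul, key γ hγ ψ hψ, smul_zero]

theorem charSum_mul_single_of_conj {K Γ : Type*} [Field K] [Group Γ] {H H' : Finset Γ}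
    (χ : Γ →* ℤˣ) {g : Γ} (h : ∀ x, x ∈ H ↔ g * x * g⁻¹ ∈ H') :
    charSum K H' χ * MonoidAlgebra.single g 1 = MonoidAlgebra.single g 1 * charSum K H χ := by
  unfold charSum
  rw [Finset.sum_mul, Finset.mul_sum]
  symm
  refine Finset.sum_equiv (MulAut.conj g).toEquiv (fun x => by simp [h]) fun x _ => ?_
  have hχ : χ (g * x * g⁻¹) = χ x := by
    rw [map_mul, map_mul, map_inv, mul_right_comm, mul_inv_cancel, one_mul]
  change _ = MonoidAlgebra.single (g * x * g⁻¹) (((χ (g * x * g⁻¹) : ℤˣ) : ℤ) : K) * _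
  rw [hχ, MonoidAlgebra.single_mul_single, MonoidAlgebra.single_mul_single, inv_mul_cancel_right,
    one_mul, mul_one]

theorem StandardTableau.Carries.symm {T₀ T : StandardTableau L} {σ : Equiv.Perm (Fin k)}
    (h : T₀.Carries T σ) : T.Carries T₀ σ⁻¹ where
  fix i hi := Equiv.Perm.inv_eq_iff_eq.2 (h.fix i hi).symm
  row_eq i := by rw [← h.row_eq]; simp
  col_eq i := by rw [← h.col_eq]; simp

theorem StandardTableau.Carries.conj_mem {T₀ T : StandardTableau L} {σ : Equiv.Perm (Fin k)}
    (h : T₀.Carries T σ) {x : Equiv.Perm (Fin k)} :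
    (x ∈ T₀.rowGroup → σ * x * σ⁻¹ ∈ T.rowGroup) ∧
      (x ∈ T₀.colGroup → σ * x * σ⁻¹ ∈ T.colGroup) := by
  rw [mem_rowGroup, mem_rowGroup, mem_colGroup, mem_colGroup]
  constructor
  all_goals
    rintro ⟨h₁, h₂⟩
    refine ⟨fun i hi => ?_, fun i => ?_⟩
    · rw [Equiv.Perm.mul_apply, Equiv.Perm.mul_apply, h.symm.fix i hi, h₁ i hi, h.fix i hi]
    · rw [Equiv.Perm.mul_apply, Equiv.Perm.mul_apply]
      first
        | rw [h.row_eq, h₂, h.symm.row_eq]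
        | rw [h.col_eq, h₂, h.symm.col_eq]

theorem StandardTableau.Carries.conj_iff {T₀ T : StandardTableau L} {σ : Equiv.Perm (Fin k)}
    (h : T₀.Carries T σ) (x : Equiv.Perm (Fin k)) :
    (x ∈ T₀.rowGroup ↔ σ * x * σ⁻¹ ∈ T.rowGroup) ∧
      (x ∈ T₀.colGroup ↔ σ * x * σ⁻¹ ∈ T.colGroup) := by
  have hx : σ⁻¹ * (σ * x * σ⁻¹) * σ⁻¹⁻¹ = x := by group
  refine ⟨⟨h.conj_mem.1, fun h' => ?_⟩, ⟨h.conj_mem.2, fun h' => ?_⟩⟩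
  · simpa only [hx] using h.symm.conj_mem.1 h'
  · simpa only [hx] using h.symm.conj_mem.2 h'

/-- Conjugation by `σ` takes the row and column groups of `T₀` to those of `T`. All tableaux of one
shape are thereby handled with the Young element of `T₀` alone. -/
theorem StandardTableau.Carries.young_mul_single {T₀ T : StandardTableau L}
    {σ : Equiv.Perm (Fin k)} (h : T₀.Carries T σ) :
    T.colSum κ * T.rowSum κ * MonoidAlgebra.single σ 1 =
      MonoidAlgebra.single σ 1 * (T₀.colSum κ * T₀.rowSum κ) := by
  rw [mul_assoc, charSum_mul_single_of_conj _ fun x => (h.conj_iff x).1, ← mul_assoc,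
    charSum_mul_single_of_conj _ fun x => (h.conj_iff x).2, mul_assoc]

theorem StandardTableau.Carries.letter_eq {T₀ T : HookTableau r s L} {σ : Equiv.Perm (Fin k)}
    (h : T₀.1.Carries T.1 σ) {x : Fin k} (hx : x ∈ L) (hσx : σ x ∈ L) :
    T.letter e ⟨σ x, hσx⟩ = T₀.letter e ⟨x, hx⟩ := by
  refine HookTableau.letter_eq_of_box_eq (Prod.ext ?_ ?_)
  · have := h.row_eq x
    rwa [T.1.row_of_mem hσx, T₀.1.row_of_mem hx, Option.some_inj] at this
  · have := h.col_eq x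
    rwa [T.1.col_of_mem hσx, T₀.1.col_of_mem hx, Option.some_inj] at this

end Projection

/-! ### Linear independence -/

section Independence

variable {κ G V : Type*} [Field κ] [CharZero κ] [CommGroup G] [Fintype G] [DecidableEq G]
  [AddCommGroup V] [Module κ V] {𝒱 : G → Submodule κ V}
  {form : LinearMap.BilinForm κ V} {β : G → G → κˣ} {r s e : ℕ}
  {b : Basis (Idx r s e) κ V} {deg : Idx r s e → G} {k : ℕ}

theorem theta_eq (hr : 1 ≤ r) (c : ContractionData k) (T : HookTableau r s c.compl) :
    theta hr β form b deg c T = permAct β form b deg (T.1.symmetrizer κ)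
      (contract β form b deg c (tensorBasis k b (simpleLabel e hr c T))) := by
  rw [theta, tensorBasis, Basis.piTensorProduct_apply]

theorem labelProj_eq_smul {Z : Set (Fin k → Idx r s e)} {v : ⨂[κ] _ : Fin k, V}
    {z : Fin k → Idx r s e} (hz : z ∈ Z)
    (h : ∀ y ∈ Z, (tensorBasis k b).repr v y ≠ 0 → y = z) :
    labelProj b Z v = (tensorBasis k b).repr v z • tensorBasis k b z := by
  conv_lhs => rw [← (tensorBasis k b).sum_repr v]
  rw [map_sum, Finset.sum_eq_single z, map_smul, labelProj_apply, if_pos hz]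
  · intro y _ hy
    rw [map_smul, labelProj_apply]
    by_cases hyZ : y ∈ Z
    · rw [if_pos hyZ, not_not.1 fun hne => hy (h y hyZ hne), zero_smul]
    · rw [if_neg hyZ, smul_zero]
  · exact fun h => absurd (Finset.mem_univ z) h

/-- `z` carries the letters of `T` and distinct fresh labels with their duals on the pairs. -/
structure IsSeparating {c : ContractionData k} (T : HookTableau r s c.compl)
    (z : Fin k → Idx r s e) : Prop where
  letter : ∀ x : {i // i ∈ c.compl}, z x = T.letter e x
  injective : Function.Injective fun a => z (c.p a)
  height_pos : ∀ a, 0 < (z (c.p a)).height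
  fresh : ∀ x ∈ c.compl, ∀ a, z x ≠ z (c.p a)
  star : ∀ a, z (c.q a) = (z (c.p a)).star

theorem exists_isSeparating (hk : k ≤ r + s) {c : ContractionData k}
    (T : HookTableau r s c.compl) : ∃ z : Fin k → Idx r s e, IsSeparating T z := by
  obtain ⟨f, hf, hpos, hfresh⟩ := exists_fresh_labels (e := e) hk T
  obtain ⟨z, h₁, h₂, h₃⟩ := exists_labeling (T.letter e) f
  exact ⟨z, h₁, fun a a' h => hf (by simpa only [h₂] using h), fun a => by rw [h₂]; exact hpos a,
    fun x hx a => by rw [h₁ ⟨x, hx⟩, h₂]; exact hfresh _ a, fun a => by rw [h₃, h₂]⟩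

namespace IsSeparating

variable {c₀ : ContractionData k} {T₀ : HookTableau r s c₀.compl} {z : Fin k → Idx r s e}

theorem height_compl (h : IsSeparating T₀ z) {x : Fin k} (hx : x ∈ c₀.compl) :
    0 < (z x).height := by
  rw [h.letter ⟨x, hx⟩]
  exact T₀.letter_height_pos _

theorem eq_of_apply_eq (h : IsSeparating T₀ z) {i : Fin k} (hi : i ∉ c₀.compl) {j : Fin k}
    (hij : z j = z i) : j = i := by
  have hneg : ∀ a, (z (c₀.q a)).height < 0 := fun a => by
    rw [h.star, Idx.height_star]
    have := h.height_pos a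
    omega
  rcases c₀.mem_compl_or i with hi' | ⟨a, rfl⟩ | ⟨a, rfl⟩
  · exact absurd hi' hi
  · rcases c₀.mem_compl_or j with hj | ⟨a', rfl⟩ | ⟨a', rfl⟩
    · exact absurd hij (h.fresh j hj a)
    · rw [h.injective hij]
    · have := hneg a'
      rw [hij] at this
      exact absurd this (h.height_pos a).not_gt
  · rcases c₀.mem_compl_or j with hj | ⟨a', rfl⟩ | ⟨a', rfl⟩
    · have := h.height_compl hj
      rw [hij] at this
      exact absurd this (hneg a).not_gt
    · have := h.height_pos a'
      rw [hij] at this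
      exact absurd this (hneg a).not_gt
    · rw [h.star, h.star] at hij
      rw [h.injective (Function.LeftInverse.injective Idx.star_star hij)]

/-- The projection onto the rearrangements of a separating labeling detects the contraction datum
and the shape of the tableau. -/
theorem exists_of_labelProj_theta_ne_zero (h : IsSeparating T₀ z)
    (hβ : IsSymmetricBicharacter β) (hb : IsSpoBasis β 𝒱 form b deg) (hr : 1 ≤ r)
    {c : ContractionData k} {T : HookTableau r s c.compl}
    (hne : labelProj b (rearrangements c₀.compl z) (theta hr β form b deg c T) ≠ 0) :
    ∃ T' : HookTableau r s c₀.compl,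
      (⟨c, T⟩ : (c : ContractionData k) × HookTableau r s c.compl) = ⟨c₀, T'⟩ ∧
        T'.1.shape = T₀.1.shape := by
  rw [theta_eq] at hne
  obtain ⟨y, σ, hy, hσ, τ, hτ, hyz⟩ := exists_of_labelProj_permAct_ne_zero hβ _ _ hne
  obtain ⟨-, hy₁, hy₂⟩ := (repr_contract_ne_zero hβ hb c _ _).1 hy
  have hσmem : ∀ {x}, x ∈ c.compl → σ x ∈ c.compl := fun {x} hx => by
    by_contra h'
    exact h' (by rwa [σ.injective (hσ _ h')])
  have hτmem : ∀ {x}, x ∈ c₀.compl → τ x ∈ c₀.compl := fun {x} hx => by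
    by_contra h'
    exact h' (by rwa [τ.injective (hτ _ h')])
  have hyletter : ∀ x (hx : x ∈ c.compl), (z ∘ τ) x = T.letter e ⟨σ x, hσmem hx⟩ :=
    fun x hx => by
      rw [← hyz, Function.comp_apply, hy₁ _ (hσmem hx), simpleLabel_of_mem hr T (hσmem hx)]
  have hp : ∀ a, c₀.p a ∉ c₀.compl := fun a h' => (ContractionData.mem_compl.1 h' a).1 rfl
  have hq : ∀ a, c₀.q a ∉ c₀.compl := fun a h' => (ContractionData.mem_compl.1 h' a).2 rfl
  have hp' : ∀ a, c.p a ∉ c.compl := fun a h' => (ContractionData.mem_compl.1 h' a).1 rfl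
  have hq' : ∀ a, c.q a ∉ c.compl := fun a h' => (ContractionData.mem_compl.1 h' a).2 rfl
  -- The labeling `z ∘ τ = y ∘ σ` has two descriptions: `τ` fixes the pairs of `c₀`, so the fresh
  -- labels stay there, and `σ` fixes the pairs of `c`, so those carry mutually dual labels.
  obtain rfl : c = c₀ := by
    refine ContractionData.eq_of_label (z := z ∘ τ) h.injective h.height_pos (fun a => ?_)
      (fun a => ?_) (fun x hx => h.height_compl (hτmem hx)) (fun x hx => h.fresh _ (hτmem hx))
      (fun a => ?_) fun x hx => ?_
    · rw [Function.comp_apply, hτ _ (hp a)]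
    · rw [Function.comp_apply, hτ _ (hq a), h.star]
    · rw [← hyz, Function.comp_apply, Function.comp_apply, hσ _ (hp' a), hσ _ (hq' a), hy₂]
    · rw [hyletter x hx]
      exact T.letter_height_pos _
  refine ⟨T, rfl, ?_⟩
  have hσiff : ∀ x, x ∈ c.compl ↔ σ x ∈ c.compl := fun x => ⟨hσmem, fun hx => by
    by_contra h'
    exact h' (by rwa [hσ x h'] at hx)⟩
  have hτiff : ∀ x, x ∈ c.compl ↔ τ x ∈ c.compl := fun x => ⟨hτmem, fun hx => by
    by_contra h'
    exact h' (by rwa [hτ x h'] at hx)⟩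
  refine HookTableau.shape_eq_of_letter_eq (e := e)
    ((σ.subtypePerm fun x => (hσiff x).symm).symm.trans (τ.subtypePerm fun x => (hτiff x).symm)) ?_
  intro x
  obtain ⟨x, rfl⟩ := (σ.subtypePerm fun x => (hσiff x).symm).surjective x
  rw [Equiv.trans_apply, Equiv.symm_apply_apply, ← h.letter]
  exact (hyletter x.1 x.2).symm

theorem labelProj_theta (h : IsSeparating T₀ z) (hβ : IsSymmetricBicharacter β)
    (hb : IsSpoBasis β 𝒱 form b deg) (hr : 1 ≤ r) {T : HookTableau r s c₀.compl}
    {σ : Equiv.Perm (Fin k)} (hσ : T₀.1.Carries T.1 σ) :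
    ∃ u : κ, u ≠ 0 ∧ labelProj b (rearrangements c₀.compl z) (theta hr β form b deg c₀ T) =
      u • MonoidAlgebra.lift κ _ _ (permRep hβ form b deg k)
        (MonoidAlgebra.single σ 1 * (T₀.1.colSum κ * T₀.1.rowSum κ)) (tensorBasis k b z) := by
  set v := contract β form b deg c₀ (tensorBasis k b (simpleLabel e hr c₀ T)) with hv
  have hp : ∀ a, c₀.p a ∉ c₀.compl := fun a h' => (ContractionData.mem_compl.1 h' a).1 rfl
  have hq : ∀ a, c₀.q a ∉ c₀.compl := fun a h' => (ContractionData.mem_compl.1 h' a).2 rfl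
  have hletter : ∀ x ∈ c₀.compl, (z ∘ σ.symm) x = simpleLabel e hr c₀ T x := by
    intro x hx
    have hx' : σ.symm x ∈ c₀.compl := by
      by_contra h'
      have := hσ.fix _ h'
      rw [Equiv.apply_symm_apply] at this
      exact h' (this ▸ hx)
    have hxx : σ (σ.symm x) ∈ c₀.compl := by rwa [Equiv.apply_symm_apply]
    rw [Function.comp_apply, h.letter ⟨_, hx'⟩, ← hσ.letter_eq hx' hxx, simpleLabel_of_mem hr T hx]
    congr 2
    exact Equiv.apply_symm_apply σ x
  have hfix : ∀ i, i ∉ c₀.compl → σ.symm i = i := hσ.symm.fix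
  have hne : (tensorBasis k b).repr v (z ∘ σ.symm) ≠ 0 := by
    refine (repr_contract_ne_zero hβ hb c₀ _ _).2 ⟨fun a => ?_, hletter, fun a => ?_⟩
    · rw [simpleLabel_p, simpleLabel_q]; rfl
    · rw [Function.comp_apply, Function.comp_apply, hfix _ (hp a), hfix _ (hq a), h.star]
  -- A rearrangement of `z` in the support of `v` is forced everywhere: it equals `z` on the pairs
  -- and shows the letters of `T` elsewhere. Hence just one basis tensor survives.
  have hproj : labelProj b (rearrangements c₀.compl z) v =
      (tensorBasis k b).repr v (z ∘ σ.symm) • tensorBasis k b (z ∘ σ.symm) := by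
    refine labelProj_eq_smul ⟨σ.symm, hfix, rfl⟩ ?_
    rintro _ ⟨τ, hτ, rfl⟩ hy
    obtain ⟨-, hy, -⟩ := (repr_contract_ne_zero hβ hb c₀ _ _).1 hy
    funext i
    by_cases hi : i ∈ c₀.compl
    · rw [hy i hi, hletter i hi]
    · rw [Function.comp_apply, Function.comp_apply, hτ i hi, hfix i hi]
  have hperm : tensorBasis k b (z ∘ σ.symm) = (braidSign β (deg ∘ z) σ : κ)⁻¹ •
      MonoidAlgebra.lift κ _ _ (permRep hβ form b deg k) (MonoidAlgebra.single σ 1)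
        (tensorBasis k b z) := by
    rw [MonoidAlgebra.lift_single, one_smul, permRep_apply, smul_smul,
      inv_mul_cancel₀ (Units.ne_zero _), one_smul]
  refine ⟨(T.1.hookNumber κ)⁻¹ * ((tensorBasis k b).repr v (z ∘ σ.symm) *
    (braidSign β (deg ∘ z) σ : κ)⁻¹), mul_ne_zero (inv_ne_zero (T.1.hookNumber_ne_zero κ))
      (mul_ne_zero hne (inv_ne_zero (Units.ne_zero _))), ?_⟩
  rw [theta_eq, labelProj_permAct_symmetrizer hβ, ← hv, hproj, hperm, permAct_symmetrizer hβ,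
    ← hσ.young_mul_single]
  simp only [map_smul, smul_smul, map_mul, End.mul_apply]

end IsSeparating

theorem linearIndependent_theta (hβ : IsSymmetricBicharacter β)
    (hb : IsSpoBasis β 𝒱 form b deg) (hr : 1 ≤ r) (hk : k ≤ r + s) :
    LinearIndependent κ fun x : (c : ContractionData k) × HookTableau r s c.compl =>
      theta hr β form b deg x.1 x.2 := by
  classical
  rw [linearIndependent_iff']
  rintro S g hg ⟨c₀, T₀⟩ hS
  obtain ⟨z, h⟩ := exists_isSeparating (e := e) hk T₀
  -- Only the indices with datum `c₀` and the shape of `T₀` survive the projection.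
  set S' : Finset (HookTableau r s c₀.compl) :=
    (S.preimage (Sigma.mk c₀) sigma_mk_injective.injOn).filter
      fun T => T.1.shape = T₀.1.shape with hS'
  have hσ : ∀ T : HookTableau r s c₀.compl, ∃ σ, T.1.shape = T₀.1.shape → T₀.1.Carries T.1 σ :=
    fun T => by
      by_cases hT : T.1.shape = T₀.1.shape
      · obtain ⟨σ, hσ⟩ := StandardTableau.exists_carries hT.symm
        exact ⟨σ, fun _ => hσ⟩
      · exact ⟨1, fun h => absurd h hT⟩
  choose σ hσ using hσ
  have hu : ∀ T : HookTableau r s c₀.compl, ∃ u : κ, u ≠ 0 ∧ (T.1.shape = T₀.1.shape →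
      labelProj b (rearrangements c₀.compl z) (theta hr β form b deg c₀ T) =
        u • MonoidAlgebra.lift κ _ _ (permRep hβ form b deg k)
          (MonoidAlgebra.single (σ T) 1 * (T₀.1.colSum κ * T₀.1.rowSum κ)) (tensorBasis k b z)) :=
    fun T => by
      by_cases hT : T.1.shape = T₀.1.shape
      · obtain ⟨u, hu, hu'⟩ := h.labelProj_theta hβ hb hr (hσ T hT)
        exact ⟨u, hu, fun _ => hu'⟩
      · exact ⟨1, one_ne_zero, fun h => absurd h hT⟩
  choose u hu₀ hu using hu
  have hsum : ∑ T ∈ S', g ⟨c₀, T⟩ •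
      labelProj b (rearrangements c₀.compl z) (theta hr β form b deg c₀ T) = 0 := by
    have hg' := congrArg (labelProj b (rearrangements c₀.compl z)) hg
    rw [map_sum, map_zero] at hg'
    rw [← hg']
    have hinj : Set.InjOn (fun T : HookTableau r s c₀.compl =>
        (⟨c₀, T⟩ : (c : ContractionData k) × HookTableau r s c.compl)) S' :=
      fun T _ T' _ h => eq_of_heq (Sigma.mk.inj h).2
    refine Finset.sum_of_injOn _ hinj (fun T hT => ?_) ?_ fun T _ => ?_
    rotate_left 2
    · rw [map_smul]
    · exact Finset.mem_preimage.1 (Finset.mem_filter.1 hT).1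
    · rintro ⟨c, T⟩ hmem hnot
      rw [map_smul]
      by_contra hne
      obtain ⟨T', hT', hshape⟩ :=
        h.exists_of_labelProj_theta_ne_zero hβ hb hr (right_ne_zero_of_smul hne)
      refine hnot ⟨T', ?_, hT'.symm⟩
      rw [hT'] at hmem
      exact Finset.mem_filter.2 ⟨Finset.mem_preimage.2 hmem, hshape⟩
  have hlift : MonoidAlgebra.lift κ _ _ (permRep hβ form b deg k)
      ((∑ T ∈ S', MonoidAlgebra.single (σ T) (g ⟨c₀, T⟩ * u T)) *
        (T₀.1.colSum κ * T₀.1.rowSum κ)) (tensorBasis k b z) = 0 := by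
    rw [← hsum, Finset.sum_mul, map_sum, LinearMap.sum_apply]
    refine Finset.sum_congr rfl fun T hT => ?_
    rw [hu T (Finset.mem_filter.1 hT).2, smul_smul, ← mul_one (g ⟨c₀, T⟩ * u T),
      ← smul_eq_mul (g ⟨c₀, T⟩ * u T) 1, ← MonoidAlgebra.smul_single, smul_mul_assoc, map_smul,
      LinearMap.smul_apply, smul_eq_mul, mul_one]
  have hzero := mul_young_eq_zero_of_lift_eq_zero hβ hb T₀ h.letter
    (fun i hi j => h.eq_of_apply_eq hi) hlift
  have := StandardTableau.coeff_eq_zero_of_sum_mul_young_mul (T₀ := T₀.1)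
    (T := fun T : HookTableau r s c₀.compl => T.1) Subtype.val_injective
    (fun T hT => hσ T (Finset.mem_filter.1 hT).2) hzero T₀
    (Finset.mem_filter.2 ⟨Finset.mem_preimage.2 hS, rfl⟩)
  exact (mul_eq_zero.1 this).resolve_right (hu₀ T₀)

end Independence

end Spo

end

theorem theorem3p11 {κ G V : Type*} [Field κ] [CharZero κ]
    [CommGroup G] [Fintype G] [DecidableEq G] [AddCommGroup V] [Module κ V]
    (β : G → G → κˣ) (hβ : Spo.IsSymmetricBicharacter β)
    (𝒱 : G → Submodule κ V) [DirectSum.Decomposition 𝒱]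
    (form : LinearMap.BilinForm κ V) (hform : Spo.IsColorSkewForm β 𝒱 form)
    (r s e : ℕ) (he : e ≤ 1) (hr : 1 ≤ r)
    (b : Module.Basis (Spo.Idx r s e) κ V) (deg : Spo.Idx r s e → G)
    (hb : Spo.IsSpoBasis β 𝒱 form b deg)
    (k : ℕ) (hk : k ≤ r + s) :
    (∀ (c : Spo.ContractionData k) (T : Spo.HookTableau r s c.compl),
      ∃ μ : Module.Dual κ (Spo.cartan β 𝒱 form b),
        Spo.IsMaximalVector β 𝒱 form b μ (Spo.theta hr β form b deg c T)) ∧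
    LinearIndependent κ
      (fun x : (c : Spo.ContractionData k) × Spo.HookTableau r s c.compl =>
        Spo.theta hr β form b deg x.1 x.2) := by
  exact ⟨fun c T => ⟨_, Spo.isMaximalVector_theta hβ hform hb hr c T⟩,
    Spo.linearIndependent_theta hβ hb hr hk⟩
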